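/- Infinite chess is played on the edgeless board $\mathbb Z\times\mathbb Z$ with the usual movements of kings, queens, rooks, bishops, knights and pawns; there is no castling, promotion, initial two-step pawn move or en passant, and no 50-move or threefold-repetition rule. White pawns advance in the direction $+y$, black pawns in the direction $-y$. A (finite) position is a finite sequence of piece designations $\langle$colour and kind, in play or captured, square$\rangle$, with at most one king of each colour, no two live pieces on one square, and default location $(0,0)$ for captured pieces, together with an indication of whose turn it is. Moves preserve the order of the listing; captured pieces stay listed, marked as captured. A move is legal if it does not leave the mover's own king in check. A position is won for a player $c$ if the opponent is checkmated (is to move, is in check, has no legal move) and $c$ is not in check, or if it is the turn of $c$ and the opponent is in check. It is a stalemate if the player to move has no legal move, neither that player nor the opponent being in check. The game ends at won positions and at stalemates; an infinite play is a draw. Throughout, the moves counted are those of the designated player $c$ only, and a strategy for a player (a possibly partial function of the history of the play, which where undefined leaves the player free to make any legal move) prescribes only legal moves. Consider the following goals of $c$: (M) the position is won for $c$; (S) the position is won for $c$ or is a stalemate (of either player); (R$_k$) the position is won for $c$, or there are a family $F$ of at most $k$ positions (turn included) and a strategy for $c$ such that every play from this position in which $c$ follows the strategy stays in $F$ forever without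 the game ever ending. A position is mate-in-$n$, respectively stalemate-in-$n$, respectively draw-in-$n$-by-$k$-repetition, for $c$ if $c$ has a strategy such that every play from it in which $c$ follows the strategy reaches goal (M), respectively (S), respectively (R$_k$), after at most $n$ moves of $c$. **Theorem.** 1. The mate-in-$n$ problem is computably decidable, uniformly in the finite position, the designated player and $n$. There is a partial computable strategy, a function of $c$ and the current position, that is defined at every position that is mate-in-$n$ for $c$ for some $n$, with $c$ to move and the game not over, and that wins in the fewest moves: from every position that is mate-in-$n$ for $c$, every play in which $c$ follows it reaches a win of $c$ after at most $n$ moves of $c$. 2. There is a computable total strategy for the opponent of $c$, a function of $c$, a number $k$ and the current position, such that, for every position $p$: (a) if $p$ is mate-in-$k$ for $c$, the strategy delays checkmate as long as possible: for every $j$ such that the opponent has some strategy from $p$ that prevents $c$ from having won within the first $j$ moves of $c$, this strategy prevents it too; (b) in general, for every $j\le k$ (in particular for $j=k$), if the opponent has some strategy from $p$ that prevents $c$ from having won within the first $j$ moves of $c$, then this strategy prevents it too. 3. The statements of 1 and 2 hold with "stalemate-in-$n$" and goal (S) in place of "mate-in-$n$" and goal (M). The draw-in-$n$-by-$k$-repetition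 problem is computably decidable, uniformly in the position, the designated player, $n$ and $k$. There is a partial computable strategy for $c$, a function of $c$, $k$ and the history of the play, such that from every position $p$ that is draw-in-$n$-by-$k$-repetition for $c$ the following holds for every play in which $c$ follows it: the strategy is defined whenever $c$ is to move and the game is not over, and after at most $n$ moves of $c$ either $c$ has won or there is a family of at most $k$ positions in which every continuation following the strategy stays forever, without the game ever ending. There is also a computable total strategy for the opponent that delays goal (R$_k$) as long as possible, in the sense of 2 (with (R$_k$) in place of (M)), as a function of $c$, $k$, the horizon and the current position. -/

import Mathlib

namespace InfiniteChess

/-! ### Pieces and positions -/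

/-- The two players. -/
inductive Color
  | white
  | black
  deriving DecidableEq

/-- The opponent of a player. -/
def Color.other : Color → Color
  | .white => .black
  | .black => .white

/-- The kinds of chess pieces. -/
inductive Kind
  | king
  | queen
  | rook
  | bishop
  | knight
  | pawn
  deriving DecidableEq

/-- The squares of the infinite edgeless board. -/
abbrev Square := ℤ × ℤ

/-- A piece designation: colour and kind of the piece, whether it is still in play (`alive`) or
captured, and its location. -/
structure Piece where
  color : Color
  kind : Kind
  alive : Bool
  loc : Square
  deriving DecidableEq

/-- A finite listing of piece designations together with the player whose turn it is to play.
The actual positions of infinite chess are the listings satisfying `Position.Valid`. -/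
structure Position where
  pieces : List Piece
  turn : Color
  deriving DecidableEq

/-- The conditions on a finite position: at most one king of each colour, no two live pieces on the
same square, and captured pieces carry the default location `(0, 0)`. -/
structure Position.Valid (p : Position) : Prop where
  one_king : ∀ c : Color, p.pieces.countP (fun a => a.color = c ∧ a.kind = Kind.king) ≤ 1
  disjoint : p.pieces.Pairwise (fun a b => ¬ (a.alive = true ∧ b.alive = true ∧ a.loc = b.loc))
  captured : ∀ a ∈ p.pieces, a.alive = false → a.loc = (0, 0)

/-! ### Codings of the finite data, needed to speak of computability -/

/-- Colours coded by Booleans. -/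
def Color.equivBool : Color ≃ Bool where
  toFun
    | .white => true
    | .black => false
  invFun
    | true => .white
    | false => .black
  left_inv c := by cases c <;> rfl
  right_inv b := by cases b <;> rfl

/-- Kinds coded by the numbers below six. -/
def Kind.equivFin : Kind ≃ Fin 6 where
  toFun
    | .king => 0
    | .queen => 1
    | .rook => 2
    | .bishop => 3
    | .knight => 4
    | .pawn => 5
  invFun
    | 0 => .king
    | 1 => .queen
    | 2 => .rook
    | 3 => .bishop
    | 4 => .knight
    | 5 => .pawn
  left_inv k := by cases k <;> rfl
  right_inv i := by fin_cases i <;> rfl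

/-- A piece designation as a tuple. -/
def Piece.equivProd : Piece ≃ Color × Kind × Bool × Square where
  toFun a := (a.color, a.kind, a.alive, a.loc)
  invFun t := ⟨t.1, t.2.1, t.2.2.1, t.2.2.2⟩
  left_inv _ := rfl
  right_inv _ := rfl

/-- A position as a pair. -/
def Position.equivProd : Position ≃ List Piece × Color where
  toFun p := (p.pieces, p.turn)
  invFun t := ⟨t.1, t.2⟩
  left_inv _ := rfl
  right_inv _ := rfl

instance : Primcodable Color := Primcodable.ofEquiv Bool Color.equivBool
instance : Primcodable Kind := Primcodable.ofEquiv (Fin 6) Kind.equivFin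
instance : Primcodable Piece := Primcodable.ofEquiv (Color × Kind × Bool × Square) Piece.equivProd
instance : Primcodable Position := Primcodable.ofEquiv (List Piece × Color) Position.equivProd

/-! ### The moves -/

/-- Some live piece stands on the square `s`. -/
def Position.Occupied (p : Position) (s : Square) : Prop :=
  ∃ a ∈ p.pieces, a.alive = true ∧ a.loc = s

/-- Some live piece of colour `c` stands on the square `s`. -/
def Position.OccupiedBy (p : Position) (c : Color) (s : Square) : Prop :=
  ∃ a ∈ p.pieces, a.alive = true ∧ a.color = c ∧ a.loc = s

/-- The four directions of a rook. -/
def rookDirs : List Square := [(1, 0), (-1, 0), (0, 1), (0, -1)]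

/-- The four directions of a bishop. -/
def bishopDirs : List Square := [(1, 1), (1, -1), (-1, 1), (-1, -1)]

/-- From `s` one reaches `t` by going at least one step in one of the given directions, with no
live piece strictly in between. -/
def Position.Slides (p : Position) (dirs : List Square) (s t : Square) : Prop :=
  ∃ d ∈ dirs, ∃ m : ℤ, 0 < m ∧ t = s + m • d ∧ ∀ j : ℤ, 0 < j → j < m → ¬ p.Occupied (s + j • d)

/-- The direction in which the pawns of a player advance along the files. -/
def Color.forward : Color → ℤ
  | .white => 1
  | .black => -1

/-- The piece `a`, standing where it stands, attacks the square `t`: it could capture an opposing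
piece there, irrespective of pins and of what actually stands on `t`. -/
def Position.Attacks (p : Position) (a : Piece) (t : Square) : Prop :=
  match a.kind with
  | .king => t ≠ a.loc ∧ |t.1 - a.loc.1| ≤ 1 ∧ |t.2 - a.loc.2| ≤ 1
  | .queen => p.Slides (rookDirs ++ bishopDirs) a.loc t
  | .rook => p.Slides rookDirs a.loc t
  | .bishop => p.Slides bishopDirs a.loc t
  | .knight => (|t.1 - a.loc.1| = 1 ∧ |t.2 - a.loc.2| = 2) ∨
      (|t.1 - a.loc.1| = 2 ∧ |t.2 - a.loc.2| = 1)
  | .pawn => |t.1 - a.loc.1| = 1 ∧ t.2 = a.loc.2 + a.color.forward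

/-- Player `c` is in check: a live piece of the opponent attacks the live king of `c`. -/
def Position.InCheck (p : Position) (c : Color) : Prop :=
  ∃ k ∈ p.pieces, k.alive = true ∧ k.color = c ∧ k.kind = Kind.king ∧
    ∃ a ∈ p.pieces, a.alive = true ∧ a.color = c.other ∧ p.Attacks a k.loc

/-- The piece `a` may go to the square `t`, apart from the question of exposing its own king. Pawns
advance one step to an empty square or capture diagonally; there is no initial double step,
en passant capture, promotion or castling. -/
def Position.CanGo (p : Position) (a : Piece) (t : Square) : Prop :=
  ¬ p.OccupiedBy a.color t ∧
    if a.kind = Kind.pawn then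
      (t = (a.loc.1, a.loc.2 + a.color.forward) ∧ ¬ p.Occupied t) ∨
        (p.Attacks a t ∧ p.OccupiedBy a.color.other t)
    else p.Attacks a t

/-- The position after the `i`-th piece has been put on the square `t`. The order of the listing is
kept, and a piece that stood on `t` remains listed, marked as captured. -/
def Position.play (p : Position) (i : ℕ) (t : Square) : Position where
  pieces := p.pieces.mapIdx fun j b =>
    if j = i then { b with loc := t }
    else if b.alive = true ∧ b.loc = t then { b with alive := false, loc := (0, 0) }
    else b
  turn := p.turn.other

/-- A legal move of the player whose turn it is transforms `p` into `q`. -/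
def OneMove (p q : Position) : Prop :=
  ∃ (i : ℕ) (a : Piece) (t : Square), p.pieces[i]? = some a ∧ a.alive = true ∧ a.color = p.turn ∧
    p.CanGo a t ∧ q = p.play i t ∧ ¬ q.InCheck p.turn

/-! ### Outcomes -/

/-- Player `c` is checkmated. -/
def Position.Mated (p : Position) (c : Color) : Prop :=
  p.turn = c ∧ p.InCheck c ∧ ¬ ∃ q, OneMove p q

/-- The position is already won for `c`: either the opponent is checkmated while `c` is not in
check, or it is the turn of `c` and the opponent is in check. (The latter can occur only in the
initial position of a game.) -/
def Position.Won (p : Position) (c : Color) : Prop :=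
  (p.Mated c.other ∧ ¬ p.InCheck c) ∨ (p.turn = c ∧ p.InCheck c.other)

/-- Stalemate: the player to move has no legal move, and neither is that player in check nor is
the position already won for that player. -/
def Position.Stalemate (p : Position) : Prop :=
  ¬ p.InCheck p.turn ∧ ¬ p.InCheck p.turn.other ∧ ¬ ∃ q, OneMove p q

/-- The game has ended. -/
def Position.Over (p : Position) : Prop :=
  p.Won Color.white ∨ p.Won Color.black ∨ p.Stalemate

/-! ### Plays and strategies -/

/-- A play starting at `p`: legal moves are made as long as the game is not over; from then on the
sequence is constant. -/
def IsPlay (p : Position) (f : ℕ → Position) : Prop :=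
  f 0 = p ∧ ∀ t, ((f t).Over → f (t + 1) = f t) ∧ (¬ (f t).Over → OneMove (f t) (f (t + 1)))

/-- The history `f 0, …, f t` of a play up to time `t`. -/
def hist (f : ℕ → Position) (t : ℕ) : List Position := (List.range (t + 1)).map f

/-- The number of moves that player `c` has made before time `t`. -/
noncomputable def movesMade (c : Color) (f : ℕ → Position) (t : ℕ) : ℕ :=
  Set.ncard {s : ℕ | s < t ∧ (f s).turn = c ∧ ¬ (f s).Over}

/-- A strategy prescribes a next position for the history of a play (whose last entry is the current
position). It may be partial: where it is silent, the player may make any legal move. -/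
abbrev Strategy := List Position →. Position

/-- The strategy that looks only at the current position. -/
def positional (W : Position →. Position) : Strategy := fun h => (Part.ofOption h.getLast?).bind W

/-- As a strategy for `c`, the strategy prescribes only legal moves. -/
def Legal (σ : Strategy) (c : Color) : Prop :=
  ∀ (h : List Position) (p q : Position), p.Valid → p.turn = c → ¬ p.Over →
    q ∈ σ (h ++ [p]) → OneMove p q

/-- In the play `f`, player `c` follows the strategy `σ`. -/
def Follows (σ : Strategy) (c : Color) (f : ℕ → Position) : Prop :=
  ∀ t, (f t).turn = c → ¬ (f t).Over → ∀ q ∈ σ (hist f t), f (t + 1) = q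

/-- Following `σ` from `p`, player `c` reaches the goal `G` after at most `n` own moves, whatever
the opponent does. -/
def Forces (σ : Strategy) (c : Color) (G : Position → Prop) (n : ℕ) (p : Position) : Prop :=
  ∀ f, IsPlay p f → Follows σ c f → ∃ t, G (f t) ∧ movesMade c f t ≤ n

/-- If the opponent of `c` follows `τ` from `p`, then the goal `G` is not reached within the first
`n` moves of player `c`, whatever `c` does. -/
def Avoids (τ : Strategy) (c : Color) (G : Position → Prop) (n : ℕ) (p : Position) : Prop :=
  ∀ f, IsPlay p f → Follows τ c.other f → ∀ t, G (f t) → n < movesMade c f t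

/-- Player `c` can force the goal `G` from `p` in at most `n` own moves. -/
def CanForce (c : Color) (G : Position → Prop) (n : ℕ) (p : Position) : Prop :=
  ∃ σ, Legal σ c ∧ Forces σ c G n p

/-- The opponent of `c` can avoid that the goal `G` is reached within the first `n` moves of `c`. -/
def CanAvoid (c : Color) (G : Position → Prop) (n : ℕ) (p : Position) : Prop :=
  ∃ τ, Legal τ c.other ∧ Avoids τ c G n p

/-! ### The decision problems -/

/-- The goal of the mate-in-`n` problem: a win of `c`. -/
def mateGoal (c : Color) (p : Position) : Prop := p.Won c

/-- The goal of the stalemate-in-`n` problem: a win of `c` or a stalemate. -/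
def stalemateGoal (c : Color) (p : Position) : Prop := p.Won c ∨ p.Stalemate

/-- Once the history `h` has occurred, the strategy `σ` for `c` keeps the play forever, and without
the game ever ending, inside one family of at most `k` positions. -/
def Confines (σ : Strategy) (c : Color) (k : ℕ) (h : List Position) : Prop :=
  ∃ F : Finset Position, F.card ≤ k ∧
    ∀ p f, IsPlay p f → Follows σ c f → ∀ t, hist f t = h → ∀ s, t ≤ s → f s ∈ F ∧ ¬ (f s).Over

/-- From the position `p` player `c` can force the opponent to remain perpetually inside a family of
`k` positions. -/
def CanConfine (c : Color) (k : ℕ) (p : Position) : Prop :=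
  ∃ σ, Legal σ c ∧ Confines σ c k [p]

/-- The goal of the draw-in-`n`-by-`k`-repetition problem: a win of `c`, or a position in which `c`
has the opponent confined to a family of `k` positions. -/
def repetitionGoal (c : Color) (k : ℕ) (p : Position) : Prop := p.Won c ∨ CanConfine c k p

/-- Player `c` can force a win from `p` in at most `n` moves. -/
def MateIn (c : Color) (n : ℕ) (p : Position) : Prop := CanForce c (mateGoal c) n p

/-- Player `c` can force a stalemate or a win from `p` in at most `n` moves. -/
def StalemateIn (c : Color) (n : ℕ) (p : Position) : Prop := CanForce c (stalemateGoal c) n p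

/-- Player `c` can in at most `n` moves force a win or force the opponent into a family of `k`
positions inside of which `c` can force the opponent perpetually to remain. -/
def DrawIn (c : Color) (n k : ℕ) (p : Position) : Prop := CanForce c (repetitionGoal c k) n p

/-- Following `σ` from `p`, player `c` either wins or, after at most `n` own moves, has the opponent
in a family of `k` positions that is never left again as long as `c` continues to follow `σ`. -/
def ForcesRepetition (σ : Strategy) (c : Color) (n k : ℕ) (p : Position) : Prop :=
  ∀ f, IsPlay p f → Follows σ c f →
    ∃ t, movesMade c f t ≤ n ∧ ((f t).Won c ∨ Confines σ c k (hist f t))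

end InfiniteChess

namespace InfiniteChess

/-! ### Finite pieces of Presburger back-and-forth -/

/-! A position may have infinitely many legal moves, so the recursion defining "forced within n
plies" is not visibly decidable. The remedy is that the rules never multiply coordinates. Attack,
blocking, check and capture depend only on the signs of short signed sums of coordinates and of the
constant 1; even the quantifier over the squares between two squares becomes one over the listed
pieces (`slides_iff`). This permits a back-and-forth argument in the style of Presburger arithmetic.

Under a relation that is `Good A M`, signed sums of at most `A` related pairs have equal signs, and
related integers agree modulo `M`. By `Good.exists_extend'` a new integer on the left is matched by
one of explicitly bounded size on the right, if `A` and `M` may shrink. Positions with related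
coordinates therefore imitate each other's moves (`Sim.exists_legalMove`). Applied to a position and
itself, this shows that every legal move is equivalent, as far as the next `j` plies can tell, to a
legal move into a computable finite box (`exists_mem_moves`). So `forced_succ_iff` is a recursion
over finite lists, and `Forced` is primitive recursive for every goal that is itself primitive
recursive and respected by `Sim`.

Confinement to `k` positions is such a goal: a closed family can be grown from its starting position
by adding successors one at a time, and representatives of these successors suffice
(`completable_iff`, `canConfine_iff`).

Call the rank of a position the least number of plies in which the goal is forced. Player `c`
searches for the rank and makes a move that lowers it; the opponent, with a horizon given, makes a
move that keeps it as large as possible. Pitting one strategy against the other shows that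
`CanForce` is exactly `Forced` at the matching number of plies (`IsGoal.canForce_iff`) and that both
strategies are optimal. For repetition, the history recalls the first confinable position reached,
and `c` stays in one closed family computed from it. -/

/-- Simultaneous signed sums, with at most `n` summands, of pairs related by `R`. -/
inductive Combo (R : ℤ → ℤ → Prop) : ℕ → ℤ → ℤ → Prop
  | zero (n : ℕ) : Combo R n 0 0
  | add {n : ℕ} {a b x y : ℤ} : Combo R n a b → R x y → Combo R (n + 1) (a + x) (b + y)
  | sub {n : ℕ} {a b x y : ℤ} : Combo R n a b → R x y → Combo R (n + 1) (a - x) (b - y)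

namespace Combo

variable {R S : ℤ → ℤ → Prop} {m n : ℕ} {a b c d : ℤ}

theorem mono (h : Combo R m a b) : ∀ {n : ℕ}, m ≤ n → Combo R n a b := by
  induction h with
  | zero n => exact fun _ => zero _
  | add _ hr ih =>
    intro n hn
    obtain ⟨k, rfl⟩ : ∃ k, n = k + 1 := ⟨n - 1, by omega⟩
    exact (ih (by omega)).add hr
  | sub _ hr ih =>
    intro n hn
    obtain ⟨k, rfl⟩ : ∃ k, n = k + 1 := ⟨n - 1, by omega⟩
    exact (ih (by omega)).sub hr

theorem of_rel (h : R a b) : Combo R 1 a b := by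
  simpa using (zero 0).add h

theorem neg (h : Combo R n a b) : Combo R n (-a) (-b) := by
  induction h with
  | zero n => simpa using zero n
  | add _ hr ih =>
    rw [neg_add, neg_add, ← sub_eq_add_neg, ← sub_eq_add_neg]
    exact ih.sub hr
  | sub _ hr ih =>
    rw [neg_sub', neg_sub', sub_neg_eq_add, sub_neg_eq_add]
    exact ih.add hr

theorem sum (h : Combo R m a b) (h' : Combo R n c d) : Combo R (m + n) (a + c) (b + d) := by
  induction h' with
  | zero n => simpa using h.mono (Nat.le_add_right m n)
  | add _ hr ih => simpa only [add_assoc] using ih.add hr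
  | sub _ hr ih => simpa only [add_sub_assoc, add_assoc] using ih.sub hr

theorem diff (h : Combo R m a b) (h' : Combo R n c d) : Combo R (m + n) (a - c) (b - d) := by
  simpa only [sub_eq_add_neg] using h.sum h'.neg

theorem nsmul (h : Combo R n a b) (k : ℕ) : Combo R (k * n) (k * a) (k * b) := by
  induction k with
  | zero => simpa using zero _
  | succ k ih =>
    have := ih.sum h
    rw [Nat.succ_mul]
    push_cast
    rwa [add_mul, add_mul, one_mul, one_mul]

theorem swap (h : Combo R n a b) : Combo (fun x y => R y x) n b a := by
  induction h with
  | zero n => exact zero n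
  | add _ hr ih => exact ih.add hr
  | sub _ hr ih => exact ih.sub hr

theorem natCast (h : R 1 1) (k : ℕ) : Combo R k (k : ℤ) (k : ℤ) := by
  simpa using (of_rel h).nsmul k

theorem dvd_sub {M : ℤ} (hM : ∀ x y, R x y → M ∣ x - y) (h : Combo R n a b) : M ∣ a - b := by
  induction h with
  | zero n => simp
  | add _ hr ih =>
    rw [add_sub_add_comm]
    exact dvd_add ih (hM _ _ hr)
  | sub _ hr ih =>
    rw [sub_sub_sub_comm]
    exact _root_.dvd_sub ih (hM _ _ hr)

theorem abs_le {X : ℤ} (hX : ∀ x y, R x y → |y| ≤ X) (hX₀ : 0 ≤ X) (h : Combo R n a b) :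
    |b| ≤ n * X := by
  induction h with
  | zero n => simpa using mul_nonneg (Nat.cast_nonneg n) hX₀
  | add _ hr ih =>
    have := hX _ _ hr
    push_cast
    rw [add_mul, one_mul]
    exact (abs_add_le _ _).trans (add_le_add ih this)
  | sub _ hr ih =>
    have := hX _ _ hr
    push_cast
    rw [add_mul, one_mul]
    exact (abs_sub _ _).trans (add_le_add ih this)

end Combo

/-- The relation `R` together with one more pair. -/
def extend (R : ℤ → ℤ → Prop) (u v : ℤ) (a b : ℤ) : Prop := R a b ∨ (a = u ∧ b = v)

/-- Collecting the occurrences of the new pair leaves a sum over `R` plus a multiple of that pair.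
The bound on `e` limits the coefficients of the new pair to finitely many. -/
theorem Combo.of_extend {R : ℤ → ℤ → Prop} {u v : ℤ} {n : ℕ} {a b : ℤ}
    (h : Combo (extend R u v) n a b) :
    ∃ e a₀ b₀ : ℤ, |e| ≤ n ∧ Combo R n a₀ b₀ ∧ a = a₀ + e * u ∧ b = b₀ + e * v := by
  induction h with
  | zero n => exact ⟨0, 0, 0, by simp, zero n, by simp, by simp⟩
  | add _ hr ih =>
    obtain ⟨e, a₀, b₀, he, h, rfl, rfl⟩ := ih
    rcases hr with hr | ⟨rfl, rfl⟩
    · exact ⟨e, _, _, by push_cast; linarith, h.add hr, by ring, by ring⟩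
    · refine ⟨e + 1, _, _, ?_, h.mono (Nat.le_succ _), by ring, by ring⟩
      push_cast
      exact (abs_add_le _ _).trans (by simpa using he)
  | sub _ hr ih =>
    obtain ⟨e, a₀, b₀, he, h, rfl, rfl⟩ := ih
    rcases hr with hr | ⟨rfl, rfl⟩
    · exact ⟨e, _, _, by push_cast; linarith, h.sub hr, by ring, by ring⟩
    · refine ⟨e - 1, _, _, ?_, h.mono (Nat.le_succ _), by ring, by ring⟩
      push_cast
      exact (abs_sub _ _).trans (by simpa using he)

/-- Related tuples of integers satisfy the same linear inequalities with coefficients of total size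
at most `A`, and are congruent modulo `M`. -/
structure Good (A M : ℕ) (R : ℤ → ℤ → Prop) : Prop where
  one : R 1 1
  zero : R 0 0
  pos_iff : ∀ a b, Combo R A a b → (0 < a ↔ 0 < b)
  dvd_sub : ∀ a b, R a b → (M : ℤ) ∣ a - b

namespace Good

variable {A B M N : ℕ} {R : ℤ → ℤ → Prop}

theorem mono (h : Good B N R) (hA : A ≤ B) (hM : M ∣ N) : Good A M R where
  one := h.one
  zero := h.zero
  pos_iff a b hab := h.pos_iff a b (hab.mono hA)
  dvd_sub a b hab := (Int.natCast_dvd_natCast.2 hM).trans (h.dvd_sub a b hab)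

theorem swap (h : Good A M R) : Good A M (fun x y => R y x) where
  one := h.one
  zero := h.zero
  pos_iff a b hab := (h.pos_iff b a hab.swap).symm
  dvd_sub a b hab := (dvd_sub_comm).1 (h.dvd_sub b a hab)

theorem diag {X : ℤ} (hX : 1 ≤ X) : Good A M (fun a b => a = b ∧ |b| ≤ X) where
  one := ⟨rfl, by simpa using hX⟩
  zero := ⟨rfl, by rw [abs_zero]; linarith⟩
  pos_iff a b hab := by
    have : a = b := by
      induction hab with
      | zero n => rfl
      | add _ hr ih => rw [ih, hr.1]
      | sub _ hr ih => rw [ih, hr.1]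
    rw [this]
  dvd_sub a b hab := by rw [hab.1, sub_self]; exact dvd_zero _

/-- Preservation of positivity is enough for all three signs, since signed sums are closed under
negation. -/
theorem sign_eq (h : Good A M R) {n : ℕ} {a b : ℤ} (hc : Combo R n a b) (hn : n ≤ A) :
    a.sign = b.sign := by
  have h₁ := h.pos_iff _ _ (hc.mono hn)
  have h₂ := h.pos_iff _ _ (hc.mono hn).neg
  rcases lt_trichotomy a 0 with ha | rfl | ha
  · rw [Int.sign_eq_neg_one_of_neg ha, Int.sign_eq_neg_one_of_neg (by omega)]
  · rw [show b = 0 by omega]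
  · rw [Int.sign_eq_one_of_pos ha, Int.sign_eq_one_of_pos (by omega)]

/-- A nonzero coefficient `e` of the new pair is normalised to `L` by multiplying with `k = L / e`,
whose sign cancels afterwards. Since `|k| ≤ L`, it suffices to compare `L * u` and `L * v` with sums
of length `L * A`. -/
theorem extend_of_sign {L u v : ℤ} (h : Good A M R) (hL : 0 < L)
    (hLdvd : ∀ e : ℤ, e ≠ 0 → |e| ≤ A → e ∣ L) (hdvd : (M : ℤ) ∣ u - v)
    (hsign : ∀ α β, Combo R (L.toNat * A) α β → (L * u - α).sign = (L * v - β).sign) :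
    Good A M (extend R u v) where
  one := Or.inl h.one
  zero := Or.inl h.zero
  pos_iff a b hab := by
    obtain ⟨e, a₀, b₀, he, hc, rfl, rfl⟩ := hab.of_extend
    rcases eq_or_ne e 0 with rfl | he₀
    · simpa using h.pos_iff _ _ hc
    obtain ⟨k, hk⟩ := hLdvd e he₀ he
    have hk₀ : k ≠ 0 := by rintro rfl; simp at hk; omega
    have hkL : k.natAbs ≤ L.toNat := by
      have h₁ : L.natAbs = e.natAbs * k.natAbs := by rw [hk, Int.natAbs_mul]
      have h₂ : L.natAbs = L.toNat := by omega
      rw [← h₂, h₁]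
      exact Nat.le_mul_of_pos_left _ (Int.natAbs_pos.2 he₀)
    have hcomb : Combo R (L.toNat * A) (-(k * a₀)) (-(k * b₀)) := by
      rcases Int.natAbs_eq k with hk' | hk'
      · rw [hk']
        exact ((hc.nsmul k.natAbs).mono (Nat.mul_le_mul_right A hkL)).neg
      · rw [hk', neg_mul, neg_mul, neg_neg, neg_neg]
        exact (hc.nsmul k.natAbs).mono (Nat.mul_le_mul_right A hkL)
    have hs := hsign _ _ hcomb
    rw [show L * u - -(k * a₀) = k * (a₀ + e * u) by rw [hk]; ring,
      show L * v - -(k * b₀) = k * (b₀ + e * v) by rw [hk]; ring, Int.sign_mul, Int.sign_mul] at hs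
    have hs' := mul_left_cancel₀ (by simpa [Int.sign_eq_zero_iff_zero] using hk₀) hs
    rw [← Int.sign_eq_one_iff_pos, hs', Int.sign_eq_one_iff_pos]
  dvd_sub a b hab := by
    rcases hab with hab | ⟨rfl, rfl⟩
    · exact h.dvd_sub _ _ hab
    · exact hdvd

/-- Locate `L * u` among the values of short sums: let `α₀` be the greatest one not above it and `r`
the gap. On the right, `L * v` is put at distance `r'` above the partner `β₀`, where `r'` is
congruent to `r`, at most `r` and at most `L * M`, and positive when `r` is. Sums up to `α₀` then
stay on their side because signs of differences are preserved, and sums above `L * u` because `r' ≤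
r`. -/
theorem exists_sign_of_nonneg {L u : ℤ} (hL : 0 < L) (hM : 0 < M)
    (h : Good (2 * (L.toNat * A) + L.toNat * M) (L.toNat * M) R) (hu : 0 ≤ u) :
    ∃ v : ℤ, (M : ℤ) ∣ u - v ∧
      (∀ X : ℤ, 0 ≤ X → (∀ a b, R a b → |b| ≤ X) → |v| ≤ L * (A * X + M)) ∧
      ∀ α β, Combo R (L.toNat * A) α β → (L * u - α).sign = (L * v - β).sign := by
  have hLt : (L.toNat : ℤ) = L := Int.toNat_of_nonneg hL.le
  have hLM : 0 < L * M := by positivity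
  -- The sign of `u` matters here: it makes the empty sum an admissible value, so that a greatest
  -- one exists.
  obtain ⟨α₀, ⟨⟨β₀, hc₀⟩, hα₀⟩, hmax⟩ := Int.exists_greatest_of_bdd
    (P := fun α => (∃ β, Combo R (L.toNat * A) α β) ∧ α ≤ L * u)
    ⟨L * u, fun z hz => hz.2⟩ ⟨0, ⟨0, Combo.zero _⟩, by positivity⟩
  obtain ⟨r, hr₀, hr⟩ : ∃ r, 0 ≤ r ∧ L * u = α₀ + r := ⟨L * u - α₀, by omega, by omega⟩
  obtain ⟨r', hr'₀, hr'r, hr'M, hpos, hdvd⟩ : ∃ r' : ℤ, 0 ≤ r' ∧ r' ≤ r ∧ r' ≤ L * M ∧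
      (0 < r → 0 < r') ∧ L * M ∣ r - r' := by
    rcases hr₀.eq_or_lt with rfl | hr₀
    · exact ⟨0, le_rfl, le_rfl, hLM.le, id, by simp⟩
    · have h₁ := Int.emod_nonneg (r - 1) hLM.ne'
      have h₂ := Int.emod_lt_of_pos (r - 1) hLM
      have h₃ : (r - 1) % (L * M) ≤ r - 1 := by
        have h₄ := Int.mul_ediv_add_emod (r - 1) (L * M)
        have h₅ := mul_nonneg hLM.le (Int.ediv_nonneg (show 0 ≤ r - 1 by omega) hLM.le)
        omega
      -- The representative of `r` in `{1, ..., L * M}`; the shift by one keeps a positive gap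
      -- positive.
      refine ⟨(r - 1) % (L * M) + 1, by omega, by omega, by omega, fun _ => by omega, ?_⟩
      rw [show r - ((r - 1) % (L * M) + 1) = (r - 1) - (r - 1) % (L * M) by ring]
      exact Int.dvd_self_sub_emod
  -- Related pairs agree modulo `L * M` and not just modulo `M`, so `β₀ + r'` is divisible by `L`
  -- and the quotient is congruent to `u` modulo `M`.
  have hcong : L * M ∣ L * u - (β₀ + r') := by
    have h₁ : ((L.toNat * M : ℕ) : ℤ) ∣ α₀ - β₀ := hc₀.dvd_sub h.dvd_sub
    push_cast at h₁
    rw [hLt] at h₁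
    rw [hr, show α₀ + r - (β₀ + r') = (α₀ - β₀) + (r - r') by ring]
    exact dvd_add h₁ hdvd
  obtain ⟨w, hw⟩ := hcong
  have hv : L * (u - M * w) = β₀ + r' := by linear_combination hw
  refine ⟨u - M * w, ⟨w, by ring⟩, fun X hX hR => ?_, ?_⟩
  · have hb : |β₀| ≤ L * A * X := by
      have := hc₀.abs_le hR hX
      push_cast at this
      rwa [hLt] at this
    have h₁ : |u - M * w| ≤ |L * (u - M * w)| := by
      rw [abs_mul, abs_of_pos hL]
      exact le_mul_of_one_le_left (abs_nonneg _) hL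
    rw [hv] at h₁
    have h₂ : |β₀ + r'| ≤ |β₀| + r' := (abs_add_le _ _).trans (by rw [abs_of_nonneg hr'₀])
    have h₃ : L * (A * X + M) = L * A * X + L * M := by ring
    rw [h₃]
    linarith
  · intro α β hc
    rw [hv, hr]
    have hcc := h.sign_eq (hc₀.diff hc) (by omega)
    rcases lt_or_ge (L * u) α with hα | hα
    · have hr'N : r'.toNat ≤ L.toNat * M := by
        zify
        rw [hLt, Int.toNat_of_nonneg hr'₀]
        exact hr'M
      -- Here `α - α₀` exceeds `r`, hence `r'`. Subtracting `r'` copies of the pair `(1, 1)` costs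
      -- at most `L * M` summands, which explains the last term of the coefficient bound in the
      -- hypothesis.
      have h₁ := h.sign_eq ((hc.diff hc₀).diff (Combo.natCast h.one r'.toNat)) (by omega)
      rw [Int.toNat_of_nonneg hr'₀] at h₁
      rw [Int.sign_eq_one_of_pos (by omega)] at h₁
      have h₂ := Int.sign_eq_one_iff_pos.1 h₁.symm
      rw [Int.sign_eq_neg_one_of_neg (by omega), Int.sign_eq_neg_one_of_neg (by omega)]
    · rcases (hmax α ⟨⟨β, hc⟩, hα⟩).eq_or_lt with rfl | hlt
      · rw [sub_self, Int.sign_zero] at hcc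
        have : β₀ - β = 0 := Int.sign_eq_zero_iff_zero.1 hcc.symm
        rw [show α + r - α = r by ring, show β₀ + r' - β = r' by omega]
        rcases hr₀.eq_or_lt with h₀ | h₀
        · rw [show r' = r by omega]
        · rw [Int.sign_eq_one_of_pos h₀, Int.sign_eq_one_of_pos (hpos h₀)]
      · rw [Int.sign_eq_one_of_pos (by omega)] at hcc
        have := Int.sign_eq_one_iff_pos.1 hcc.symm
        rw [Int.sign_eq_one_of_pos (by omega), Int.sign_eq_one_of_pos (by omega)]

theorem exists_sign {L u : ℤ} (hL : 0 < L) (hM : 0 < M)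
    (h : Good (2 * (L.toNat * A) + L.toNat * M) (L.toNat * M) R) :
    ∃ v : ℤ, (M : ℤ) ∣ u - v ∧
      (∀ X : ℤ, 0 ≤ X → (∀ a b, R a b → |b| ≤ X) → |v| ≤ L * (A * X + M)) ∧
      ∀ α β, Combo R (L.toNat * A) α β → (L * u - α).sign = (L * v - β).sign := by
  rcases le_total 0 u with hu | hu
  · exact exists_sign_of_nonneg hL hM h hu
  · obtain ⟨v, hv, hb, hs⟩ := exists_sign_of_nonneg hL hM h (u := -u) (by omega)
    refine ⟨-v, ?_, by simpa only [abs_neg] using hb, fun α β hc => ?_⟩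
    · rw [show u - -v = -(-u - v) by ring]
      exact (dvd_neg).2 hv
    · have := hs _ _ hc.neg
      rw [show L * -u - -α = -(L * u - α) by ring, show L * v - -β = -(L * -v - β) by ring,
        Int.sign_neg, Int.sign_neg] at this
      exact neg_injective this

end Good

/-- The choice `L = A!` is divisible by every nonzero coefficient of size at most `A`. -/
theorem Good.exists_extend' {A M : ℕ} {R : ℤ → ℤ → Prop} (hM : 0 < M)
    (h : Good (2 * (A.factorial * A) + A.factorial * M) (A.factorial * M) R) (u : ℤ) :
    ∃ v : ℤ, Good A M (extend R u v) ∧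
      ∀ X : ℤ, 0 ≤ X → (∀ a b, R a b → |b| ≤ X) → |v| ≤ A.factorial * (A * X + M) := by
  have hf := A.factorial_pos
  obtain ⟨v, hv, hb, hs⟩ := Good.exists_sign (L := A.factorial) (u := u) (by exact_mod_cast hf)
    hM (by simpa using h)
  refine ⟨v, Good.extend_of_sign (L := A.factorial) ?_ (by exact_mod_cast hf) ?_ hv hs, hb⟩
  · refine h.mono ?_ (Dvd.intro_left _ rfl)
    have : 1 * A ≤ A.factorial * A := Nat.mul_le_mul_right A hf
    omega
  · intro e he heA
    rw [← Int.natAbs_dvd_natAbs, Int.natAbs_natCast]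
    rw [Int.abs_eq_natAbs] at heA
    exact Nat.dvd_factorial (Int.natAbs_pos.2 he) (by exact_mod_cast heA)

/-! ### The ladder of coefficient bounds and moduli -/

/-- Bounds for coefficients and moduli that suffice for `j` further extensions. -/
def level : ℕ → ℕ × ℕ
  -- Eight summands cover every test of the rules: a coordinate difference takes two, its comparison
  -- with an integer up to 3 takes five, a diagonal condition four.
  | 0 => (8, 1)
  | j + 1 => (2 * ((level j).1.factorial * (level j).1) + (level j).1.factorial * (level j).2,
      (level j).1.factorial * (level j).2)

theorem level_snd_pos (j : ℕ) : 0 < (level j).2 := by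
  induction j with
  | zero => simp [level]
  | succ j ih => exact Nat.mul_pos (Nat.factorial_pos _) ih

theorem level_fst_mono {i j : ℕ} (h : i ≤ j) : (level i).1 ≤ (level j).1 := by
  refine monotone_nat_of_le_succ (f := fun j => (level j).1) (fun j => ?_) h
  have : 1 * (level j).1 ≤ (level j).1.factorial * (level j).1 :=
    Nat.mul_le_mul_right _ (Nat.factorial_pos _)
  simp only [level]
  omega

theorem level_snd_dvd {i j : ℕ} (h : i ≤ j) : (level i).2 ∣ (level j).2 := by
  induction j, h using Nat.le_induction with
  | base => exact dvd_rfl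
  | succ j _ ih => exact ih.trans (Dvd.intro_left _ rfl)

/-- A relation good enough for imitating `j` moves. -/
def Sim (j : ℕ) (R : ℤ → ℤ → Prop) : Prop := Good (level (2 * j)).1 (level (2 * j)).2 R

/-- The growth of the bounds in one extension. -/
def extendBound (j X : ℕ) : ℕ := (level j).1.factorial * ((level j).1 * X + (level j).2)

/-- The growth of the bounds when one move is imitated. -/
def moveBound (j X : ℕ) : ℕ := extendBound (2 * j) (extendBound (2 * j + 1) X)

theorem le_extendBound (j X : ℕ) : X ≤ extendBound j X := by
  have h₁ : 8 ≤ (level j).1 := level_fst_mono (Nat.zero_le j)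
  calc X = 1 * (1 * X) := by ring
    _ ≤ (level j).1.factorial * ((level j).1 * X + (level j).2) :=
      Nat.mul_le_mul (Nat.factorial_pos _)
        ((Nat.mul_le_mul_right X (by omega)).trans (Nat.le_add_right _ _))

theorem Good.exists_extend {j : ℕ} {R : ℤ → ℤ → Prop}
    (h : Good (level (j + 1)).1 (level (j + 1)).2 R) (u : ℤ) :
    ∃ v : ℤ, Good (level j).1 (level j).2 (extend R u v) ∧
      ∀ X : ℕ, (∀ a b, R a b → |b| ≤ (X : ℤ)) →
        ∀ a b, extend R u v a b → |b| ≤ (extendBound j X : ℤ) := by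
  obtain ⟨v, hv, hb⟩ := Good.exists_extend' (level_snd_pos j) h u
  refine ⟨v, hv, fun X hR => ?_⟩
  rintro a b (hab | ⟨rfl, rfl⟩)
  · exact (hR a b hab).trans (by exact_mod_cast le_extendBound j X)
  · simpa [extendBound] using hb X (Nat.cast_nonneg X) hR

namespace Sim

variable {i j : ℕ} {R : ℤ → ℤ → Prop}

theorem mono (h : Sim j R) (hij : i ≤ j) : Sim i R :=
  Good.mono h (level_fst_mono (by omega)) (level_snd_dvd (by omega))

theorem swap (h : Sim j R) : Sim j (fun x y => R y x) := Good.swap h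

theorem diag (j : ℕ) {X : ℤ} (hX : 1 ≤ X) : Sim j (fun a b => a = b ∧ |b| ≤ X) := Good.diag hX

theorem sign_eq (h : Sim j R) {n : ℕ} {a b : ℤ} (hc : Combo R n a b) (hn : n ≤ 8) :
    a.sign = b.sign :=
  Good.sign_eq h hc (hn.trans (level_fst_mono (Nat.zero_le _)))

/-- Two new coordinates on the left can be matched by two on the right. -/
theorem exists_extend₂ (h : Sim (j + 1) R) (s : Square) :
    ∃ (s' : Square) (S : ℤ → ℤ → Prop), Sim j S ∧ (∀ a b, R a b → S a b) ∧ S s.1 s'.1 ∧ S s.2 s'.2 ∧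
      ∀ X : ℕ, (∀ a b, R a b → |b| ≤ (X : ℤ)) → ∀ a b, S a b → |b| ≤ (moveBound j X : ℤ) := by
  -- A square costs two extensions, hence the factor two in the index of `level` in `Sim`.
  obtain ⟨v, hv, hb⟩ := Good.exists_extend (j := 2 * j + 1) h s.1
  obtain ⟨w, hw, hb'⟩ := Good.exists_extend (j := 2 * j) hv s.2
  exact ⟨(v, w), _, hw, fun a b hab => Or.inl (Or.inl hab), Or.inl (Or.inr ⟨rfl, rfl⟩),
    Or.inr ⟨rfl, rfl⟩, fun X hR => hb' _ (hb X hR)⟩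

end Sim

/-! ### Positions of the same shape with related coordinates -/

/-- Both coordinates of two squares are related. -/
def SqRel (R : ℤ → ℤ → Prop) (s s' : Square) : Prop := R s.1 s'.1 ∧ R s.2 s'.2

/-- Two piece designations agree up to related locations. -/
structure PieceRel (R : ℤ → ℤ → Prop) (a a' : Piece) : Prop where
  color : a.color = a'.color
  kind : a.kind = a'.kind
  alive : a.alive = a'.alive
  loc : SqRel R a.loc a'.loc

/-- Two positions agree up to related locations of the pieces. -/
structure PosRel (R : ℤ → ℤ → Prop) (p p' : Position) : Prop where
  turn : p.turn = p'.turn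
  length : p.pieces.length = p'.pieces.length
  piece : ∀ (i : ℕ) (a a' : Piece), p.pieces[i]? = some a → p'.pieces[i]? = some a' → PieceRel R a a'

/-- All coordinates of the pieces are bounded by `X`. -/
def InBox (X : ℕ) (p : Position) : Prop := ∀ a ∈ p.pieces, |a.loc.1| ≤ (X : ℤ) ∧ |a.loc.2| ≤ (X : ℤ)

/-- The move of the `i`-th piece to `t` is legal. -/
def Position.LegalMove (p : Position) (i : ℕ) (t : Square) : Prop :=
  ∃ a, p.pieces[i]? = some a ∧ a.alive = true ∧ a.color = p.turn ∧ p.CanGo a t ∧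
    ¬ (p.play i t).InCheck p.turn

theorem oneMove_iff {p q : Position} : OneMove p q ↔ ∃ i t, p.LegalMove i t ∧ q = p.play i t := by
  constructor
  · rintro ⟨i, a, t, h₁, h₂, h₃, h₄, h₅, h₆⟩
    exact ⟨i, t, ⟨a, h₁, h₂, h₃, h₄, h₅ ▸ h₆⟩, h₅⟩
  · rintro ⟨i, t, ⟨a, h₁, h₂, h₃, h₄, h₆⟩, h₅⟩
    exact ⟨i, a, t, h₁, h₂, h₃, h₄, h₅, h₅ ▸ h₆⟩

/-- The square `t` lies strictly beyond `s` in the direction `d`. -/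
def OnRay (d s t : Square) : Prop := ∃ m : ℤ, 0 < m ∧ t = s + m • d

/-- Directions have entries in `{-1, 0, 1}`, so the step count can be eliminated: signs of the
coordinate differences remain and, on diagonals, a linear equation. In this form the condition
survives passage along a `Sim`. -/
theorem onRay_iff {d s t : Square} (hd : d ∈ rookDirs ++ bishopDirs) :
    OnRay d s t ↔ (t.1 - s.1).sign = d.1 ∧ (t.2 - s.2).sign = d.2 ∧
      (d.1 ≠ 0 → d.2 ≠ 0 → d.1 * (t.1 - s.1) = d.2 * (t.2 - s.2)) := by
  obtain ⟨s₁, s₂⟩ := s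
  obtain ⟨t₁, t₂⟩ := t
  constructor
  · rintro ⟨m, hm, h⟩
    simp only [Prod.ext_iff, Prod.fst_add, Prod.snd_add, Prod.smul_fst, Prod.smul_snd,
      smul_eq_mul] at h
    simp only [h.1, h.2, add_sub_cancel_left, Int.sign_mul, Int.sign_eq_one_of_pos hm, one_mul]
    simp only [rookDirs, bishopDirs, List.cons_append, List.nil_append, List.mem_cons,
      List.not_mem_nil, or_false] at hd
    rcases hd with rfl | rfl | rfl | rfl | rfl | rfl | rfl | rfl <;> simp
  · rintro ⟨h₁, h₂, h₃⟩
    simp only [rookDirs, bishopDirs, List.cons_append, List.nil_append, List.mem_cons,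
      List.not_mem_nil, or_false] at hd
    rcases hd with rfl | rfl | rfl | rfl | rfl | rfl | rfl | rfl <;>
      simp only [Int.sign_eq_one_iff_pos, Int.sign_eq_neg_one_iff_neg,
        Int.sign_eq_zero_iff_zero] at h₁ h₂ <;>
      simp only [OnRay, Prod.ext_iff, Prod.fst_add, Prod.snd_add, Prod.smul_fst, Prod.smul_snd,
        smul_eq_mul]
    · exact ⟨t₁ - s₁, by omega, by omega, by omega⟩
    · exact ⟨s₁ - t₁, by omega, by omega, by omega⟩
    · exact ⟨t₂ - s₂, by omega, by omega, by omega⟩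
    · exact ⟨s₂ - t₂, by omega, by omega, by omega⟩
    all_goals
      have h₄ := h₃ (by decide) (by decide)
      simp only at h₄
    · exact ⟨t₁ - s₁, by omega, by omega, by omega⟩
    · exact ⟨t₁ - s₁, by omega, by omega, by omega⟩
    · exact ⟨s₁ - t₁, by omega, by omega, by omega⟩
    · exact ⟨s₁ - t₁, by omega, by omega, by omega⟩

/-- An obstructing square strictly between `s` and `t` is one beyond `s` from which `t` lies beyond.
The unbounded quantifier over intermediate squares thus turns into one over the pieces, with no new
coordinates to match. -/
theorem slides_iff {p : Position} {dirs : List Square} {s t : Square}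
    (hdirs : dirs ⊆ rookDirs ++ bishopDirs) :
    p.Slides dirs s t ↔ ∃ d ∈ dirs, OnRay d s t ∧
      ∀ b ∈ p.pieces, b.alive = true → ¬ (OnRay d s b.loc ∧ OnRay d b.loc t) := by
  constructor
  · rintro ⟨d, hd, m, hm, rfl, h⟩
    refine ⟨d, hd, ⟨m, hm, rfl⟩, fun b hb hba => ?_⟩
    rintro ⟨⟨j, hj, hbs⟩, ⟨i, hi, hbt⟩⟩
    rw [hbs, add_assoc, ← add_smul, add_right_inj] at hbt
    have hd₀ : d ≠ 0 := by
      rintro rfl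
      exact absurd (hdirs hd) (by decide)
    have := smul_left_injective ℤ hd₀ hbt
    exact h j hj (by omega) ⟨b, hb, hba, hbs⟩
  · rintro ⟨d, hd, ⟨m, hm, rfl⟩, h⟩
    refine ⟨d, hd, m, hm, rfl, fun j hj hjm => ?_⟩
    rintro ⟨b, hb, hba, hbs⟩
    refine h b hb hba ⟨⟨j, hj, hbs⟩, ⟨m - j, by omega, ?_⟩⟩
    rw [hbs, add_assoc, ← add_smul, add_sub_cancel]

/-! ### Transfer of the rules along related coordinates -/

section Transfer

variable {R S : ℤ → ℤ → Prop} {p p' q q' : Position} {a a' : Piece} {s s' t t' d : Square} {j : ℕ}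

theorem SqRel.swap (h : SqRel R s s') : SqRel (fun x y => R y x) s' s := h

theorem PieceRel.swap (h : PieceRel R a a') : PieceRel (fun x y => R y x) a' a :=
  ⟨h.color.symm, h.kind.symm, h.alive.symm, h.loc⟩

theorem PosRel.swap (h : PosRel R p p') : PosRel (fun x y => R y x) p' p :=
  ⟨h.turn.symm, h.length.symm, fun i a a' ha ha' => (h.piece i a' a ha' ha).swap⟩

theorem PosRel.mono (h : PosRel R p p') (hRS : ∀ x y, R x y → S x y) : PosRel S p p' :=
  ⟨h.turn, h.length, fun i a a' ha ha' =>
    let h' := h.piece i a a' ha ha'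
    ⟨h'.color, h'.kind, h'.alive, hRS _ _ h'.loc.1, hRS _ _ h'.loc.2⟩⟩

theorem PosRel.getElem? (h : PosRel R p p') {i : ℕ} (ha : p.pieces[i]? = some a) :
    ∃ a', p'.pieces[i]? = some a' ∧ PieceRel R a a' := by
  obtain ⟨hi, -⟩ := List.getElem?_eq_some_iff.1 ha
  have h' : p'.pieces[i]? = some (p'.pieces[i]'(h.length ▸ hi)) := List.getElem?_eq_getElem _
  exact ⟨_, h', h.piece i _ _ ha h'⟩

theorem PosRel.exists_mem (h : PosRel R p p') (ha : a ∈ p.pieces) :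
    ∃ a' ∈ p'.pieces, PieceRel R a a' := by
  obtain ⟨i, hi⟩ := List.mem_iff_getElem?.1 ha
  obtain ⟨a', ha', hr⟩ := h.getElem? hi
  exact ⟨a', List.mem_iff_getElem?.2 ⟨i, ha'⟩, hr⟩

theorem Sim.combo_sub {x x' y y' : ℤ} (hx : R x x') (hy : R y y') :
    Combo R 2 (x - y) (x' - y') :=
  (Combo.of_rel hx).diff (Combo.of_rel hy)

theorem Sim.sign_sub (h : Sim j R) {x x' y y' : ℤ} (hx : R x x') (hy : R y y') :
    (x - y).sign = (x' - y').sign :=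
  h.sign_eq (Sim.combo_sub hx hy) (by norm_num)

theorem Sim.eq_iff (h : Sim j R) {x x' y y' : ℤ} (hx : R x x') (hy : R y y') :
    x = y ↔ x' = y' := by
  rw [← sub_eq_zero, ← Int.sign_eq_zero_iff_zero, h.sign_sub hx hy, Int.sign_eq_zero_iff_zero,
    sub_eq_zero]

/-- Comparing a difference with the integers up to 3 in absolute value determines it exactly between
-2 and 2, which is all that kings, knights and pawns see. -/
theorem Sim.sub_eq_or (h : Sim j R) {x x' y y' : ℤ} (hx : R x x') (hy : R y y') :
    x - y = x' - y' ∨ (2 < x - y ∧ 2 < x' - y') ∨ (x - y < -2 ∧ x' - y' < -2) := by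
  have hc := Sim.combo_sub hx hy
  have h₁ (k : ℕ) (hk : k ≤ 3) : 0 < x - y + k ↔ 0 < x' - y' + k := by
    rw [← Int.sign_eq_one_iff_pos, h.sign_eq (hc.sum (Combo.natCast (Good.one h) k)) (by omega),
      Int.sign_eq_one_iff_pos]
  have h₂ (k : ℕ) (hk : k ≤ 3) : 0 < x - y - k ↔ 0 < x' - y' - k := by
    rw [← Int.sign_eq_one_iff_pos, h.sign_eq (hc.diff (Combo.natCast (Good.one h) k)) (by omega),
      Int.sign_eq_one_iff_pos]
  have := h₁ 0 (by omega)
  have := h₁ 1 (by omega)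
  have := h₁ 2 (by omega)
  have := h₁ 3 (by omega)
  have := h₂ 1 (by omega)
  have := h₂ 2 (by omega)
  omega

theorem Sim.sq_eq_iff (h : Sim j R) (hs : SqRel R s s') (ht : SqRel R t t') :
    s = t ↔ s' = t' := by
  rw [Prod.ext_iff, Prod.ext_iff, h.eq_iff hs.1 ht.1, h.eq_iff hs.2 ht.2]

/-- The diagonal condition is the vanishing of the sum or of the difference of two coordinate
differences, a combination of four summands. As in the following transfer lemmas, one implication is
enough: the other is the same lemma for the swapped relation. -/
theorem Sim.onRay (h : Sim j R) (hs : SqRel R s s') (ht : SqRel R t t')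
    (hd : d ∈ rookDirs ++ bishopDirs) (hst : OnRay d s t) : OnRay d s' t' := by
  rw [onRay_iff hd] at hst ⊢
  obtain ⟨h₁, h₂, h₃⟩ := hst
  refine ⟨(h.sign_sub ht.1 hs.1) ▸ h₁, (h.sign_sub ht.2 hs.2) ▸ h₂, fun h₄ h₅ => ?_⟩
  have h₆ := h₃ h₄ h₅
  have hc₁ := h.sign_eq ((Sim.combo_sub ht.1 hs.1).diff (Sim.combo_sub ht.2 hs.2)) (by norm_num)
  have hc₂ := h.sign_eq ((Sim.combo_sub ht.1 hs.1).sum (Sim.combo_sub ht.2 hs.2)) (by norm_num)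
  simp only [rookDirs, bishopDirs, List.cons_append, List.nil_append, List.mem_cons,
    List.not_mem_nil, or_false] at hd
  rcases hd with rfl | rfl | rfl | rfl | rfl | rfl | rfl | rfl <;> simp only at h₄ h₅ h₆ ⊢
  any_goals exact absurd rfl h₄
  any_goals exact absurd rfl h₅
  · rw [Int.sign_eq_zero_iff_zero.2 (by omega)] at hc₁
    have := Int.sign_eq_zero_iff_zero.1 hc₁.symm
    omega
  · rw [Int.sign_eq_zero_iff_zero.2 (by omega)] at hc₂
    have := Int.sign_eq_zero_iff_zero.1 hc₂.symm
    omega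
  · rw [Int.sign_eq_zero_iff_zero.2 (by omega)] at hc₂
    have := Int.sign_eq_zero_iff_zero.1 hc₂.symm
    omega
  · rw [Int.sign_eq_zero_iff_zero.2 (by omega)] at hc₁
    have := Int.sign_eq_zero_iff_zero.1 hc₁.symm
    omega

theorem Sim.occupied (h : Sim j R) (hp : PosRel R p p') (hs : SqRel R s s') (ho : p.Occupied s) :
    p'.Occupied s' := by
  obtain ⟨a, ha, hal, rfl⟩ := ho
  obtain ⟨a', ha', hr⟩ := hp.exists_mem ha
  exact ⟨a', ha', hr.alive ▸ hal, (h.sq_eq_iff hr.loc hs).1 rfl⟩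

theorem Sim.occupiedBy (h : Sim j R) (hp : PosRel R p p') (hs : SqRel R s s') {c : Color}
    (ho : p.OccupiedBy c s) : p'.OccupiedBy c s' := by
  obtain ⟨a, ha, hal, hc, rfl⟩ := ho
  obtain ⟨a', ha', hr⟩ := hp.exists_mem ha
  exact ⟨a', ha', hr.alive ▸ hal, hr.color ▸ hc, (h.sq_eq_iff hr.loc hs).1 rfl⟩

theorem Sim.slides (h : Sim j R) (hp : PosRel R p p') (hs : SqRel R s s') (ht : SqRel R t t')
    {dirs : List Square} (hd : dirs ⊆ rookDirs ++ bishopDirs) (hst : p.Slides dirs s t) :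
    p'.Slides dirs s' t' := by
  rw [slides_iff hd] at hst ⊢
  obtain ⟨d, hdd, hr, hb⟩ := hst
  refine ⟨d, hdd, h.onRay hs ht (hd hdd) hr, fun b' hb' hba' => ?_⟩
  rintro ⟨h₁, h₂⟩
  obtain ⟨b, hbm, hbr⟩ := hp.swap.exists_mem hb'
  exact hb b hbm (hbr.alive ▸ hba') ⟨h.swap.onRay hs.swap hbr.loc (hd hdd) h₁,
    h.swap.onRay hbr.loc ht.swap (hd hdd) h₂⟩

theorem Sim.attacks (h : Sim j R) (hp : PosRel R p p') (ha : PieceRel R a a') (ht : SqRel R t t')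
    (hat : p.Attacks a t) : p'.Attacks a' t' := by
  have h₁ := h.sub_eq_or ht.1 ha.loc.1
  have h₂ := h.sub_eq_or ht.2 ha.loc.2
  have hf : a'.color.forward = 1 ∨ a'.color.forward = -1 := by cases a'.color <;> simp [Color.forward]
  unfold Position.Attacks at hat ⊢
  rw [← ha.kind]
  rw [ha.color] at hat
  cases hk : a.kind <;> rw [hk] at hat <;>
    simp only [Int.abs_eq_natAbs] at hat ⊢
  · exact ⟨fun h' => hat.1 ((h.sq_eq_iff ht ha.loc).2 h'), by omega, by omega⟩
  · exact h.slides hp ha.loc ht (fun _ h => h) hat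
  · exact h.slides hp ha.loc ht (List.subset_append_left _ _) hat
  · exact h.slides hp ha.loc ht (List.subset_append_right _ _) hat
  · omega
  · omega

theorem Sim.inCheck (h : Sim j R) (hp : PosRel R p p') {c : Color} (hc : p.InCheck c) :
    p'.InCheck c := by
  obtain ⟨k, hk, h₁, h₂, h₃, a, ha, h₄, h₅, h₆⟩ := hc
  obtain ⟨k', hk', hkr⟩ := hp.exists_mem hk
  obtain ⟨a', ha', har⟩ := hp.exists_mem ha
  exact ⟨k', hk', hkr.alive ▸ h₁, hkr.color ▸ h₂, hkr.kind ▸ h₃, a', ha', har.alive ▸ h₄,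
    har.color ▸ h₅, h.attacks hp har hkr.loc h₆⟩

theorem Sim.inCheck_iff (h : Sim j R) (hp : PosRel R p p') {c : Color} :
    p.InCheck c ↔ p'.InCheck c :=
  ⟨h.inCheck hp, h.swap.inCheck hp.swap⟩

theorem Sim.canGo (h : Sim j R) (hp : PosRel R p p') (ha : PieceRel R a a') (ht : SqRel R t t')
    (hat : p.CanGo a t) : p'.CanGo a' t' := by
  refine ⟨fun h' => hat.1 (h.swap.occupiedBy hp.swap ht.swap (ha.color ▸ h')), ?_⟩
  have h₁ := h.sub_eq_or ht.1 ha.loc.1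
  have h₂ := h.sub_eq_or ht.2 ha.loc.2
  have hf : a'.color.forward = 1 ∨ a'.color.forward = -1 := by cases a'.color <;> simp [Color.forward]
  have h₃ := hat.2
  rw [← ha.kind]
  split_ifs at h₃ ⊢ with hk
  · refine h₃.imp ?_ ?_
    · rintro ⟨h₄, h₅⟩
      refine ⟨?_, fun h' => h₅ (h.swap.occupied hp.swap ht.swap h')⟩
      rw [ha.color] at h₄
      rw [Prod.ext_iff] at h₄ ⊢
      simp only at h₄ ⊢
      omega
    · rintro ⟨h₄, h₅⟩
      exact ⟨h.attacks hp ha ht h₄, ha.color ▸ h.occupiedBy hp ht h₅⟩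
  · exact h.attacks hp ha ht h₃

theorem Sim.play (h : Sim j R) (hp : PosRel R p p') (ht : SqRel R t t') (i : ℕ) :
    PosRel R (p.play i t) (p'.play i t') where
  turn := by simp [Position.play, hp.turn]
  length := by simp [Position.play, hp.length]
  piece k b b' hb hb' := by
    simp only [Position.play, List.getElem?_mapIdx, Option.map_eq_some_iff] at hb hb'
    obtain ⟨a, ha, rfl⟩ := hb
    obtain ⟨a', ha', rfl⟩ := hb'
    have hr := hp.piece k a a' ha ha'
    have he := h.sq_eq_iff hr.loc ht
    by_cases hki : k = i
    · simp only [hki, if_true]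
      exact ⟨hr.color, hr.kind, hr.alive, ht⟩
    · simp only [hki, if_false, he, hr.alive]
      split_ifs
      -- A captured piece is sent to `(0, 0)`; for this the pair of zeros is required in `Good`.
      · exact ⟨hr.color, hr.kind, rfl, Good.zero h, Good.zero h⟩
      · exact hr

theorem Sim.legalMove (h : Sim j R) (hp : PosRel R p p') (ht : SqRel R t t') {i : ℕ}
    (hm : p.LegalMove i t) : p'.LegalMove i t' := by
  obtain ⟨a, h₁, h₂, h₃, h₄, h₅⟩ := hm
  obtain ⟨a', ha', hr⟩ := hp.getElem? h₁
  refine ⟨a', ha', hr.alive ▸ h₂, ?_, h.canGo hp hr ht h₄, ?_⟩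
  · rw [← hr.color, h₃, hp.turn]
  · rw [← h.inCheck_iff (h.play hp ht i), ← hp.turn]
    exact h₅

/-- Vanishing differences are preserved, so the relation is a partial injection on integers and the
related position is determined. -/
theorem Sim.posRel_right_unique (h : Sim j R) (hp : PosRel R p q) (hp' : PosRel R p q') : q = q' := by
  obtain ⟨l, c⟩ := q
  obtain ⟨l', c'⟩ := q'
  obtain rfl : c = c' := hp.turn.symm.trans hp'.turn
  congr 1
  refine List.ext_getElem (hp.length.symm.trans hp'.length) fun i hi hi' => ?_
  have hpi : p.pieces[i]? = some (p.pieces[i]'(hp.length ▸ hi)) := List.getElem?_eq_getElem _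
  have h₁ := hp.piece i _ _ hpi (List.getElem?_eq_getElem hi)
  have h₂ := hp'.piece i _ _ hpi (List.getElem?_eq_getElem hi')
  have h₄ : l[i].loc = l'[i].loc := (h.sq_eq_iff h₁.loc h₂.loc).1 rfl
  have h₅ := h₁.color.symm.trans h₂.color
  have h₆ := h₁.kind.symm.trans h₂.kind
  have h₇ := h₁.alive.symm.trans h₂.alive
  cases hx : l[i]
  cases hy : l'[i]
  simp only [hx, hy] at h₄ h₅ h₆ h₇
  simp [h₄, h₅, h₆, h₇]

theorem Sim.posRel_left_unique (h : Sim j R) (hp : PosRel R q p) (hp' : PosRel R q' p) : q = q' :=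
  h.swap.posRel_right_unique hp.swap hp'.swap

/-- A legal move between two positions whose coordinates are available is imitated. -/
theorem Sim.oneMove (h : Sim j R) (hp : PosRel R p p') (hq : PosRel R q q') (hm : OneMove p q) :
    OneMove p' q' := by
  obtain ⟨i, t, hl, rfl⟩ := oneMove_iff.1 hm
  obtain ⟨a, ha, -⟩ := id hl
  have hb : (p.play i t).pieces[i]? = some { a with loc := t } := by
    simp [Position.play, List.getElem?_mapIdx, ha]
  obtain ⟨b', hb', hr⟩ := hq.getElem? hb
  refine oneMove_iff.2 ⟨i, b'.loc, h.legalMove hp hr.loc hl, ?_⟩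
  exact h.posRel_right_unique hq (h.play hp hr.loc i)

/-- Every legal move is imitated by a legal move to a square of bounded size. -/
theorem Sim.exists_legalMove (h : Sim (j + 1) R) (hp : PosRel R p p') (hm : OneMove p q) :
    ∃ (i : ℕ) (t' : Square) (S : ℤ → ℤ → Prop), Sim j S ∧ (∀ a b, R a b → S a b) ∧
      p'.LegalMove i t' ∧ PosRel S q (p'.play i t') ∧
      ∀ X : ℕ, (∀ a b, R a b → |b| ≤ (X : ℤ)) →
        |t'.1| ≤ (moveBound j X : ℤ) ∧ |t'.2| ≤ (moveBound j X : ℤ) := by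
  obtain ⟨i, t, hl, rfl⟩ := InfiniteChess.oneMove_iff.1 hm
  obtain ⟨t', S, hS, hRS, h₁, h₂, hb⟩ := h.exists_extend₂ t
  exact ⟨i, t', S, hS, hRS, hS.legalMove (hp.mono hRS) ⟨h₁, h₂⟩ hl,
    hS.play (hp.mono hRS) ⟨h₁, h₂⟩ i, fun X hX => ⟨hb X hX _ _ h₁, hb X hX _ _ h₂⟩⟩

theorem Sim.exists_oneMove (h : Sim (j + 1) R) (hp : PosRel R p p') (hm : OneMove p q) :
    ∃ (q' : Position) (S : ℤ → ℤ → Prop), Sim j S ∧ (∀ a b, R a b → S a b) ∧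
      OneMove p' q' ∧ PosRel S q q' := by
  obtain ⟨i, t', S, hS, hRS, hl, hr, -⟩ := h.exists_legalMove hp hm
  exact ⟨_, S, hS, hRS, InfiniteChess.oneMove_iff.2 ⟨i, t', hl, rfl⟩, hr⟩

/-- The witnessing move has to be imitated, which uses up one level. This is the origin of the index
`j + 1` for mate, wins, stalemate and the end of the game. -/
theorem Sim.exists_oneMove_iff (h : Sim (j + 1) R) (hp : PosRel R p p') :
    (∃ q, OneMove p q) ↔ ∃ q, OneMove p' q :=
  ⟨fun ⟨_, hq⟩ => let ⟨q', _, _, _, h', _⟩ := h.exists_oneMove hp hq; ⟨q', h'⟩,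
    fun ⟨_, hq⟩ => let ⟨q', _, _, _, h', _⟩ := h.swap.exists_oneMove hp.swap hq; ⟨q', h'⟩⟩

theorem Sim.mated_iff (h : Sim (j + 1) R) (hp : PosRel R p p') (c : Color) :
    p.Mated c ↔ p'.Mated c := by
  rw [Position.Mated, Position.Mated, hp.turn, h.inCheck_iff hp, h.exists_oneMove_iff hp]

theorem Sim.won_iff (h : Sim (j + 1) R) (hp : PosRel R p p') (c : Color) :
    p.Won c ↔ p'.Won c := by
  rw [Position.Won, Position.Won, h.mated_iff hp, hp.turn, h.inCheck_iff hp, h.inCheck_iff hp]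

theorem Sim.stalemate_iff (h : Sim (j + 1) R) (hp : PosRel R p p') :
    p.Stalemate ↔ p'.Stalemate := by
  rw [Position.Stalemate, Position.Stalemate, hp.turn, h.exists_oneMove_iff hp, h.inCheck_iff hp,
    h.inCheck_iff hp]

theorem Sim.over_iff (h : Sim (j + 1) R) (hp : PosRel R p p') : p.Over ↔ p'.Over := by
  rw [Position.Over, Position.Over, h.won_iff hp, h.won_iff hp, h.stalemate_iff hp]

end Transfer

theorem InBox.posRel {X : ℕ} {p : Position} (h : InBox X p) :
    PosRel (fun a b => a = b ∧ |b| ≤ (X : ℤ)) p p where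
  turn := rfl
  length := rfl
  piece i a a' ha ha' := by
    rw [ha, Option.some_inj] at ha'
    subst ha'
    have := h a (List.mem_of_getElem? ha)
    exact ⟨rfl, rfl, rfl, ⟨rfl, this.1⟩, ⟨rfl, this.2⟩⟩

/-! ### Finite lists of representative moves -/

/-- The integers of absolute value at most `X`. -/
def intBox (X : ℕ) : List ℤ := (List.range (2 * X + 1)).map fun n : ℕ => (n : ℤ) - X

theorem mem_intBox {X : ℕ} {z : ℤ} : z ∈ intBox X ↔ |z| ≤ (X : ℤ) := by
  rw [abs_le, intBox, List.mem_map]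
  constructor
  · rintro ⟨n, hn, rfl⟩
    rw [List.mem_range] at hn
    omega
  · rintro ⟨h₁, h₂⟩
    exact ⟨(z + X).toNat, by rw [List.mem_range]; omega, by omega⟩

open Classical in
/-- The list of all positions reached by a legal move to a square in a box. -/
noncomputable def movesIn (X : ℕ) (p : Position) : List Position :=
  (((List.range p.pieces.length).product ((intBox X).product (intBox X))).filter
    fun x => p.LegalMove x.1 x.2).map fun x => p.play x.1 x.2

theorem mem_movesIn {X : ℕ} {p q : Position} : q ∈ movesIn X p ↔
    ∃ i t, p.LegalMove i t ∧ |t.1| ≤ (X : ℤ) ∧ |t.2| ≤ (X : ℤ) ∧ q = p.play i t := by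
  simp only [movesIn, List.mem_map, List.mem_filter, List.pair_mem_product, Prod.exists,
    List.mem_range, mem_intBox, decide_eq_true_eq]
  constructor
  · rintro ⟨i, x, y, ⟨⟨hi, hx, hy⟩, hl⟩, rfl⟩
    exact ⟨i, x, y, hl, hx, hy, rfl⟩
  · rintro ⟨i, x, y, hl, hx, hy, rfl⟩
    obtain ⟨a, ha, -⟩ := id hl
    exact ⟨i, x, y, ⟨⟨(List.getElem?_eq_some_iff.1 ha).1, hx, hy⟩, hl⟩, rfl⟩

theorem oneMove_of_mem_movesIn {X : ℕ} {p q : Position} (h : q ∈ movesIn X p) : OneMove p q :=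
  let ⟨i, t, hl, _, _, hq⟩ := mem_movesIn.1 h
  oneMove_iff.2 ⟨i, t, hl, hq⟩

/-- The destination can be read off from `q` as the new location of the moved piece, so a bound on
`q` bounds the move. -/
theorem mem_movesIn_of_oneMove {X : ℕ} {p q : Position} (h : OneMove p q) (hq : InBox X q) :
    q ∈ movesIn X p := by
  obtain ⟨i, t, hl, rfl⟩ := oneMove_iff.1 h
  obtain ⟨a, ha, -⟩ := id hl
  have hb : (p.play i t).pieces[i]? = some { a with loc := t } := by
    simp [Position.play, List.getElem?_mapIdx, ha]
  have := hq _ (List.mem_of_getElem? hb)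
  exact mem_movesIn.2 ⟨i, t, hl, this.1, this.2, rfl⟩

/-- Up to imitability of `j` further moves, all legal moves are represented among those of bounded
length. -/
theorem exists_mem_movesIn (j : ℕ) {X : ℕ} (hX : 1 ≤ X) {p q : Position} (hp : InBox X p)
    (h : OneMove p q) :
    ∃ q' ∈ movesIn (moveBound j X) p, ∃ S : ℤ → ℤ → Prop, Sim j S ∧
      (∀ a b, (a = b ∧ |b| ≤ (X : ℤ)) → S a b) ∧ PosRel S q q' := by
  obtain ⟨i, t', S, hS, hRS, hl, hr, hb⟩ :=
    (Sim.diag (j + 1) (X := X) (by exact_mod_cast hX)).exists_legalMove hp.posRel h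
  obtain ⟨h₁, h₂⟩ := hb X fun a b hab => hab.2
  exact ⟨_, mem_movesIn.2 ⟨i, t', hl, h₁, h₂, rfl⟩, S, hS, hRS, hr⟩

/-! ### Ranks of positions with respect to a goal -/

/-- Player `c` can force the goal `G` within `n` plies. -/
def Forced (c : Color) (G : Position → Prop) : ℕ → Position → Prop
  | 0, p => G p
  | n + 1, p => G p ∨ (¬ p.Over ∧ (p.turn = c → ∃ q, OneMove p q ∧ Forced c G n q) ∧
      (p.turn ≠ c → ∀ q, OneMove p q → Forced c G n q))

theorem Forced.of_goal {c : Color} {G : Position → Prop} {n : ℕ} {p : Position} (h : G p) :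
    Forced c G n p := by
  cases n with
  | zero => exact h
  | succ n => exact Or.inl h

theorem Forced.succ {c : Color} {G : Position → Prop} {n : ℕ} : ∀ {p : Position},
    Forced c G n p → Forced c G (n + 1) p := by
  induction n with
  | zero => exact fun h => Or.inl h
  | succ n ih =>
    rintro p (h | ⟨h₁, h₂, h₃⟩)
    · exact Or.inl h
    · exact Or.inr ⟨h₁, fun h => let ⟨q, hq, hf⟩ := h₂ h; ⟨q, hq, ih hf⟩,
        fun h q hq => ih (h₃ h q hq)⟩

theorem Forced.mono {c : Color} {G : Position → Prop} {m n : ℕ} {p : Position} (h : Forced c G m p)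
    (hmn : m ≤ n) : Forced c G n p := by
  induction n, hmn using Nat.le_induction with
  | base => exact h
  | succ n _ ih => exact ih.succ

/-- Each ply uses one level, in either direction: a move of `c` is carried to the right, and a reply
of the opponent is pulled back to the left. The remaining `l + 1` levels serve the goal. -/
theorem Sim.forced {c : Color} {G : Position → Prop} {l : ℕ}
    (hG : ∀ R p p', Sim (l + 1) R → PosRel R p p' → G p → G p') {n : ℕ} :
    ∀ {R : ℤ → ℤ → Prop} {p p' : Position}, Sim (l + 1 + n) R → PosRel R p p' →
      Forced c G n p → Forced c G n p' := by
  induction n with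
  | zero => exact fun hR hp h => hG _ _ _ hR hp h
  | succ n ih =>
    rintro R p p' hR hp (h | ⟨h₁, h₂, h₃⟩)
    · exact Or.inl (hG _ _ _ (hR.mono (by omega)) hp h)
    · refine Or.inr ⟨?_, fun hc => ?_, fun hc q' hq' => ?_⟩
      · rwa [← hR.over_iff hp]
      · obtain ⟨q, hq, hf⟩ := h₂ (hp.turn.trans hc)
        obtain ⟨q', S, hS, -, hq', hr⟩ := Sim.exists_oneMove (j := l + 1 + n) hR hp hq
        exact ⟨q', hq', ih hS hr hf⟩
      · obtain ⟨q, S, hS, -, hq, hr⟩ := Sim.exists_oneMove (j := l + 1 + n) hR.swap hp.swap hq'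
        exact ih hS.swap hr.swap (h₃ (hp.turn ▸ hc) q hq)

/-! ### The forcing recursion over finite lists -/

/-- A bound for the coordinates of the pieces of a position. -/
def posSize (p : Position) : ℕ := (p.pieces.map fun a => a.loc.1.natAbs + a.loc.2.natAbs).sum + 1

theorem inBox_posSize (p : Position) : InBox (posSize p) p := by
  intro a ha
  have h : a.loc.1.natAbs + a.loc.2.natAbs ≤
      (p.pieces.map fun a => a.loc.1.natAbs + a.loc.2.natAbs).sum :=
    List.single_le_sum (fun _ _ => Nat.zero_le _) _ (List.mem_map.2 ⟨a, ha, rfl⟩)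
  simp only [Int.abs_eq_natAbs, posSize]
  omega

theorem InBox.mono {X Y : ℕ} {p : Position} (h : InBox X p) (hXY : X ≤ Y) : InBox Y p :=
  fun a ha => ⟨(h a ha).1.trans (by exact_mod_cast hXY), (h a ha).2.trans (by exact_mod_cast hXY)⟩

/-- Legal moves that represent all legal moves as far as `j` further moves are concerned. -/
noncomputable def moves (j : ℕ) (p : Position) : List Position :=
  movesIn (moveBound j (posSize p)) p

theorem oneMove_of_mem_moves {j : ℕ} {p q : Position} (h : q ∈ moves j p) : OneMove p q :=
  oneMove_of_mem_movesIn h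

theorem exists_mem_moves (j : ℕ) {p q : Position} (h : OneMove p q) :
    ∃ q' ∈ moves j p, ∃ S, Sim j S ∧ PosRel S q q' := by
  obtain ⟨q', hq', S, hS, -, hr⟩ := exists_mem_movesIn j (Nat.le_add_left _ _) (inBox_posSize p) h
  exact ⟨q', hq', S, hS, hr⟩

theorem exists_oneMove_iff_moves (j : ℕ) (p : Position) : (∃ q, OneMove p q) ↔ ∃ q, q ∈ moves j p :=
  ⟨fun ⟨_, h⟩ => let ⟨q', hq', _⟩ := exists_mem_moves j h; ⟨q', hq'⟩,
    fun ⟨q, h⟩ => ⟨q, oneMove_of_mem_moves h⟩⟩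

theorem exists_forced_iff {c : Color} {G : Position → Prop} {l : ℕ}
    (hG : ∀ R p p', Sim (l + 1) R → PosRel R p p' → G p → G p') (n : ℕ) (p : Position) :
    (∃ q, OneMove p q ∧ Forced c G n q) ↔ ∃ q ∈ moves (l + 1 + n) p, Forced c G n q := by
  constructor
  · rintro ⟨q, hq, hf⟩
    obtain ⟨q', hq', S, hS, hr⟩ := exists_mem_moves (l + 1 + n) hq
    exact ⟨q', hq', Sim.forced hG hS hr hf⟩
  · rintro ⟨q, hq, hf⟩
    exact ⟨q, oneMove_of_mem_moves hq, hf⟩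

theorem forall_forced_iff {c : Color} {G : Position → Prop} {l : ℕ}
    (hG : ∀ R p p', Sim (l + 1) R → PosRel R p p' → G p → G p') (n : ℕ) (p : Position) :
    (∀ q, OneMove p q → Forced c G n q) ↔ ∀ q ∈ moves (l + 1 + n) p, Forced c G n q := by
  constructor
  · exact fun h q hq => h q (oneMove_of_mem_moves hq)
  · intro h q hq
    obtain ⟨q', hq', S, hS, hr⟩ := exists_mem_moves (l + 1 + n) hq
    exact Sim.forced hG hS.swap hr.swap (h q' hq')

/-- The move lists have accuracy `l + 1 + n`, exactly what transferring `Forced c G n` from a move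
to its representative requires. -/
theorem forced_succ_iff {c : Color} {G : Position → Prop} {l : ℕ}
    (hG : ∀ R p p', Sim (l + 1) R → PosRel R p p' → G p → G p') (n : ℕ) (p : Position) :
    Forced c G (n + 1) p ↔ G p ∨ (¬ p.Over ∧
      (p.turn = c → ∃ q ∈ moves (l + 1 + n) p, Forced c G n q) ∧
      (p.turn ≠ c → ∀ q ∈ moves (l + 1 + n) p, Forced c G n q)) := by
  rw [← exists_forced_iff hG, ← forall_forced_iff hG]
  rfl

/-! ### Confinement to a small family of positions -/

/-- Player `c` can keep the play inside the family `F` forever, without the game ending. -/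
def Closed (c : Color) (F : Set Position) : Prop :=
  ∀ q ∈ F, ¬ q.Over ∧ (q.turn = c → ∃ q' ∈ F, OneMove q q') ∧
    (q.turn ≠ c → ∀ q', OneMove q q' → q' ∈ F)

/-- By adding at most `m` positions, each reached from an earlier one by a legal move, the family
`V` can be made closed. -/
def Completable (c : Color) : ℕ → List Position → Prop
  | 0, V => Closed c {q | q ∈ V}
  | m + 1, V => Closed c {q | q ∈ V} ∨ ∃ v ∈ V, ∃ q, OneMove v q ∧ Completable c m (q :: V)

/-- Every member of either family is related to a member of the other one. -/
def FamRel (R : ℤ → ℤ → Prop) (V V' : List Position) : Prop :=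
  (∀ q ∈ V, ∃ q' ∈ V', PosRel R q q') ∧ ∀ q' ∈ V', ∃ q ∈ V, PosRel R q q'

theorem FamRel.cons {R S : ℤ → ℤ → Prop} {V V' : List Position} {q q' : Position}
    (h : FamRel R V V') (hRS : ∀ a b, R a b → S a b) (hq : PosRel S q q') :
    FamRel S (q :: V) (q' :: V') := by
  constructor
  · intro r hr
    rcases List.mem_cons.1 hr with rfl | hr
    · exact ⟨q', List.mem_cons_self, hq⟩
    · obtain ⟨r', hr', hrr⟩ := h.1 r hr
      exact ⟨r', List.mem_cons_of_mem _ hr', hrr.mono hRS⟩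
  · intro r' hr'
    rcases List.mem_cons.1 hr' with rfl | hr'
    · exact ⟨q, List.mem_cons_self, hq⟩
    · obtain ⟨r, hr, hrr⟩ := h.2 r' hr'
      exact ⟨r, List.mem_cons_of_mem _ hr, hrr.mono hRS⟩

/-- The point is closure under the opponent's replies. A reply on the right is imitated on the left,
where it lands in `V`; its partner in `V'` must be the original reply, because related positions are
unique. -/
theorem Sim.closed {j : ℕ} {R : ℤ → ℤ → Prop} {c : Color} {V V' : List Position}
    (hR : Sim (j + 1) R) (hV : FamRel R V V') (h : Closed c {q | q ∈ V}) :
    Closed c {q | q ∈ V'} := by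
  intro q' hq'
  obtain ⟨q, hq, hr⟩ := hV.2 q' hq'
  obtain ⟨h₁, h₂, h₃⟩ := h q hq
  refine ⟨?_, fun hc => ?_, fun hc s' hs' => ?_⟩
  · rwa [← hR.over_iff hr]
  · obtain ⟨s, hs, hm⟩ := h₂ (hr.turn.trans hc)
    obtain ⟨s', hs', hrs⟩ := hV.1 s hs
    exact ⟨s', hs', hR.oneMove hr hrs hm⟩
  · obtain ⟨s, S, hS, hRS, hs, hrs⟩ := hR.swap.exists_oneMove hr.swap hs'
    obtain ⟨t', ht', hrt⟩ := hV.1 s (h₃ (hr.turn ▸ hc) s hs)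
    rw [hS.posRel_left_unique hrs (hrt.swap.mono hRS)]
    exact ht'

/-- One level is spent on each of the `m` added positions, and one on testing closedness. -/
theorem Sim.completable {c : Color} {m : ℕ} : ∀ {R : ℤ → ℤ → Prop} {V V' : List Position},
    Sim (m + 1) R → FamRel R V V' → Completable c m V → Completable c m V' := by
  induction m with
  | zero => exact fun hR hV h => hR.closed hV h
  | succ m ih =>
    rintro R V V' hR hV (h | ⟨v, hv, q, hq, hc⟩)
    · exact Or.inl (hR.closed hV h)
    · obtain ⟨v', hv', hr⟩ := hV.1 v hv
      obtain ⟨q', S, hS, hRS, hq', hrq⟩ := hR.exists_oneMove hr hq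
      exact Or.inr ⟨v', hv', q', hq', ih hS (hV.cons hRS hrq) hc⟩

/-- As long as `V ⊆ F` is not closed, some member has a successor in `F` that is missing from `V`.
Adding such successors exhausts `F` after at most `m` steps by counting. -/
theorem Completable.of_closed {c : Color} {F : Finset Position} (hF : Closed c {q | q ∈ F}) {m : ℕ} :
    ∀ {V : List Position}, V.Nodup → (∀ q ∈ V, q ∈ F) → F.card ≤ V.length + m →
      Completable c m V := by
  have key {V : List Position} (hV : ∀ q ∈ V, q ∈ F) (h : ¬ Closed c {q | q ∈ V}) :
      ∃ v ∈ V, ∃ q ∈ F, q ∉ V ∧ OneMove v q := by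
    by_contra hcon
    push Not at hcon
    refine h fun q hq => ?_
    obtain ⟨h₁, h₂, h₃⟩ := hF q (hV q hq)
    refine ⟨h₁, fun hc => ?_, fun hc q' hq' => ?_⟩
    · obtain ⟨q', hq', hm⟩ := h₂ hc
      by_contra hno
      exact hcon q hq q' hq' (fun hin => hno ⟨q', hin, hm⟩) hm
    · by_contra hno
      exact hcon q hq q' (h₃ hc q' hq') hno hq'
  induction m with
  | zero =>
    intro V hnd hV hcard
    by_contra h
    obtain ⟨v, -, q, hqF, hqV, -⟩ := key hV h
    have : (q :: V).toFinset.card ≤ F.card := Finset.card_le_card fun x hx => by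
      rcases List.mem_cons.1 (List.mem_toFinset.1 hx) with rfl | hx
      · exact hqF
      · exact hV x hx
    rw [List.toFinset_card_of_nodup (List.nodup_cons.2 ⟨hqV, hnd⟩), List.length_cons] at this
    omega
  | succ m ih =>
    intro V hnd hV hcard
    by_cases h : Closed c {q | q ∈ V}
    · exact Or.inl h
    · obtain ⟨v, hv, q, hqF, hqV, hm⟩ := key hV h
      refine Or.inr ⟨v, hv, q, hm, ih (List.nodup_cons.2 ⟨hqV, hnd⟩) ?_ ?_⟩
      · intro x hx
        rcases List.mem_cons.1 hx with rfl | hx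
        · exact hqF
        · exact hV x hx
      · rw [List.length_cons]
        omega

/-- A bound for the coordinates of the pieces in a family of positions. -/
def famSize (V : List Position) : ℕ := (V.map posSize).sum + 1

theorem inBox_famSize {V : List Position} {p : Position} (hp : p ∈ V) : InBox (famSize V) p := by
  refine (inBox_posSize p).mono ((?_ : _ ≤ (V.map posSize).sum).trans (Nat.le_succ _))
  exact List.single_le_sum (fun _ _ => Nat.zero_le _) _ (List.mem_map.2 ⟨p, hp, rfl⟩)

theorem famRel_self (V : List Position) :
    FamRel (fun a b => a = b ∧ |b| ≤ (famSize V : ℤ)) V V :=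
  ⟨fun q hq => ⟨q, hq, (inBox_famSize hq).posRel⟩, fun q hq => ⟨q, hq, (inBox_famSize hq).posRel⟩⟩

theorem one_le_famSize (V : List Position) : 1 ≤ famSize V := Nat.le_add_left _ _

/-- A move that stays in `V` ends inside the box of `V`. For the opponent, a reply `q'` has a
representative `r` on the list. If `r` lies in `V`, its coordinates lie in the box, where the
relation contains the identity, so uniqueness yields `q' = r`. Checking the listed replies therefore
excludes all others. -/
theorem closed_iff {c : Color} {V : List Position} : Closed c {q | q ∈ V} ↔
    ∀ q ∈ V, ¬ q.Over ∧ (q.turn = c → ∃ q' ∈ V, q' ∈ movesIn (famSize V) q) ∧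
      (q.turn ≠ c → ∀ q' ∈ movesIn (moveBound 0 (famSize V)) q, q' ∈ V) := by
  refine forall₂_congr fun q hq => and_congr_right fun _ => and_congr ?_ ?_
  · refine imp_congr_right fun _ => exists_congr fun q' => and_congr_right fun hq' => ?_
    exact ⟨fun h => mem_movesIn_of_oneMove h (inBox_famSize hq'), oneMove_of_mem_movesIn⟩
  · refine imp_congr_right fun _ => ⟨fun h q' hq' => h q' (oneMove_of_mem_movesIn hq'), ?_⟩
    intro h q' hq'
    obtain ⟨r, hr, S, hS, hRS, hqr⟩ := exists_mem_movesIn 0 (one_le_famSize V) (inBox_famSize hq) hq'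
    have hrV := h r hr
    rw [hS.posRel_left_unique hqr ((inBox_famSize hrV).posRel.mono hRS)]
    exact hrV

/-- The families obtained by adding one position. -/
noncomputable def enlargements (m : ℕ) (V : List Position) : List (List Position) :=
  V.flatMap fun v => (movesIn (moveBound (m + 1) (famSize V)) v).map fun q => q :: V

/-- The families obtained by adding at most `m` positions. -/
noncomputable def families : ℕ → List Position → List (List Position)
  | 0, V => [V]
  | m + 1, V => V :: ((enlargements m V).map (families m)).flatten

theorem mem_families_succ {m : ℕ} {V W : List Position} : W ∈ families (m + 1) V ↔
    W = V ∨ ∃ v ∈ V, ∃ q ∈ movesIn (moveBound (m + 1) (famSize V)) v, W ∈ families m (q :: V) := by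
  simp only [families, enlargements, List.mem_cons, List.mem_flatten, List.mem_map,
    List.mem_flatMap]
  refine or_congr_right ⟨?_, ?_⟩
  · rintro ⟨_, ⟨_, ⟨v, hv, q, hq, rfl⟩, rfl⟩, hW⟩
    exact ⟨v, hv, q, hq, hW⟩
  · rintro ⟨v, hv, q, hq, hW⟩
    exact ⟨_, ⟨_, ⟨v, hv, q, hq, rfl⟩, rfl⟩, hW⟩

theorem completable_iff {c : Color} {m : ℕ} : ∀ {V : List Position},
    Completable c m V ↔ ∃ W ∈ families m V, Closed c {q | q ∈ W} := by
  induction m with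
  | zero => simp [Completable, families]
  | succ m ih =>
    intro V
    simp only [mem_families_succ]
    constructor
    · rintro (h | ⟨v, hv, q, hq, hc⟩)
      · exact ⟨V, Or.inl rfl, h⟩
      · obtain ⟨q', hq', S, hS, hRS, hr⟩ :=
          exists_mem_movesIn (m + 1) (one_le_famSize V) (inBox_famSize hv) hq
        obtain ⟨W, hW, hWc⟩ := ih.1 (hS.completable ((famRel_self V).cons hRS hr) hc)
        exact ⟨W, Or.inr ⟨v, hv, q', hq', hW⟩, hWc⟩
    · rintro ⟨W, rfl | ⟨v, hv, q, hq, hW⟩, hWc⟩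
      · exact Or.inl hWc
      · exact Or.inr ⟨v, hv, q, oneMove_of_mem_movesIn hq, ih.2 ⟨W, hW, hWc⟩⟩

theorem subset_and_length_of_mem_families {m : ℕ} : ∀ {V W : List Position}, W ∈ families m V →
    V ⊆ W ∧ W.length ≤ V.length + m := by
  induction m with
  | zero =>
    intro V W h
    obtain rfl : W = V := by simpa [families] using h
    exact ⟨fun _ h => h, le_rfl⟩
  | succ m ih =>
    intro V W h
    rcases mem_families_succ.1 h with rfl | ⟨v, -, q, -, hW⟩
    · exact ⟨fun _ h => h, Nat.le_add_right _ _⟩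
    · obtain ⟨h₁, h₂⟩ := ih hW
      rw [List.length_cons] at h₂
      exact ⟨fun x hx => h₁ (List.mem_cons_of_mem _ hx), by omega⟩

/-- From `p`, player `c` can confine the opponent to `k` positions. -/
def Confinable (c : Color) (k : ℕ) (p : Position) : Prop := k ≠ 0 ∧ Completable c (k - 1) [p]

theorem Sim.confinable {c : Color} {k : ℕ} {R : ℤ → ℤ → Prop} {p p' : Position}
    (hR : Sim (k + 1) R) (hp : PosRel R p p') (h : Confinable c k p) : Confinable c k p' := by
  refine ⟨h.1, Sim.completable (R := R) (hR.mono (by omega)) ⟨?_, ?_⟩ h.2⟩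
  · simpa using hp
  · simpa using hp

/-! ### Plays -/

theorem Color.other_ne (c : Color) : c.other ≠ c := by cases c <;> decide

theorem Color.other_other (c : Color) : c.other.other = c := by cases c <;> rfl

theorem Color.ne_iff {c d : Color} : d ≠ c ↔ d = c.other := by cases c <;> cases d <;> decide

theorem OneMove.turn {p q : Position} (h : OneMove p q) : q.turn = p.turn.other := by
  obtain ⟨i, t, -, rfl⟩ := oneMove_iff.1 h
  rfl

/-- With no legal move available, the position is won for the mover, a mate or a stalemate,
according to who is in check. -/
theorem exists_oneMove_of_not_over {p : Position} (h : ¬ p.Over) : ∃ q, OneMove p q := by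
  by_contra hno
  have key : p.Won p.turn ∨ p.Won p.turn.other ∨ p.Stalemate := by
    by_cases h₁ : p.InCheck p.turn.other
    · exact Or.inl (Or.inr ⟨rfl, h₁⟩)
    by_cases h₂ : p.InCheck p.turn
    · refine Or.inr (Or.inl (Or.inl ⟨?_, h₁⟩))
      rw [p.turn.other_other]
      exact ⟨rfl, h₂, hno⟩
    · exact Or.inr (Or.inr ⟨h₂, h₁, hno⟩)
  refine h ?_
  rw [Position.Over]
  cases ht : p.turn <;> rw [ht] at key <;> simp only [Color.other] at key <;> tauto

theorem valid_of_oneMove {p q : Position} (hp : p.Valid) (h : OneMove p q) : q.Valid := by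
  obtain ⟨i, t, ⟨a, ha, hal, -⟩, rfl⟩ := oneMove_iff.1 h
  refine ⟨fun c => ?_, ?_, ?_⟩
  -- The count of kings depends only on the columns of colours and kinds, which no move alters.
  · have hcount (l : List Piece) : l.countP (fun a => a.color = c ∧ a.kind = Kind.king) =
        (l.map fun a => (a.color, a.kind)).countP (fun x => x.1 = c ∧ x.2 = Kind.king) := by
      rw [List.countP_map]
      rfl
    have hmap : (p.play i t).pieces.map (fun a => (a.color, a.kind)) =
        p.pieces.map fun a => (a.color, a.kind) := by
      refine List.ext_getElem? fun k => ?_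
      simp only [Position.play, List.getElem?_map, List.getElem?_mapIdx, Option.map_map]
      congr 1
      funext b
      simp only [Function.comp]
      split_ifs <;> rfl
    rw [hcount, hmap, ← hcount]
    exact hp.one_king c
  · have hd := List.pairwise_iff_getElem.1 hp.disjoint
    rw [List.pairwise_iff_getElem]
    intro k l hk hl hkl
    simp only [Position.play, List.length_mapIdx] at hk hl
    have := hd k l hk hl hkl
    simp only [Position.play, List.getElem_mapIdx]
    by_cases hki : k = i <;> by_cases hli : l = i
    · omega
    · simp only [hki, hli, if_true, if_false]
      split_ifs with h₁
      · simp
      · rintro ⟨-, h₂, h₃⟩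
        exact h₁ ⟨h₂, h₃.symm⟩
    · simp only [hki, hli, if_true, if_false]
      split_ifs with h₁
      · simp
      · rintro ⟨h₂, -, h₃⟩
        exact h₁ ⟨h₂, h₃⟩
    · simp only [hki, hli, if_false]
      split_ifs <;> simp_all
  · intro b hb hba
    obtain ⟨k, hk⟩ := List.mem_iff_getElem?.1 hb
    simp only [Position.play, List.getElem?_mapIdx, Option.map_eq_some_iff] at hk
    obtain ⟨b', hb', rfl⟩ := hk
    by_cases hki : k = i
    · subst hki
      rw [ha, Option.some_inj] at hb'
      subst hb'
      simp [hal] at hba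
    · simp only [hki, if_false] at hba ⊢
      split_ifs at hba ⊢ with h₁
      · rfl
      · exact hp.captured b' (List.mem_of_getElem? hb') hba

section Play

variable {p : Position} {f : ℕ → Position}

theorem hist_eq (f : ℕ → Position) (t : ℕ) : hist f t = (List.range t).map f ++ [f t] := by
  rw [hist, List.range_succ, List.map_append, List.map_singleton]

theorem length_hist (f : ℕ → Position) (t : ℕ) : (hist f t).length = t + 1 := by simp [hist]

theorem getElem?_hist {f : ℕ → Position} {s t : ℕ} (h : s ≤ t) : (hist f t)[s]? = some (f s) := by
  rw [hist, List.getElem?_map, List.getElem?_range (by omega), Option.map_some]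

theorem eq_of_hist_eq {f g : ℕ → Position} {s t : ℕ} (h : hist f s = hist g t) :
    s = t ∧ ∀ i ≤ t, f i = g i := by
  have hl := congrArg List.length h
  rw [length_hist, length_hist, Nat.add_right_cancel_iff] at hl
  subst hl
  refine ⟨rfl, fun i hi => ?_⟩
  have := congrArg (fun l => l[i]?) h
  simpa only [getElem?_hist hi, Option.some_inj] using this

theorem hist_congr {f g : ℕ → Position} {t : ℕ} (h : ∀ i ≤ t, f i = g i) : hist f t = hist g t :=
  List.map_congr_left fun i hi => h i (by rw [List.mem_range] at hi; omega)

theorem IsPlay.valid (hf : IsPlay p f) (hp : p.Valid) (t : ℕ) : (f t).Valid := by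
  induction t with
  | zero => rwa [hf.1]
  | succ t ih =>
    by_cases ho : (f t).Over
    · rwa [(hf.2 t).1 ho]
    · exact valid_of_oneMove ih ((hf.2 t).2 ho)

theorem IsPlay.eq_of_over (hf : IsPlay p f) {s t : ℕ} (hs : (f s).Over) (hst : s ≤ t) :
    f t = f s := by
  induction t, hst using Nat.le_induction with
  | base => rfl
  | succ t _ ih => rw [(hf.2 t).1 (ih ▸ hs), ih]

theorem IsPlay.not_over_of_le (hf : IsPlay p f) {s t : ℕ} (ht : ¬ (f t).Over) (hst : s ≤ t) :
    ¬ (f s).Over := fun hs => ht (hf.eq_of_over hs hst ▸ hs)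

/-- The number of plies during which `c` makes at most `n` moves. -/
def plies (c : Color) (n : ℕ) (p : Position) : ℕ := 2 * n + if p.turn = c then 0 else 1

theorem IsPlay.turn_iff (hf : IsPlay p f) (c : Color) {t : ℕ} (h : ∀ s < t, ¬ (f s).Over) :
    (f t).turn = c ↔ (t + plies c 0 p) % 2 = 0 := by
  induction t with
  | zero =>
    rw [hf.1, plies]
    split_ifs with hc <;> simp [hc]
  | succ t ih =>
    have ih := ih fun s hs => h s (by omega)
    rw [((hf.2 t).2 (h t (by omega))).turn]
    by_cases hc : (f t).turn = c
    · rw [hc, iff_false_left c.other_ne]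
      have := ih.1 hc
      omega
    · have : (t + plies c 0 p) % 2 ≠ 0 := fun h' => hc (ih.2 h')
      rw [Color.ne_iff.1 hc, c.other_other, iff_true_left rfl]
      omega

theorem plies_eq (c : Color) (n : ℕ) (p : Position) : plies c n p = 2 * n + plies c 0 p := by
  simp [plies]

theorem plies_zero_le (c : Color) (p : Position) : plies c 0 p ≤ 1 := by
  rw [plies]
  split_ifs <;> omega

/-- While the game lasts, `c` moves exactly at the times `2 * i + plies c 0 p`; counting these
converts plies into moves of `c`, here and in the next lemma. -/
theorem IsPlay.movesMade_le (hf : IsPlay p f) {c : Color} {n t : ℕ} (ht : t ≤ plies c n p) :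
    movesMade c f t ≤ n := by
  have hsub : {s : ℕ | s < t ∧ (f s).turn = c ∧ ¬ (f s).Over} ⊆
      (fun i => 2 * i + plies c 0 p) '' (Set.Iio n) := by
    rintro s ⟨hs, hc, ho⟩
    have h₁ := (hf.turn_iff c fun r hr => hf.not_over_of_le ho hr.le).1 hc
    have h₂ := plies_zero_le c p
    rw [plies_eq] at ht
    exact ⟨(s - plies c 0 p) / 2, by simp only [Set.mem_Iio]; omega, by simp only; omega⟩
  refine (Set.ncard_le_ncard hsub ((Set.finite_Iio n).image _)).trans ?_
  refine (Set.ncard_image_le (Set.finite_Iio n)).trans ?_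
  rw [Set.ncard_eq_toFinset_card', Set.toFinset_Iio, Nat.card_Iio]

theorem IsPlay.lt_movesMade (hf : IsPlay p f) {c : Color} {n t : ℕ}
    (ho : ∀ s ≤ plies c n p, ¬ (f s).Over) (ht : plies c n p < t) : n < movesMade c f t := by
  have hsub : (fun i => 2 * i + plies c 0 p) '' (Set.Iic n) ⊆
      {s : ℕ | s < t ∧ (f s).turn = c ∧ ¬ (f s).Over} := by
    rintro _ ⟨i, hi, rfl⟩
    rw [Set.mem_Iic] at hi
    rw [plies_eq] at ht ho
    have hle : 2 * i + plies c 0 p ≤ 2 * n + plies c 0 p := by omega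
    refine ⟨hle.trans_lt ht, ?_, ho _ hle⟩
    refine (hf.turn_iff c fun s hs => ho s (hs.le.trans hle)).2 ?_
    omega
  have hfin : {s : ℕ | s < t ∧ (f s).turn = c ∧ ¬ (f s).Over}.Finite :=
    (Set.finite_Iio t).subset fun s hs => hs.1
  have h₁ := Set.ncard_le_ncard hsub hfin
  rw [Set.ncard_image_of_injective _ (fun i j (hij : 2 * i + plies c 0 p = 2 * j + plies c 0 p) => by omega),
    Set.ncard_eq_toFinset_card', Set.toFinset_Iic, Nat.card_Iic] at h₁
  exact h₁

/-- Plays can be constructed move by move. -/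
theorem exists_play (hp : p.Valid) (P : List Position → Position → Prop)
    (hP : ∀ h q, q.Valid → ¬ q.Over → ∃ q', OneMove q q' ∧ P (h ++ [q]) q') :
    ∃ f, IsPlay p f ∧ ∀ t, ¬ (f t).Over → P (hist f t) (f (t + 1)) := by
  classical
  have hP' : ∀ h q, ∃ q', (q.Over → q' = q) ∧
      (q.Valid → ¬ q.Over → OneMove q q' ∧ P (h ++ [q]) q') := by
    intro h q
    by_cases ho : q.Over
    · exact ⟨q, fun _ => rfl, fun _ h => absurd ho h⟩
    · by_cases hv : q.Valid
      · obtain ⟨q', hq'⟩ := hP h q hv ho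
        exact ⟨q', fun h => absurd h ho, fun _ _ => hq'⟩
      · exact ⟨q, fun _ => rfl, fun h => absurd h hv⟩
  choose g hg₁ hg₂ using hP'
  -- The state holds the past without the present position, and the present position, matching the
  -- form `h ++ [q]` of histories.
  let st : ℕ → List Position × Position := fun n =>
    n.rec ([], p) fun _ x => (x.1 ++ [x.2], g x.1 x.2)
  have hst (n : ℕ) : st (n + 1) = ((st n).1 ++ [(st n).2], g (st n).1 (st n).2) := rfl
  have hpast (n : ℕ) : (st n).1 = (List.range n).map fun i => (st i).2 := by
    induction n with
    | zero => rfl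
    | succ n ih => rw [hst, ih, List.range_succ, List.map_append, List.map_singleton]
  have hval (n : ℕ) : (st n).2.Valid := by
    induction n with
    | zero => exact hp
    | succ n ih =>
      rw [hst]
      by_cases ho : (st n).2.Over
      · simp only [hg₁ _ _ ho, ih]
      · exact valid_of_oneMove ih (hg₂ (st n).1 _ ih ho).1
  refine ⟨fun n => (st n).2, ⟨rfl, fun t => ⟨fun ho => ?_, fun ho => ?_⟩⟩, fun t ho => ?_⟩
  · simp only [hst, hg₁ _ _ ho]
  · exact (hg₂ (st t).1 _ (hval t) ho).1
  · rw [hist_eq, ← hpast]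
    exact (hg₂ (st t).1 _ (hval t) ho).2

/-! ### Strategies, determinacy and ranks -/

variable {σ τ : Strategy} {c : Color} {G : Position → Prop}

theorem Legal.exists_move (hσ : Legal σ c) {q : Position} (hv : q.Valid) (hc : q.turn = c)
    (ho : ¬ q.Over) (h : List Position) : ∃ q', OneMove q q' ∧ ∀ r ∈ σ (h ++ [q]), q' = r := by
  by_cases hd : (σ (h ++ [q])).Dom
  · refine ⟨(σ (h ++ [q])).get hd, hσ h q _ hv hc ho (Part.get_mem hd), fun r hr => ?_⟩
    exact Part.get_eq_of_mem hr hd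
  · obtain ⟨q', hq'⟩ := exists_oneMove_of_not_over ho
    exact ⟨q', hq', fun r hr => absurd (Part.dom_iff_mem.2 ⟨r, hr⟩) hd⟩

theorem exists_play_follows (hp : p.Valid) (hσ : Legal σ c) (hτ : Legal τ c.other) :
    ∃ f, IsPlay p f ∧ Follows σ c f ∧ Follows τ c.other f := by
  obtain ⟨f, hf, h⟩ := exists_play hp
    (fun h q' => ∀ q, h.getLast? = some q → (q.turn = c → ∀ r ∈ σ h, q' = r) ∧
      (q.turn = c.other → ∀ r ∈ τ h, q' = r)) (by
      intro h q hv ho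
      simp only [List.getLast?_concat, Option.some_inj, forall_eq']
      by_cases hc : q.turn = c
      · obtain ⟨q', hq', hr⟩ := hσ.exists_move hv hc ho h
        exact ⟨q', hq', fun _ => hr, fun h' => absurd (hc.symm.trans h').symm c.other_ne⟩
      · obtain ⟨q', hq', hr⟩ := hτ.exists_move hv (Color.ne_iff.1 hc) ho h
        exact ⟨q', hq', fun h' => absurd h' hc, fun _ => hr⟩)
  have hl (t : ℕ) : (hist f t).getLast? = some (f t) := by rw [hist_eq, List.getLast?_concat]
  exact ⟨f, hf, fun t hc ho => (h t ho _ (hl t)).1 hc, fun t hc ho => (h t ho _ (hl t)).2 hc⟩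

/-- Both strategies are played against each other; in the resulting play the goal occurs within `n`
but not within `j` moves of `c`. -/
theorem lt_of_avoids_of_forces (hp : p.Valid) (hσ : Legal σ c) (hτ : Legal τ c.other) {j n : ℕ}
    (h : Forces σ c G n p) (h' : Avoids τ c G j p) : j < n := by
  obtain ⟨f, hf, h₁, h₂⟩ := exists_play_follows hp hσ hτ
  obtain ⟨t, hG, hn⟩ := h f hf h₁
  exact (h' f hf h₂ t hG).trans_le hn

/-- The move that the strategy `σ` prescribes after the history `h` decreases the rank of `q`. -/
def DecreasesRank (σ : Strategy) (c : Color) (G : Position → Prop) (h : List Position)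
    (q : Position) : Prop :=
  ∃ r ∈ σ h, ∀ m, Forced c G (m + 1) q → Forced c G m r

/-- As long as the goal is not reached, a strategy that always decreases the rank keeps it small. -/
theorem exists_goal_or_forced {n : ℕ} (hf : IsPlay p f) (hfol : Follows σ c f)
    (hσ : ∀ t, (f t).turn = c → ¬ (f t).Over → (∀ s ≤ t, ¬ G (f s)) →
      (∃ m, Forced c G m (f t)) → DecreasesRank σ c G (hist f t) (f t))
    (h : Forced c G n p) : ∀ t ≤ n, (∃ s ≤ t, G (f s)) ∨ Forced c G (n - t) (f t) := by
  intro t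
  induction t with
  | zero => exact fun _ => Or.inr (by rwa [hf.1])
  | succ t ih =>
    intro ht
    by_cases hG : ∃ s ≤ t, G (f s)
    · obtain ⟨s, hs, hG⟩ := hG
      exact Or.inl ⟨s, by omega, hG⟩
    right
    have hF := (ih (by omega)).resolve_left hG
    push Not at hG
    rw [show n - t = n - (t + 1) + 1 by omega] at hF
    have hF' := hF
    rcases hF with hF | ⟨ho, h₁, h₂⟩
    · exact absurd hF (hG t le_rfl)
    by_cases hc : (f t).turn = c
    · obtain ⟨r, hr, h₄⟩ := hσ t hc ho hG ⟨_, hF'⟩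
      rw [hfol t hc ho r hr]
      exact h₄ _ hF'
    · exact h₂ hc _ ((hf.2 t).2 ho)

/-- A strategy that always decreases the rank reaches the goal in time. -/
theorem exists_goal_of_forced {n : ℕ} (hf : IsPlay p f) (hfol : Follows σ c f)
    (hσ : ∀ t, (f t).turn = c → ¬ (f t).Over → (∀ s ≤ t, ¬ G (f s)) →
      (∃ m, Forced c G m (f t)) → DecreasesRank σ c G (hist f t) (f t))
    (h : Forced c G n p) : ∃ t ≤ n, G (f t) := by
  rcases exists_goal_or_forced hf hfol hσ h n le_rfl with ⟨s, hs, hG⟩ | hF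
  · exact ⟨s, hs, hG⟩
  · rw [Nat.sub_self] at hF
    exact ⟨n, le_rfl, hF⟩

theorem forces_of_forced {n : ℕ} (hσ : ∀ h q, q.turn = c → ¬ q.Over → ¬ G q →
      (∃ m, Forced c G m q) → DecreasesRank σ c G (h ++ [q]) q)
    (h : Forced c G (plies c n p) p) : Forces σ c G n p := fun f hf hfol =>
  let ⟨t, ht, hG⟩ := exists_goal_of_forced hf hfol
    (fun t hc ho hG hm => hist_eq f t ▸ hσ _ _ hc ho (hG t le_rfl) hm) h
  ⟨t, hG, hf.movesMade_le ht⟩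

/-- A strategy of the opponent that never lets the rank become small avoids the goal. -/
theorem avoids_of_not_forced {n N : ℕ} (hτ : ∀ h q, q.turn = c.other → ¬ q.Over → ∀ m < N,
      ¬ Forced c G (m + 1) q → ∃ r ∈ τ (h ++ [q]), ¬ Forced c G m r)
    (hN : plies c n p ≤ N) (h : ¬ Forced c G (plies c n p) p) : Avoids τ c G n p := by
  intro f hf hfol
  have key : ∀ t ≤ plies c n p, ¬ Forced c G (plies c n p - t) (f t) := by
    intro t
    induction t with
    | zero => exact fun _ => by rwa [hf.1]
    | succ t ih =>
      intro ht
      have ih := ih (by omega)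
      rw [show plies c n p - t = plies c n p - (t + 1) + 1 by omega] at ih
      by_cases ho : (f t).Over
      -- A finished game stands still, and a goal that is not forced within `m + 1` plies is not
      -- forced within `m`.
      · rw [(hf.2 t).1 ho]
        exact fun h' => ih h'.succ
      · by_cases hc : (f t).turn = c
        · exact fun h' => ih (Or.inr ⟨ho, fun _ => ⟨_, (hf.2 t).2 ho, h'⟩, fun h'' => absurd hc h''⟩)
        · have hc' := Color.ne_iff.1 hc
          have h₃ := hτ ((List.range t).map f) (f t) hc' ho _ (by omega) ih
          rw [← hist_eq] at h₃
          obtain ⟨r, hr, h₄⟩ := h₃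
          rwa [hfol t hc' ho r hr]
  have key' : ∀ t ≤ plies c n p, ¬ G (f t) := fun t ht hG => key t ht (Forced.of_goal hG)
  intro t hG
  -- If the game stops within the horizon, later positions repeat one already excluded. Otherwise
  -- all these plies are really played, and beyond them `c` has made more than `n` moves.
  by_cases ho : ∃ s ≤ plies c n p, (f s).Over
  · obtain ⟨s, hs, ho⟩ := ho
    rcases le_total t s with hts | hst
    · exact absurd hG (key' t (hts.trans hs))
    · rw [hf.eq_of_over ho hst] at hG
      exact absurd hG (key' s hs)
  · push Not at ho
    refine hf.lt_movesMade ho (lt_of_not_ge fun h' => key' t h' hG)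

/-- Validity persists along a play, so goals need to agree only on valid positions. This is used to
replace confinement by strategies with its combinatorial form. -/
theorem Forces.congr {G H : Position → Prop} (hGH : ∀ q, q.Valid → (G q ↔ H q)) (hp : p.Valid)
    {n : ℕ} (h : Forces σ c G n p) : Forces σ c H n p := fun f hf hfol =>
  let ⟨t, hG, hn⟩ := h f hf hfol
  ⟨t, (hGH _ (hf.valid hp t)).1 hG, hn⟩

theorem Avoids.congr {G H : Position → Prop} (hGH : ∀ q, q.Valid → (G q ↔ H q)) (hp : p.Valid)
    {n : ℕ} (h : Avoids τ c G n p) : Avoids τ c H n p := fun f hf hfol t hH =>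
  h f hf hfol t ((hGH _ (hf.valid hp t)).2 hH)

/-! ### Confining strategies -/

theorem IsPlay.mem_of_closed {F : Set Position} (hF : Closed c F) (hf : IsPlay p f)
    (hfol : Follows σ c f) {t : ℕ} (ht : f t ∈ F)
    (hσ : ∀ s, t ≤ s → f s ∈ F → (f s).turn = c → ∃ r ∈ σ (hist f s), r ∈ F) {s : ℕ}
    (hs : t ≤ s) : f s ∈ F := by
  induction s, hs using Nat.le_induction with
  | base => exact ht
  | succ s hs ih =>
    obtain ⟨ho, -, h₂⟩ := hF _ ih
    by_cases hc : (f s).turn = c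
    · obtain ⟨r, hr, hrF⟩ := hσ s hs ih hc
      rwa [hfol s hc ho r hr]
    · exact h₂ hc _ ((hf.2 s).2 ho)

theorem canConfine_of_closed {k : ℕ} {V : List Position} (hV : Closed c {q | q ∈ V})
    (hlen : V.length ≤ k) (hp : p ∈ V) : CanConfine c k p := by
  classical
  let g : Position → Option Position := fun q =>
    if hq : ∃ q' ∈ V, OneMove q q' then some hq.choose else none
  have hg {q r : Position} (h : g q = some r) : r ∈ V ∧ OneMove q r := by
    simp only [g] at h
    split_ifs at h with hq
    rw [Option.some_inj] at h
    exact h ▸ hq.choose_spec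
  refine ⟨fun h => Part.ofOption (h.getLast?.bind g), ?_, V.toFinset,
    (List.toFinset_card_le V).trans hlen, ?_⟩
  · intro h q r _ _ _ hr
    simp only [List.getLast?_concat, Option.bind_some, Part.mem_ofOption] at hr
    exact (hg hr).2
  · intro q f hf hfol t ht s hs
    obtain ⟨rfl, h₀⟩ := eq_of_hist_eq (g := fun _ => p) (s := t) (t := 0) ht
    have h₁ : f s ∈ {q | q ∈ V} := by
      refine hf.mem_of_closed hV hfol (t := 0) (by rw [h₀ 0 le_rfl]; exact hp) ?_ hs
      intro i _ hi hc
      have h₂ := (hV _ hi).2.1 hc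
      rw [hist_eq, List.getLast?_concat, Option.bind_some]
      have h₃ : g (f i) = some h₂.choose := dif_pos h₂
      exact ⟨_, by rw [h₃]; exact Part.mem_some _, (hg h₃).1⟩
    exact ⟨List.mem_toFinset.2 h₁, (hV _ h₁).1⟩

/-- The members of `F` visited by plays following `σ` form a closed family. When `c` is to move,
such a play supplies the successor itself. When the opponent is to move, any reply can be spliced
onto the past and `σ` resumed, which is again a play following `σ` and so stays in `F`. -/
theorem confinable_of_canConfine {k : ℕ} (hp : p.Valid) (h : CanConfine c k p) :
    Confinable c k p := by
  classical
  obtain ⟨σ, hσ, F, hcard, hF⟩ := h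
  have hstay {f : ℕ → Position} (hf : IsPlay p f) (hfol : Follows σ c f) (s : ℕ) :
      f s ∈ F ∧ ¬ (f s).Over :=
    hF p f hf hfol 0 (by simp [hist, hf.1]) s (Nat.zero_le s)
  let V := F.filter fun q => ∃ f s, IsPlay p f ∧ Follows σ c f ∧ f s = q
  have hV {f : ℕ → Position} (hf : IsPlay p f) (hfol : Follows σ c f) (s : ℕ) : f s ∈ V :=
    Finset.mem_filter.2 ⟨(hstay hf hfol s).1, f, s, hf, hfol, rfl⟩
  have hclosed : Closed c {q | q ∈ V} := by
    intro q hq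
    obtain ⟨-, f, s, hf, hfol, rfl⟩ := Finset.mem_filter.1 hq
    have ho (i : ℕ) := (hstay hf hfol i).2
    refine ⟨ho s, fun hc => ⟨f (s + 1), hV hf hfol _, (hf.2 s).2 (ho s)⟩, fun hc q' hq' => ?_⟩
    -- The spliced play copies `f` up to time `s`, continues with `q'`, and obeys `σ` thereafter.
    obtain ⟨g, hg, hgP⟩ := exists_play hp
      (fun h r => (∀ i < s, h = hist f i → r = f (i + 1)) ∧ (h = hist f s → r = q') ∧
        ∀ q, h.getLast? = some q → q.turn = c → ∀ x ∈ σ h, r = x) (by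
        intro h r hv hor
        simp only [List.getLast?_concat, Option.some_inj, forall_eq']
        have hlast {i : ℕ} (hi : h ++ [r] = hist f i) : r = f i := by
          have := congrArg List.getLast? hi
          rwa [hist_eq, List.getLast?_concat, List.getLast?_concat, Option.some_inj] at this
        by_cases h₁ : ∃ i < s, h ++ [r] = hist f i
        · obtain ⟨i, hi, hir⟩ := h₁
          have hri := hlast hir
          refine ⟨f (i + 1), hri ▸ (hf.2 i).2 (ho i), fun j hj hjr => ?_, fun hsr => ?_,
            fun hrc x hx => ?_⟩
          · rw [(eq_of_hist_eq (hir.symm.trans hjr)).1]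
          · exact absurd (eq_of_hist_eq (hir.symm.trans hsr)).1 hi.ne
          · exact hfol i (hri ▸ hrc) (ho i) x (hir ▸ hx)
        by_cases h₂ : h ++ [r] = hist f s
        · have hrs := hlast h₂
          exact ⟨q', hrs ▸ hq', fun i hi hir => absurd ⟨i, hi, hir⟩ h₁, fun _ => rfl,
            fun hrc => absurd (hrs ▸ hrc) hc⟩
        by_cases hrc : r.turn = c
        · obtain ⟨r', hr', hx⟩ := hσ.exists_move hv hrc hor h
          exact ⟨r', hr', fun i hi hir => absurd ⟨i, hi, hir⟩ h₁, fun h => absurd h h₂,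
            fun _ => hx⟩
        · obtain ⟨r', hr'⟩ := exists_oneMove_of_not_over hor
          exact ⟨r', hr', fun i hi hir => absurd ⟨i, hi, hir⟩ h₁, fun h => absurd h h₂,
            fun h => absurd h hrc⟩)
    have hgf : ∀ i ≤ s, ∀ j ≤ i, g j = f j := by
      intro i
      induction i with
      | zero =>
        intro _ j hj
        obtain rfl : j = 0 := by omega
        rw [hg.1, hf.1]
      | succ i ih =>
        intro hi j hj
        have ih := ih (by omega)
        rcases hj.eq_or_lt with rfl | hj
        · refine (hgP i ?_).1 i (by omega) (hist_congr ih)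
          rw [ih i le_rfl]
          exact ho i
        · exact ih j (by omega)
    have hgfol : Follows σ c g := fun t htc hto x hx =>
      (hgP t hto).2.2 (g t) (by rw [hist_eq, List.getLast?_concat]) htc x hx
    have : g (s + 1) = q' := by
      refine (hgP s ?_).2.1 (hist_congr (hgf s le_rfl))
      rw [hgf s le_rfl s le_rfl]
      exact ho s
    rw [← this]
    exact hV hg hgfol _
  -- Some play follows `σ`, here against an opponent bound by nothing; hence `p` belongs to the
  -- family and `k` is positive.
  obtain ⟨f, hf, hfol, -⟩ := exists_play_follows hp hσ
    (τ := fun _ => Part.none) (fun _ _ _ _ _ _ h => absurd h (Part.notMem_none _))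
  have hpV : p ∈ V := hf.1 ▸ hV hf hfol 0
  have hVk : V.card ≤ k := (Finset.card_le_card (Finset.filter_subset _ _)).trans hcard
  have hpos : 0 < V.card := Finset.card_pos.2 ⟨p, hpV⟩
  refine ⟨by omega, Completable.of_closed hclosed (List.nodup_singleton p) (by simpa using hpV) ?_⟩
  rw [List.length_singleton]
  omega

theorem canConfine_iff {k : ℕ} (hp : p.Valid) : CanConfine c k p ↔ Confinable c k p := by
  refine ⟨confinable_of_canConfine hp, fun h => ?_⟩
  obtain ⟨W, hW, hc⟩ := completable_iff.1 h.2
  obtain ⟨h₁, h₂⟩ := subset_and_length_of_mem_families hW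
  rw [List.length_singleton] at h₂
  have := h.1
  exact canConfine_of_closed hc (by omega) (h₁ (List.mem_singleton_self p))

end Play

end InfiniteChess

/-! ### Primitive recursive operations on integers and lists -/

section PrimrecLists

variable {α β γ : Type*} [Primcodable α] [Primcodable β] [Primcodable γ]

theorem PrimrecPred.imp {p q : α → Prop} (hp : PrimrecPred p) (hq : PrimrecPred q) :
    PrimrecPred fun a => p a → q a :=
  (hp.not.or hq).of_eq fun _ => imp_iff_not_or.symm

theorem PrimrecPred.ex_mem {f : α → List β} {R : α × β → Prop} (hf : Primrec f)
    (hR : PrimrecPred R) : PrimrecPred fun a => ∃ b ∈ f a, R (a, b) :=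
  (PrimrecRel.exists_mem_list (R := fun b a => R (a, b))
    (hR.comp (Primrec.pair Primrec.snd Primrec.fst))).comp hf Primrec.id

theorem PrimrecPred.all_mem {f : α → List β} {R : α × β → Prop} (hf : Primrec f)
    (hR : PrimrecPred R) : PrimrecPred fun a => ∀ b ∈ f a, R (a, b) :=
  (PrimrecRel.forall_mem_list (R := fun b a => R (a, b))
    (hR.comp (Primrec.pair Primrec.snd Primrec.fst))).comp hf Primrec.id

theorem Primrec.filter {f : α → List β} {R : α × β → Prop} (hf : Primrec f)
    (hR : PrimrecPred R) [∀ a b, Decidable (R (a, b))] :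
    Primrec fun a => (f a).filter fun b => R (a, b) := by
  classical
  exact ((PrimrecRel.listFilter (R := fun b a => R (a, b))
    (hR.comp (Primrec.pair Primrec.snd Primrec.fst))).comp hf Primrec.id).of_eq fun a => by
      simp only [id]

theorem PrimrecPred.mem_list {f : α → β} {g : α → List β} (hf : Primrec f) (hg : Primrec g) :
    PrimrecPred fun a => f a ∈ g a :=
  (PrimrecPred.ex_mem (R := fun x => x.2 = f x.1) hg
    (Primrec.eq.comp Primrec.snd (hf.comp Primrec.fst))).of_eq fun a => by simp

theorem Primrec.list_sum : Primrec (List.sum : List ℕ → ℕ) :=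
  (Primrec.list_foldr Primrec.id (Primrec.const 0)
    (Primrec.nat_add.comp (Primrec.fst.comp Primrec.snd) (Primrec.snd.comp Primrec.snd)).to₂).of_eq
    fun _ => rfl

theorem Primrec.nat_factorial : Primrec Nat.factorial :=
  (Primrec.nat_rec₁ 1 (f := fun n m => (n + 1) * m)
    (Primrec.nat_mul.comp (Primrec.succ.comp Primrec.fst) Primrec.snd).to₂).of_eq fun n => by
      induction n with
      | zero => rfl
      | succ n ih => exact congrArg ((n + 1) * ·) ih

theorem Primrec.list_product {f : α → List β} {g : α → List γ} (hf : Primrec f) (hg : Primrec g) :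
    Primrec fun a => (f a).product (g a) :=
  (Primrec.list_flatMap hf (Primrec.list_map (hg.comp Primrec.fst)
    (Primrec.pair (Primrec.snd.comp Primrec.fst) Primrec.snd).to₂).to₂).of_eq fun _ => rfl

theorem Primrec.list_mapIdx {f : α → List β} {g : α × ℕ × β → γ} (d : β) (hf : Primrec f)
    (hg : Primrec g) : Primrec fun a => (f a).mapIdx fun i b => g (a, i, b) := by
  refine (Primrec.list_map (f := fun a => List.range (f a).length)
    -- The default `d` is never reached, since the indices stay below the length.
    (g := fun a i => g (a, i, ((f a)[i]?).getD d))
    (Primrec.list_range.comp (Primrec.list_length.comp hf)) ?_).of_eq fun a => ?_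
  · exact (hg.comp (Primrec.pair Primrec.fst (Primrec.pair Primrec.snd (Primrec.option_getD.comp
      (Primrec.list_getElem?.comp (hf.comp Primrec.fst) Primrec.snd) (Primrec.const d))))).to₂
  · refine List.ext_getElem (by simp) fun i h₁ h₂ => ?_
    simp only [List.length_mapIdx] at h₂
    simp [List.getElem?_eq_getElem h₂]

end PrimrecLists

section PrimrecInt

theorem Int.encode_natCast (n : ℕ) : Encodable.encode (n : ℤ) = 2 * n := rfl

theorem Int.encode_negSucc (n : ℕ) : Encodable.encode (Int.negSucc n) = 2 * n + 1 := rfl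

/-- The encoding sends nonnegative integers to even and negative ones to odd numbers, so parity
reveals the sign. -/
theorem Primrec.int_toNat : Primrec Int.toNat :=
  (Primrec.ite (c := fun z : ℤ => Encodable.encode z % 2 = 0)
    (Primrec.eq.comp (Primrec.nat_mod.comp Primrec.encode (Primrec.const 2)) (Primrec.const 0))
    (Primrec.nat_div.comp Primrec.encode (Primrec.const 2)) (Primrec.const 0)).of_eq fun z => by
      cases z with
      | ofNat n =>
        rw [Int.ofNat_eq_natCast, Int.encode_natCast]
        simp
      | negSucc n =>
        rw [Int.encode_negSucc, if_neg (by omega)]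
        rfl

theorem Primrec.int_neg_toNat : Primrec fun z : ℤ => (-z).toNat :=
  (Primrec.ite (c := fun z : ℤ => Encodable.encode z % 2 = 0)
    (Primrec.eq.comp (Primrec.nat_mod.comp Primrec.encode (Primrec.const 2)) (Primrec.const 0))
    (Primrec.const 0)
    (Primrec.succ.comp (Primrec.nat_div.comp Primrec.encode (Primrec.const 2)))).of_eq fun z => by
      cases z with
      | ofNat n =>
        rw [Int.ofNat_eq_natCast, Int.encode_natCast]
        simp
      | negSucc n =>
        rw [Int.encode_negSucc, if_neg (by omega), Int.neg_negSucc]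
        simp only [Int.toNat_natCast]
        omega

/-- The arithmetic of `ℤ` reduces to that of `ℕ` through this map, each integer being the difference
of its positive and negative parts. -/
theorem Primrec.int_subNat : Primrec₂ fun m n : ℕ => (m : ℤ) - n :=
  (Primrec.ite (c := fun x : ℕ × ℕ => x.2 ≤ x.1) (Primrec.nat_le.comp Primrec.snd Primrec.fst)
    ((Primrec.ofNat ℤ).comp (Primrec.nat_mul.comp (Primrec.const 2)
      (Primrec.nat_sub.comp Primrec.fst Primrec.snd)))
    ((Primrec.ofNat ℤ).comp (Primrec.succ.comp (Primrec.nat_mul.comp (Primrec.const 2)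
      (Primrec.pred.comp (Primrec.nat_sub.comp Primrec.snd Primrec.fst)))))).to₂.of_eq
    fun m n => by
      dsimp only
      split_ifs with h
      · rw [← Int.encode_natCast, Denumerable.ofNat_encode]
        omega
      · rw [Nat.succ_eq_add_one, ← Int.encode_negSucc, Denumerable.ofNat_encode]
        rw [Int.negSucc_eq]
        have : (n - m).pred = n - m - 1 := rfl
        omega

theorem Primrec.int_natCast : Primrec fun n : ℕ => (n : ℤ) :=
  (Primrec.int_subNat.comp Primrec.id (Primrec.const 0)).of_eq fun n => by simp

theorem Primrec.int_add : Primrec₂ fun a b : ℤ => a + b :=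
  (Primrec.int_subNat.comp
    (Primrec.nat_add.comp (Primrec.int_toNat.comp Primrec.fst) (Primrec.int_toNat.comp Primrec.snd))
    (Primrec.nat_add.comp (Primrec.int_neg_toNat.comp Primrec.fst)
      (Primrec.int_neg_toNat.comp Primrec.snd))).to₂.of_eq fun a b => by
        dsimp only
        omega

theorem Primrec.int_sub : Primrec₂ fun a b : ℤ => a - b :=
  (Primrec.int_subNat.comp
    (Primrec.nat_add.comp (Primrec.int_toNat.comp Primrec.fst)
      (Primrec.int_neg_toNat.comp Primrec.snd))
    (Primrec.nat_add.comp (Primrec.int_neg_toNat.comp Primrec.fst)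
      (Primrec.int_toNat.comp Primrec.snd))).to₂.of_eq fun a b => by
        dsimp only
        omega

theorem Primrec.int_mul : Primrec₂ fun a b : ℤ => a * b :=
  (Primrec.int_subNat.comp
    (Primrec.nat_add.comp
      (Primrec.nat_mul.comp (Primrec.int_toNat.comp Primrec.fst)
        (Primrec.int_toNat.comp Primrec.snd))
      (Primrec.nat_mul.comp (Primrec.int_neg_toNat.comp Primrec.fst)
        (Primrec.int_neg_toNat.comp Primrec.snd)))
    (Primrec.nat_add.comp
      (Primrec.nat_mul.comp (Primrec.int_toNat.comp Primrec.fst)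
        (Primrec.int_neg_toNat.comp Primrec.snd))
      (Primrec.nat_mul.comp (Primrec.int_neg_toNat.comp Primrec.fst)
        (Primrec.int_toNat.comp Primrec.snd)))).to₂.of_eq fun a b => by
          have ha : a = (a.toNat : ℤ) - ((-a).toNat : ℤ) := by omega
          have hb : b = (b.toNat : ℤ) - ((-b).toNat : ℤ) := by omega
          dsimp only
          push_cast
          conv_rhs => rw [ha, hb]
          ring

theorem Primrec.int_natAbs : Primrec Int.natAbs :=
  (Primrec.nat_add.comp Primrec.int_toNat Primrec.int_neg_toNat).of_eq fun a => by omega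

theorem PrimrecRel.int_le : PrimrecRel fun a b : ℤ => a ≤ b :=
  (Primrec.nat_le.comp
    (Primrec.nat_add.comp (Primrec.int_toNat.comp Primrec.fst)
      (Primrec.int_neg_toNat.comp Primrec.snd))
    (Primrec.nat_add.comp (Primrec.int_neg_toNat.comp Primrec.fst)
      (Primrec.int_toNat.comp Primrec.snd))).of_eq fun x => by
        obtain ⟨a, b⟩ := x
        dsimp only
        omega

theorem Primrec.int_abs : Primrec fun a : ℤ => |a| :=
  (Primrec.int_natCast.comp Primrec.int_natAbs).of_eq fun a => (Int.abs_eq_natAbs a).symm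

theorem Primrec.int_sign : Primrec Int.sign :=
  (Primrec.int_sub.comp
    (Primrec.int_natCast.comp (Primrec.nat_min.comp Primrec.int_toNat (Primrec.const 1)))
    (Primrec.int_natCast.comp
      (Primrec.nat_min.comp Primrec.int_neg_toNat (Primrec.const 1)))).of_eq fun a => by
        rcases lt_trichotomy a 0 with h | rfl | h
        · rw [Int.sign_eq_neg_one_of_neg h]
          omega
        · rfl
        · rw [Int.sign_eq_one_of_pos h]
          omega

end PrimrecInt

namespace InfiniteChess

/-! ### The rules of chess are primitive recursive -/

instance : Finite Color := Finite.of_equiv Bool Color.equivBool.symm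

theorem primrec_color : Primrec Piece.color :=
  (Primrec.fst.comp (Primrec.of_equiv (e := Piece.equivProd))).of_eq fun _ => rfl

theorem primrec_kind : Primrec Piece.kind :=
  (Primrec.fst.comp (Primrec.snd.comp (Primrec.of_equiv (e := Piece.equivProd)))).of_eq fun _ => rfl

theorem primrec_alive : Primrec Piece.alive :=
  (Primrec.fst.comp (Primrec.snd.comp (Primrec.snd.comp
    (Primrec.of_equiv (e := Piece.equivProd))))).of_eq fun _ => rfl

theorem primrec_loc : Primrec Piece.loc :=
  (Primrec.snd.comp (Primrec.snd.comp (Primrec.snd.comp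
    (Primrec.of_equiv (e := Piece.equivProd))))).of_eq fun _ => rfl

theorem primrec_pieces : Primrec Position.pieces :=
  (Primrec.fst.comp (Primrec.of_equiv (e := Position.equivProd))).of_eq fun _ => rfl

theorem primrec_turn : Primrec Position.turn :=
  (Primrec.snd.comp (Primrec.of_equiv (e := Position.equivProd))).of_eq fun _ => rfl

section Context

variable {α : Type*} [Primcodable α]

theorem primrec_piece_mk {f : α → Color} {g : α → Kind} {h : α → Bool} {k : α → Square}
    (hf : Primrec f) (hg : Primrec g) (hh : Primrec h) (hk : Primrec k) :
    Primrec fun a => Piece.mk (f a) (g a) (h a) (k a) :=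
  ((Primrec.of_equiv_symm (e := Piece.equivProd)).comp
    (hf.pair (hg.pair (hh.pair hk)))).of_eq fun _ => rfl

theorem primrec_position_mk {f : α → List Piece} {g : α → Color} (hf : Primrec f)
    (hg : Primrec g) : Primrec fun a => Position.mk (f a) (g a) :=
  ((Primrec.of_equiv_symm (e := Position.equivProd)).comp (hf.pair hg)).of_eq fun _ => rfl

theorem primrec_other : Primrec Color.other := Primrec.dom_finite _

theorem primrec_forward : Primrec Color.forward := Primrec.dom_finite _

variable {p : α → Position} {s t d : α → Square} {a : α → Piece} {c : α → Color} {i X : α → ℕ}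

theorem primrec_isAlive (ha : Primrec a) : PrimrecPred fun x => (a x).alive = true :=
  Primrec.eq.comp (primrec_alive.comp ha) (Primrec.const true)

theorem primrec_occupied (hp : Primrec p) (hs : Primrec s) :
    PrimrecPred fun x => (p x).Occupied (s x) :=
  PrimrecPred.ex_mem (R := fun y : α × Piece => y.2.alive = true ∧ y.2.loc = s y.1)
    (primrec_pieces.comp hp) ((primrec_isAlive Primrec.snd).and
      (Primrec.eq.comp (primrec_loc.comp Primrec.snd) (hs.comp Primrec.fst)))

theorem primrec_occupiedBy (hp : Primrec p) (hc : Primrec c) (hs : Primrec s) :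
    PrimrecPred fun x => (p x).OccupiedBy (c x) (s x) :=
  PrimrecPred.ex_mem
    (R := fun y : α × Piece => y.2.alive = true ∧ y.2.color = c y.1 ∧ y.2.loc = s y.1)
    (primrec_pieces.comp hp) ((primrec_isAlive Primrec.snd).and
      ((Primrec.eq.comp (primrec_color.comp Primrec.snd) (hc.comp Primrec.fst)).and
        (Primrec.eq.comp (primrec_loc.comp Primrec.snd) (hs.comp Primrec.fst))))

/-- The square `t` lies strictly beyond `s` in the direction `d`, in terms of linear conditions. -/
def OnRayLinear (d s t : Square) : Prop :=
  (t.1 - s.1).sign = d.1 ∧ (t.2 - s.2).sign = d.2 ∧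
    (d.1 ≠ 0 → d.2 ≠ 0 → d.1 * (t.1 - s.1) = d.2 * (t.2 - s.2))

theorem primrec_onRayLinear (hd : Primrec d) (hs : Primrec s) (ht : Primrec t) :
    PrimrecPred fun x => OnRayLinear (d x) (s x) (t x) := by
  have d₁ := Primrec.fst.comp hd
  have d₂ := Primrec.snd.comp hd
  have h₁ := Primrec.int_sub.comp (Primrec.fst.comp ht) (Primrec.fst.comp hs)
  have h₂ := Primrec.int_sub.comp (Primrec.snd.comp ht) (Primrec.snd.comp hs)
  exact (Primrec.eq.comp (Primrec.int_sign.comp h₁) d₁).and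
    ((Primrec.eq.comp (Primrec.int_sign.comp h₂) d₂).and
      ((Primrec.eq.comp d₁ (Primrec.const 0)).not.imp ((Primrec.eq.comp d₂ (Primrec.const 0)).not.imp
        (Primrec.eq.comp (Primrec.int_mul.comp d₁ h₁) (Primrec.int_mul.comp d₂ h₂)))))

theorem primrec_slides {dirs : List Square} (hdirs : dirs ⊆ rookDirs ++ bishopDirs)
    (hp : Primrec p) (hs : Primrec s) (ht : Primrec t) :
    PrimrecPred fun x => (p x).Slides dirs (s x) (t x) := by
  refine (PrimrecPred.ex_mem (f := fun _ : α => dirs)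
    (R := fun y : α × Square => OnRayLinear y.2 (s y.1) (t y.1) ∧ ∀ b ∈ (p y.1).pieces,
      b.alive = true → ¬ (OnRayLinear y.2 (s y.1) b.loc ∧ OnRayLinear y.2 b.loc (t y.1)))
    (Primrec.const dirs) ?_).of_eq fun x => ?_
  · have hs' := hs.comp (Primrec.fst (α := α) (β := Square))
    have ht' := ht.comp (Primrec.fst (α := α) (β := Square))
    refine (primrec_onRayLinear Primrec.snd hs' ht').and
      (PrimrecPred.all_mem (R := fun z : (α × Square) × Piece => z.2.alive = true →
        ¬ (OnRayLinear z.1.2 (s z.1.1) z.2.loc ∧ OnRayLinear z.1.2 z.2.loc (t z.1.1)))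
        (primrec_pieces.comp (hp.comp Primrec.fst)) ?_)
    have hd := (Primrec.snd (α := α) (β := Square)).comp (Primrec.fst (β := Piece))
    have hl := primrec_loc.comp (Primrec.snd (α := α × Square) (β := Piece))
    exact (primrec_isAlive Primrec.snd).imp ((primrec_onRayLinear hd (hs'.comp Primrec.fst) hl).and
      (primrec_onRayLinear hd hl (ht'.comp Primrec.fst))).not
  · rw [slides_iff hdirs]
    refine exists_congr fun d => and_congr_right fun hd => ?_
    simp only [onRay_iff (hdirs hd), OnRayLinear]

theorem attacks_iff (p : Position) (a : Piece) (t : Square) : p.Attacks a t ↔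
    (a.kind = .king ∧ (t ≠ a.loc ∧ |t.1 - a.loc.1| ≤ 1 ∧ |t.2 - a.loc.2| ≤ 1)) ∨
    (a.kind = .queen ∧ p.Slides (rookDirs ++ bishopDirs) a.loc t) ∨
    (a.kind = .rook ∧ p.Slides rookDirs a.loc t) ∨
    (a.kind = .bishop ∧ p.Slides bishopDirs a.loc t) ∨
    (a.kind = .knight ∧ ((|t.1 - a.loc.1| = 1 ∧ |t.2 - a.loc.2| = 2) ∨
      (|t.1 - a.loc.1| = 2 ∧ |t.2 - a.loc.2| = 1))) ∨
    (a.kind = .pawn ∧ (|t.1 - a.loc.1| = 1 ∧ t.2 = a.loc.2 + a.color.forward)) := by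
  unfold Position.Attacks
  cases a.kind <;> simp

theorem primrec_attacks (hp : Primrec p) (ha : Primrec a) (ht : Primrec t) :
    PrimrecPred fun x => (p x).Attacks (a x) (t x) := by
  have hl := primrec_loc.comp ha
  have h₁ := Primrec.int_abs.comp
    (Primrec.int_sub.comp (Primrec.fst.comp ht) (Primrec.fst.comp hl))
  have h₂ := Primrec.int_abs.comp
    (Primrec.int_sub.comp (Primrec.snd.comp ht) (Primrec.snd.comp hl))
  have hk (k : Kind) : PrimrecPred fun x => (a x).kind = k :=
    Primrec.eq.comp (primrec_kind.comp ha) (Primrec.const k)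
  refine PrimrecPred.of_eq ?_ fun x => (attacks_iff (p x) (a x) (t x)).symm
  refine ((hk _).and ((Primrec.eq.comp ht hl).not.and
    ((PrimrecRel.int_le.comp h₁ (Primrec.const 1)).and
      (PrimrecRel.int_le.comp h₂ (Primrec.const 1))))).or ?_
  refine ((hk _).and (primrec_slides (fun _ h => h) hp hl ht)).or ?_
  refine ((hk _).and (primrec_slides (List.subset_append_left _ _) hp hl ht)).or ?_
  refine ((hk _).and (primrec_slides (List.subset_append_right _ _) hp hl ht)).or ?_
  refine ((hk _).and (((Primrec.eq.comp h₁ (Primrec.const 1)).and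
    (Primrec.eq.comp h₂ (Primrec.const 2))).or ((Primrec.eq.comp h₁ (Primrec.const 2)).and
    (Primrec.eq.comp h₂ (Primrec.const 1))))).or ?_
  exact (hk _).and ((Primrec.eq.comp h₁ (Primrec.const 1)).and
    (Primrec.eq.comp (Primrec.snd.comp ht) (Primrec.int_add.comp (Primrec.snd.comp hl)
      (primrec_forward.comp (primrec_color.comp ha)))))

theorem primrec_inCheck (hp : Primrec p) (hc : Primrec c) :
    PrimrecPred fun x => (p x).InCheck (c x) := by
  refine PrimrecPred.ex_mem (R := fun y : α × Piece => y.2.alive = true ∧ y.2.color = c y.1 ∧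
    y.2.kind = Kind.king ∧ ∃ a ∈ (p y.1).pieces, a.alive = true ∧ a.color = (c y.1).other ∧
      (p y.1).Attacks a y.2.loc) (primrec_pieces.comp hp) ?_
  have hp' := hp.comp (Primrec.fst (α := α) (β := Piece))
  have hc' := hc.comp (Primrec.fst (α := α) (β := Piece))
  refine (primrec_isAlive Primrec.snd).and ((Primrec.eq.comp (primrec_color.comp Primrec.snd)
    hc').and ((Primrec.eq.comp (primrec_kind.comp Primrec.snd) (Primrec.const _)).and ?_))
  refine PrimrecPred.ex_mem (R := fun z : (α × Piece) × Piece => z.2.alive = true ∧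
    z.2.color = (c z.1.1).other ∧ (p z.1.1).Attacks z.2 z.1.2.loc) (primrec_pieces.comp hp') ?_
  exact (primrec_isAlive Primrec.snd).and ((Primrec.eq.comp (primrec_color.comp Primrec.snd)
    (primrec_other.comp (hc'.comp Primrec.fst))).and (primrec_attacks (hp'.comp Primrec.fst)
      Primrec.snd (primrec_loc.comp (Primrec.snd.comp Primrec.fst))))

theorem primrec_canGo (hp : Primrec p) (ha : Primrec a) (ht : Primrec t) :
    PrimrecPred fun x => (p x).CanGo (a x) (t x) := by
  have hl := primrec_loc.comp ha
  have hc := primrec_color.comp ha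
  have hk : PrimrecPred fun x => (a x).kind = Kind.pawn :=
    Primrec.eq.comp (primrec_kind.comp ha) (Primrec.const _)
  have hat := primrec_attacks hp ha ht
  have hstep : PrimrecPred fun x => t x = ((a x).loc.1, (a x).loc.2 + (a x).color.forward) :=
    Primrec.eq.comp ht (Primrec.pair (Primrec.fst.comp hl)
      (Primrec.int_add.comp (Primrec.snd.comp hl) (primrec_forward.comp hc)))
  refine ((primrec_occupiedBy hp hc ht).not.and
    ((hk.imp ((hstep.and (primrec_occupied hp ht).not).or
      (hat.and (primrec_occupiedBy hp (primrec_other.comp hc) ht)))).and (hk.not.imp hat))).of_eq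
    fun x => ?_
  unfold Position.CanGo
  split_ifs with h <;> simp [h]

theorem primrec_play (hp : Primrec p) (hi : Primrec i) (ht : Primrec t) :
    Primrec fun x => (p x).play (i x) (t x) := by
  refine primrec_position_mk ?_ (primrec_other.comp (primrec_turn.comp hp))
  refine Primrec.list_mapIdx (g := fun y : α × ℕ × Piece =>
    if y.2.1 = i y.1 then { y.2.2 with loc := t y.1 }
    else if y.2.2.alive = true ∧ y.2.2.loc = t y.1 then { y.2.2 with alive := false, loc := (0, 0) }
    else y.2.2) ⟨.white, .king, false, (0, 0)⟩ (primrec_pieces.comp hp) ?_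
  have hb := (Primrec.snd (α := ℕ) (β := Piece)).comp (Primrec.snd (α := α))
  have ht' := ht.comp (Primrec.fst (α := α) (β := ℕ × Piece))
  exact Primrec.ite (Primrec.eq.comp (Primrec.fst.comp Primrec.snd) (hi.comp Primrec.fst))
    (primrec_piece_mk (primrec_color.comp hb) (primrec_kind.comp hb) (primrec_alive.comp hb) ht')
    (Primrec.ite ((primrec_isAlive hb).and (Primrec.eq.comp (primrec_loc.comp hb) ht'))
      (primrec_piece_mk (primrec_color.comp hb) (primrec_kind.comp hb) (Primrec.const _)
        (Primrec.const _)) hb)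

theorem primrec_legalMove (hp : Primrec p) (hi : Primrec i) (ht : Primrec t) :
    PrimrecPred fun x => (p x).LegalMove (i x) (t x) := by
  refine (PrimrecPred.ex_mem (f := fun x => ((p x).pieces[i x]?).toList)
    (R := fun y : α × Piece => y.2.alive = true ∧ y.2.color = (p y.1).turn ∧
      (p y.1).CanGo y.2 (t y.1) ∧ ¬ ((p y.1).play (i y.1) (t y.1)).InCheck (p y.1).turn)
    (Primrec.optionToList.comp (Primrec.list_getElem?.comp (primrec_pieces.comp hp) hi)) ?_).of_eq
    fun x => ?_
  · have hp' := hp.comp (Primrec.fst (α := α) (β := Piece))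
    have ht' := ht.comp (Primrec.fst (α := α) (β := Piece))
    have hc := primrec_turn.comp hp'
    exact (primrec_isAlive Primrec.snd).and
      ((Primrec.eq.comp (primrec_color.comp Primrec.snd) hc).and
        ((primrec_canGo hp' Primrec.snd ht').and
          (primrec_inCheck (primrec_play hp' (hi.comp Primrec.fst) ht') hc).not))
  · simp only [Option.mem_toList]
    rfl

/-! ### Primitive recursive search for moves and closed families -/

theorem primrec_intBox : Primrec intBox :=
  Primrec.list_map
    (Primrec.list_range.comp (Primrec.succ.comp (Primrec.nat_mul.comp (Primrec.const 2) Primrec.id)))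
    (Primrec.int_sub.comp (Primrec.int_natCast.comp Primrec.snd)
      (Primrec.int_natCast.comp Primrec.fst)).to₂

theorem primrec_movesIn (hX : Primrec X) (hp : Primrec p) :
    Primrec fun x => movesIn (X x) (p x) := by
  classical
  have hb := primrec_intBox.comp hX
  refine Primrec.list_map (Primrec.filter
    (R := fun y : α × ℕ × ℤ × ℤ => (p y.1).LegalMove y.2.1 y.2.2)
    (Primrec.list_product (Primrec.list_range.comp (Primrec.list_length.comp
      (primrec_pieces.comp hp))) (Primrec.list_product hb hb)) ?_) ?_
  · exact primrec_legalMove (hp.comp Primrec.fst) (Primrec.fst.comp Primrec.snd)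
      (Primrec.snd.comp Primrec.snd)
  · exact (primrec_play (hp.comp Primrec.fst) (Primrec.fst.comp Primrec.snd)
      (Primrec.snd.comp Primrec.snd)).to₂

theorem primrec_level : Primrec level :=
  (Primrec.nat_rec₁ (8, 1) (f := fun _ (x : ℕ × ℕ) =>
    (2 * (x.1.factorial * x.1) + x.1.factorial * x.2, x.1.factorial * x.2)) (by
      have h₁ := (Primrec.fst (α := ℕ) (β := ℕ)).comp (Primrec.snd (α := ℕ))
      have h₂ := (Primrec.snd (α := ℕ) (β := ℕ)).comp (Primrec.snd (α := ℕ))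
      have hf := Primrec.nat_factorial.comp h₁
      have h₃ := Primrec.nat_mul.comp hf h₂
      exact ((Primrec.nat_add.comp (Primrec.nat_mul.comp (Primrec.const 2)
        (Primrec.nat_mul.comp hf h₁)) h₃).pair h₃).to₂)).of_eq fun n => by
      induction n with
      | zero => rfl
      | succ n ih => simp only [level, ih]

theorem primrec_extendBound {j : α → ℕ} (hj : Primrec j) (hX : Primrec X) :
    Primrec fun x => extendBound (j x) (X x) := by
  have h := primrec_level.comp hj
  exact Primrec.nat_mul.comp (Primrec.nat_factorial.comp (Primrec.fst.comp h))
    (Primrec.nat_add.comp (Primrec.nat_mul.comp (Primrec.fst.comp h) hX) (Primrec.snd.comp h))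

theorem primrec_moveBound {j : α → ℕ} (hj : Primrec j) (hX : Primrec X) :
    Primrec fun x => moveBound (j x) (X x) := by
  have h := Primrec.nat_mul.comp (Primrec.const 2) hj
  exact primrec_extendBound h (primrec_extendBound (Primrec.succ.comp h) hX)

theorem primrec_posSize : Primrec posSize :=
  Primrec.succ.comp (Primrec.list_sum.comp (Primrec.list_map primrec_pieces
    (Primrec.nat_add.comp
      (Primrec.int_natAbs.comp (Primrec.fst.comp (primrec_loc.comp Primrec.snd)))
      (Primrec.int_natAbs.comp (Primrec.snd.comp (primrec_loc.comp Primrec.snd)))).to₂))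

theorem primrec_famSize : Primrec famSize :=
  Primrec.succ.comp (Primrec.list_sum.comp (Primrec.list_map Primrec.id
    (primrec_posSize.comp Primrec.snd).to₂))

theorem primrec_moves {j : α → ℕ} (hj : Primrec j) (hp : Primrec p) :
    Primrec fun x => moves (j x) (p x) :=
  primrec_movesIn (primrec_moveBound hj (primrec_posSize.comp hp)) hp

theorem primrec_exists_oneMove (hp : Primrec p) : PrimrecPred fun x => ∃ q, OneMove (p x) q :=
  (Primrec.eq.comp (primrec_moves (Primrec.const 0) hp) (Primrec.const [])).not.of_eq fun x => by
    rw [exists_oneMove_iff_moves 0 (p x), List.eq_nil_iff_forall_not_mem, not_forall_not]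

theorem primrec_won (hp : Primrec p) (hc : Primrec c) : PrimrecPred fun x => (p x).Won (c x) := by
  have ht := primrec_turn.comp hp
  have ho := primrec_other.comp hc
  exact (((Primrec.eq.comp ht ho).and ((primrec_inCheck hp ho).and
    (primrec_exists_oneMove hp).not)).and (primrec_inCheck hp hc).not).or
      ((Primrec.eq.comp ht hc).and (primrec_inCheck hp ho))

theorem primrec_stalemate (hp : Primrec p) : PrimrecPred fun x => (p x).Stalemate := by
  have ht := primrec_turn.comp hp
  exact (primrec_inCheck hp ht).not.and
    ((primrec_inCheck hp (primrec_other.comp ht)).not.and (primrec_exists_oneMove hp).not)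

theorem primrec_over (hp : Primrec p) : PrimrecPred fun x => (p x).Over :=
  (primrec_won hp (Primrec.const _)).or
    ((primrec_won hp (Primrec.const _)).or (primrec_stalemate hp))

theorem primrec_closed {V : α → List Position} (hc : Primrec c) (hV : Primrec V) :
    PrimrecPred fun x => Closed (c x) {q | q ∈ V x} := by
  refine (PrimrecPred.all_mem (R := fun y : α × Position => ¬ y.2.Over ∧
    (y.2.turn = c y.1 → ∃ q' ∈ V y.1, q' ∈ movesIn (famSize (V y.1)) y.2) ∧
      (y.2.turn ≠ c y.1 → ∀ q' ∈ movesIn (moveBound 0 (famSize (V y.1))) y.2, q' ∈ V y.1))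
    hV ?_).of_eq fun x => (closed_iff (c := c x) (V := V x)).symm
  have hV' := hV.comp (Primrec.fst (α := α) (β := Position))
  have hV'' := hV'.comp (Primrec.fst (β := Position))
  have hX := primrec_famSize.comp hV'
  have ht : PrimrecPred fun y : α × Position => y.2.turn = c y.1 :=
    Primrec.eq.comp (primrec_turn.comp Primrec.snd) (hc.comp Primrec.fst)
  refine (primrec_over Primrec.snd).not.and ((ht.imp ?_).and (ht.not.imp ?_))
  · exact PrimrecPred.ex_mem (R := fun z : (α × Position) × Position =>
      z.2 ∈ movesIn (famSize (V z.1.1)) z.1.2) hV' (PrimrecPred.mem_list Primrec.snd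
        (primrec_movesIn (hX.comp Primrec.fst) (Primrec.snd.comp Primrec.fst)))
  · exact PrimrecPred.all_mem (R := fun z : (α × Position) × Position => z.2 ∈ V z.1.1)
      (primrec_movesIn (primrec_moveBound (Primrec.const 0) hX) Primrec.snd)
      (PrimrecPred.mem_list Primrec.snd hV'')

theorem primrec_families : Primrec fun x : ℕ × List Position => families x.1 x.2 := by
  -- The second argument changes in the recursive calls, so the recursion is a course-of-values one
  -- along the first: `l` lists the calls, of smaller measure, and `g` assembles their values.
  refine Primrec.nat_omega_rec' (m := Prod.fst)
    (l := fun x => if x.1 = 0 then [] else (enlargements (x.1 - 1) x.2).map (Prod.mk (x.1 - 1)))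
    (g := fun x r => some (x.2 :: r.flatten)) _ Primrec.fst ?_ ?_ ?_ ?_
  · refine Primrec.ite (Primrec.eq.comp Primrec.fst (Primrec.const 0)) (Primrec.const []) ?_
    have h₁ : Primrec fun x : ℕ × List Position => x.1 - 1 := Primrec.pred.comp Primrec.fst
    refine Primrec.list_map (f := fun x : ℕ × List Position => enlargements (x.1 - 1) x.2)
      (Primrec.list_flatMap Primrec.snd ?_) ((h₁.comp Primrec.fst).pair Primrec.snd).to₂
    refine (Primrec.list_map (primrec_movesIn (primrec_moveBound
      (Primrec.succ.comp (h₁.comp Primrec.fst))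
      (primrec_famSize.comp (Primrec.snd.comp Primrec.fst))) Primrec.snd) (g := fun y q => q :: y.1.2) ?_).to₂
    exact (Primrec.list_cons.comp Primrec.snd (Primrec.snd.comp (Primrec.fst.comp
      (Primrec.fst (α := (ℕ × List Position) × Position) (β := Position))))).to₂
  · exact (Primrec.option_some.comp (Primrec.list_cons.comp (Primrec.snd.comp Primrec.fst)
      (Primrec.list_flatten.comp Primrec.snd))).to₂
  · rintro ⟨_ | n, V⟩ b hb
    · simp at hb
    · simp only [Nat.succ_ne_zero, if_false, List.mem_map] at hb
      obtain ⟨W, -, rfl⟩ := hb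
      exact Nat.lt_succ_self n
  · rintro ⟨_ | n, V⟩
    · simp [families]
    · simp [families, Function.comp_def]

/-- The closed families of at most `k` positions found by the search from `p`. -/
noncomputable def closedFamilies (c : Color) (k : ℕ) (p : Position) : List (List Position) :=
  open Classical in
  if k = 0 then [] else (families (k - 1) [p]).filter fun W => Closed c {q | q ∈ W}

theorem confinable_iff {c : Color} {k : ℕ} {p : Position} :
    Confinable c k p ↔ ∃ W, W ∈ closedFamilies c k p := by
  rw [Confinable, completable_iff, closedFamilies]
  split_ifs with h
  · simp [h]
  · simp [h]

theorem mem_closedFamilies {c : Color} {k : ℕ} {p : Position} {W : List Position}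
    (h : W ∈ closedFamilies c k p) :
    Closed c {q | q ∈ W} ∧ W.length ≤ k ∧ p ∈ W := by
  rw [closedFamilies] at h
  split_ifs at h with hk
  · simp at h
  · simp only [List.mem_filter, decide_eq_true_eq] at h
    obtain ⟨h₁, h₂⟩ := subset_and_length_of_mem_families h.1
    rw [List.length_singleton] at h₂
    exact ⟨h.2, by omega, h₁ (List.mem_singleton_self p)⟩

theorem primrec_closedFamilies {k : α → ℕ} (hc : Primrec c) (hk : Primrec k) (hp : Primrec p) :
    Primrec fun x => closedFamilies (c x) (k x) (p x) := by
  classical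
  refine (Primrec.ite (Primrec.eq.comp hk (Primrec.const 0)) (Primrec.const [])
    (Primrec.filter (R := fun y : α × List Position => Closed (c y.1) {q | q ∈ y.2})
      (primrec_families.comp ((Primrec.pred.comp hk).pair
        (Primrec.list_cons.comp hp (Primrec.const []))))
      (primrec_closed (hc.comp Primrec.fst) Primrec.snd))).of_eq fun x => ?_
  rw [closedFamilies]
  congr!

theorem primrec_confinable {k : α → ℕ} (hc : Primrec c) (hk : Primrec k) (hp : Primrec p) :
    PrimrecPred fun x => Confinable (c x) (k x) (p x) :=
  (Primrec.eq.comp (primrec_closedFamilies hc hk hp) (Primrec.const [])).not.of_eq fun x => by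
    rw [confinable_iff, List.eq_nil_iff_forall_not_mem, not_forall_not]

end Context

theorem primrec_pairwise {α : Type*} [Primcodable α] {R : α → α → Prop} (hR : PrimrecRel R) :
    PrimrecPred fun l : List α => l.Pairwise R := by
  refine (PrimrecPred.all_mem (f := fun l : List α => List.range l.length)
    (R := fun y : List α × ℕ => ∀ j ∈ List.range y.2, ∀ b ∈ (y.1[y.2]?).toList,
      ∀ a ∈ (y.1[j]?).toList, R a b) (Primrec.list_range.comp Primrec.list_length) ?_).of_eq
      fun l => ?_
  · refine PrimrecPred.all_mem (R := fun y : (List α × ℕ) × ℕ => ∀ b ∈ (y.1.1[y.1.2]?).toList,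
      ∀ a ∈ (y.1.1[y.2]?).toList, R a b) (Primrec.list_range.comp Primrec.snd) ?_
    refine PrimrecPred.all_mem (R := fun y : ((List α × ℕ) × ℕ) × α =>
      ∀ a ∈ (y.1.1.1[y.1.2]?).toList, R a y.2) (Primrec.optionToList.comp
      (Primrec.list_getElem?.comp (Primrec.fst.comp Primrec.fst)
        (Primrec.snd.comp Primrec.fst))) ?_
    refine PrimrecPred.all_mem (R := fun y : (((List α × ℕ) × ℕ) × α) × α => R y.2 y.1.2)
      (Primrec.optionToList.comp (Primrec.list_getElem?.comp (Primrec.fst.comp (Primrec.fst.comp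
        Primrec.fst)) (Primrec.snd.comp Primrec.fst))) ?_
    exact hR.comp Primrec.snd (Primrec.snd.comp Primrec.fst)
  · rw [List.pairwise_iff_getElem]
    simp only [List.mem_range, Option.mem_toList]
    constructor
    · intro h i j hi hj hij
      exact h j hj i hij _ (List.getElem?_eq_getElem hj) _ (List.getElem?_eq_getElem hi)
    · intro h j hj i hij b hb a ha
      obtain ⟨hj, rfl⟩ := List.getElem?_eq_some_iff.1 hb
      obtain ⟨hi, rfl⟩ := List.getElem?_eq_some_iff.1 ha
      exact h i j hi hj hij

theorem primrec_valid : PrimrecPred Position.Valid := by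
  have hcount (c : Color) : PrimrecPred fun p : Position =>
      p.pieces.countP (fun a => a.color = c ∧ a.kind = Kind.king) ≤ 1 := by
    refine (Primrec.nat_le.comp (Primrec.list_length.comp (Primrec.filter
      (R := fun y : Position × Piece => y.2.color = c ∧ y.2.kind = Kind.king) primrec_pieces
      ((Primrec.eq.comp (primrec_color.comp Primrec.snd) (Primrec.const c)).and
        (Primrec.eq.comp (primrec_kind.comp Primrec.snd) (Primrec.const _)))))
      (Primrec.const 1)).of_eq fun p => ?_
    rw [List.countP_eq_length_filter]
  have hdisj : PrimrecPred fun p : Position => p.pieces.Pairwise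
      fun a b => ¬ (a.alive = true ∧ b.alive = true ∧ a.loc = b.loc) :=
    (primrec_pairwise (R := fun a b : Piece =>
      ¬ (a.alive = true ∧ b.alive = true ∧ a.loc = b.loc))
      ((primrec_isAlive Primrec.fst).and ((primrec_isAlive Primrec.snd).and
        (Primrec.eq.comp (primrec_loc.comp Primrec.fst)
          (primrec_loc.comp Primrec.snd)))).not).comp primrec_pieces
  have hcap : PrimrecPred fun p : Position => ∀ a ∈ p.pieces, a.alive = false → a.loc = (0, 0) :=
    PrimrecPred.all_mem (R := fun y : Position × Piece => y.2.alive = false → y.2.loc = (0, 0))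
      primrec_pieces ((Primrec.eq.comp (primrec_alive.comp Primrec.snd) (Primrec.const false)).imp
        (Primrec.eq.comp (primrec_loc.comp Primrec.snd) (Primrec.const _)))
  refine (((hcount .white).and (hcount .black)).and (hdisj.and hcap)).of_eq fun p => ?_
  constructor
  · rintro ⟨⟨h₁, h₂⟩, h₃, h₄⟩
    exact ⟨fun c => by cases c <;> assumption, h₃, h₄⟩
  · rintro ⟨h₁, h₃, h₄⟩
    exact ⟨⟨h₁ _, h₁ _⟩, h₃, h₄⟩

/-! ### Computable strategies -/

/-- Goals that are primitive recursive and depend only on bounded features of the position. -/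
structure IsGoal (G : Color → ℕ → Position → Prop) : Prop where
  transfer : ∀ c k R p p', Sim (k + 1) R → PosRel R p p' → G c k p → G c k p'
  primrec : PrimrecPred fun x : Color × ℕ × Position => G x.1 x.2.1 x.2.2

section Goal

variable {G : Color → ℕ → Position → Prop}

theorem IsGoal.primrec_forced' (hG : IsGoal G) : PrimrecPred fun x : (Color × ℕ) × ℕ × Position =>
    Forced x.1.1 (G x.1.1 x.1.2) x.2.1 x.2.2 := by
  classical
  refine Primrec.primrecPred ?_
  have hn : Primrec fun x : (Color × ℕ) × ℕ × Position => x.2.1 := Primrec.fst.comp Primrec.snd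
  have hp : Primrec fun x : (Color × ℕ) × ℕ × Position => x.2.2 := Primrec.snd.comp Primrec.snd
  have hc : Primrec fun x : (Color × ℕ) × ℕ × Position => x.1.1 := Primrec.fst.comp Primrec.fst
  have hk : Primrec fun x : (Color × ℕ) × ℕ × Position => x.1.2 := Primrec.snd.comp Primrec.fst
  refine Primrec.nat_omega_rec' (m := fun x => x.2.1)
    -- The calls are the representative moves with one ply less. Only their truth values come back,
    -- so "some successor" reads `true ∈ r` and "every successor" reads `false ∉ r`.
    (l := fun x => if x.2.1 = 0 then [] else
      (moves (x.1.2 + 1 + (x.2.1 - 1)) x.2.2).map fun q => (x.1, x.2.1 - 1, q))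
    (g := fun x r => some (decide (G x.1.1 x.1.2 x.2.2 ∨ (x.2.1 ≠ 0 ∧ ¬ x.2.2.Over ∧
      (x.2.2.turn = x.1.1 → true ∈ r) ∧ (x.2.2.turn ≠ x.1.1 → ¬ false ∈ r))))) _ hn ?_ ?_ ?_ ?_
  · have hn' := Primrec.pred.comp hn
    refine Primrec.ite (Primrec.eq.comp hn (Primrec.const 0)) (Primrec.const [])
      (Primrec.list_map (primrec_moves (Primrec.nat_add.comp (Primrec.succ.comp hk) hn') hp)
        ((Primrec.fst.comp Primrec.fst).pair ((hn'.comp Primrec.fst).pair Primrec.snd)).to₂)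
  · refine Primrec.option_some.comp (PrimrecPred.decide
      (p := fun y : ((Color × ℕ) × ℕ × Position) × List Bool => G y.1.1.1 y.1.1.2 y.1.2.2 ∨
        (y.1.2.1 ≠ 0 ∧ ¬ y.1.2.2.Over ∧ (y.1.2.2.turn = y.1.1.1 → true ∈ y.2) ∧
          (y.1.2.2.turn ≠ y.1.1.1 → ¬ false ∈ y.2))) ?_)
    have ht : PrimrecPred fun y : ((Color × ℕ) × ℕ × Position) × List Bool =>
        y.1.2.2.turn = y.1.1.1 :=
      Primrec.eq.comp (primrec_turn.comp (hp.comp Primrec.fst)) (hc.comp Primrec.fst)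
    exact (hG.primrec.comp ((hc.pair (hk.pair hp)).comp Primrec.fst)).or
      ((Primrec.eq.comp (hn.comp Primrec.fst) (Primrec.const 0)).not.and
        ((primrec_over (hp.comp Primrec.fst)).not.and
          ((ht.imp (PrimrecPred.mem_list (Primrec.const true) Primrec.snd)).and
            (ht.not.imp (PrimrecPred.mem_list (Primrec.const false) Primrec.snd).not))))
  · rintro ⟨⟨c, k⟩, _ | n, p⟩ b hb
    · simp at hb
    · simp only [Nat.succ_ne_zero, if_false, List.mem_map] at hb
      obtain ⟨W, -, rfl⟩ := hb
      exact Nat.lt_succ_self n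
  · rintro ⟨⟨c, k⟩, _ | n, p⟩
    · simp only [Forced, ne_eq, not_true_eq_false, false_and, or_false]
      congr!
    · simp only [forced_succ_iff (hG.transfer c k)]
      simp

variable {α : Type*} [Primcodable α]

theorem IsGoal.primrec_forced (hG : IsGoal G) {c : α → Color} {k n : α → ℕ} {p : α → Position}
    (hc : Primrec c) (hk : Primrec k) (hn : Primrec n) (hp : Primrec p) :
    PrimrecPred fun x => Forced (c x) (G (c x) (k x)) (n x) (p x) :=
  hG.primrec_forced'.comp ((hc.pair hk).pair (hn.pair hp))

open Classical in
/-- The candidates for good moves when the rank is `n`. -/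
noncomputable def goodMoves (G : Color → ℕ → Position → Prop) (c : Color) (k n : ℕ)
    (p : Position) : List Position :=
  (moves (k + 1 + n) p).filter fun q => Forced c (G c k) n q

open Classical in
/-- Moves to a position of smaller rank, as soon as the rank of the present position is found. -/
noncomputable def rankMove (G : Color → ℕ → Position → Prop) (c : Color) (k : ℕ) (p : Position) :
    Part Position :=
  (Nat.rfind fun n => Part.some (decide (Forced c (G c k) n p))).bind fun n =>
    Part.ofOption (goodMoves G c k (n - 1) p).head?

open Classical in
/-- The first move found after which `c` cannot force the goal within `n` plies, for `n` as large
as possible below the given bound; an arbitrary legal move if there is none. -/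
noncomputable def delayOption (G : Color → ℕ → Position → Prop) (c : Color) (k : ℕ)
    (p : Position) : ℕ → Option Position
  | 0 => (moves 0 p).head?
  | n + 1 => ((moves (k + 1 + n) p).filter fun q => ¬ Forced c (G c k) n q).head? <|>
      delayOption G c k p n

/-- Delays the goal as long as possible up to the horizon `m`. -/
noncomputable def delay (G : Color → ℕ → Position → Prop) (c : Color) (k m : ℕ) (p : Position) :
    Position :=
  (delayOption G c k p (2 * m + 1)).getD p

theorem oneMove_of_mem_rankMove {c : Color} {k : ℕ} {p q : Position} (h : q ∈ rankMove G c k p) :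
    OneMove p q := by
  obtain ⟨n, -, hq⟩ := Part.mem_bind_iff.1 h
  rw [Part.mem_ofOption] at hq
  exact oneMove_of_mem_moves (List.mem_filter.1 (List.mem_of_mem_head? hq)).1

/-- The search stops at the exact rank `n + 1`, and the chosen move leads to rank at most `n`.
Minimality makes the conclusion uniform in `m`, so one strategy serves every bound without being
told it. -/
theorem IsGoal.exists_mem_rankMove (hG : IsGoal G) {c : Color} {k : ℕ} {p : Position}
    (hc : p.turn = c) (hGp : ¬ G c k p) (h : ∃ m, Forced c (G c k) m p) :
    ∃ r ∈ rankMove G c k p, ∀ m, Forced c (G c k) (m + 1) p → Forced c (G c k) m r := by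
  classical
  obtain ⟨m, hm⟩ := h
  obtain ⟨n, hn, -⟩ := Nat.rfind_min' (p := fun n => decide (Forced c (G c k) n p)) (m := m)
    (by simpa using hm)
  have hF : Forced c (G c k) n p := by
    have := Nat.rfind_spec hn
    exact of_decide_eq_true (Part.mem_some_iff.1 this).symm
  have hmin : ∀ m, Forced c (G c k) m p → n ≤ m := by
    intro m hm
    by_contra hlt
    have := Nat.rfind_min hn (not_le.1 hlt)
    exact of_decide_eq_false (Part.mem_some_iff.1 this).symm hm
  obtain _ | n := n
  · exact absurd hF hGp
  have hF' := ((forced_succ_iff (hG.transfer c k) n p).1 hF).resolve_left hGp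
  obtain ⟨q, hq, hqF⟩ := hF'.2.1 hc
  have hne : goodMoves G c k n p ≠ [] :=
    List.ne_nil_of_mem (List.mem_filter.2 ⟨hq, by simpa using hqF⟩)
  have hhead := List.head?_eq_some_head hne
  refine ⟨(goodMoves G c k n p).head hne, Part.mem_bind_iff.2 ⟨n + 1, hn, ?_⟩, fun m hm => ?_⟩
  · rw [Part.mem_ofOption, Nat.add_sub_cancel, hhead]
    rfl
  · have := (List.mem_filter.1 (List.head_mem hne)).2
    have hmn := hmin _ hm
    exact (of_decide_eq_true this).mono (by omega)

/-- The largest bound is tried first: a move that escapes forcing within `n` plies escapes it within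
fewer. If no listed move escapes, `p` itself is forced within `n + 1` plies, the claim for `m = n`
is vacuous, and the search descends. -/
theorem IsGoal.delayOption_spec (hG : IsGoal G) {c : Color} {k : ℕ} {p : Position}
    (ho : ¬ p.Over) (n : ℕ) : ∃ q, delayOption G c k p n = some q ∧ OneMove p q ∧
      (p.turn ≠ c → ∀ m < n, ¬ Forced c (G c k) (m + 1) p → ¬ Forced c (G c k) m q) := by
  classical
  induction n with
  | zero =>
    obtain ⟨q, hq⟩ := (exists_oneMove_iff_moves 0 p).1 (exists_oneMove_of_not_over ho)
    have hne := List.ne_nil_of_mem hq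
    exact ⟨_, List.head?_eq_some_head hne, oneMove_of_mem_moves (List.head_mem hne),
      fun _ m hm => absurd hm (Nat.not_lt_zero m)⟩
  | succ n ih =>
    rw [delayOption]
    by_cases hne : ((moves (k + 1 + n) p).filter fun q => ¬ Forced c (G c k) n q) = []
    · obtain ⟨q, hq, hm, hF⟩ := ih
      refine ⟨q, by rw [hne, hq]; rfl, hm, fun hc m hmn hmF => hF hc m ?_ hmF⟩
      refine lt_of_le_of_ne (by omega) ?_
      rintro rfl
      refine hmF (Or.inr ⟨ho, fun h => absurd h hc, fun _ => ?_⟩)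
      rw [forall_forced_iff (hG.transfer c k)]
      intro q' hq'
      by_contra hcon
      exact List.ne_nil_of_mem (List.mem_filter.2 ⟨hq', by simpa using hcon⟩) hne
    · have hmem := List.mem_filter.1 (List.head_mem hne)
      refine ⟨_, by rw [List.head?_eq_some_head hne]; rfl, oneMove_of_mem_moves hmem.1,
        fun _ m hm _ hF => ?_⟩
      exact of_decide_eq_true hmem.2 (hF.mono (by omega))

theorem mem_positional_concat {W : Position → Part Position} {h : List Position} {q r : Position} :
    r ∈ positional W (h ++ [q]) ↔ r ∈ W q := by
  change r ∈ (Part.ofOption (h ++ [q]).getLast?).bind W ↔ _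
  rw [List.getLast?_concat]
  change r ∈ (Part.some q).bind W ↔ _
  rw [Part.bind_some]

theorem legal_rankMove (c : Color) (k : ℕ) : Legal (positional fun p => rankMove G c k p) c := by
  intro h p q _ _ _ hq
  exact oneMove_of_mem_rankMove (mem_positional_concat.1 hq)

theorem IsGoal.forces_rankMove (hG : IsGoal G) {c : Color} {k n : ℕ} {p : Position}
    (h : Forced c (G c k) (plies c n p) p) :
    Forces (positional fun p => rankMove G c k p) c (G c k) n p :=
  forces_of_forced (fun _ _ hc _ hGq hm =>
    let ⟨r, hr, hF⟩ := hG.exists_mem_rankMove hc hGq hm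
    ⟨r, mem_positional_concat.2 hr, hF⟩) h

theorem IsGoal.legal_delay (hG : IsGoal G) (c : Color) (k m : ℕ) :
    Legal (positional fun p => Part.some (delay G c k m p)) c.other := by
  intro h p q _ _ ho hq
  have hq := Part.mem_some_iff.1
    (mem_positional_concat (W := fun p => Part.some (delay G c k m p)).1 hq)
  obtain ⟨r, hr, hm, -⟩ := hG.delayOption_spec (c := c) (k := k) ho (2 * m + 1)
  rw [hq, delay, hr]
  exact hm

theorem IsGoal.avoids_delay (hG : IsGoal G) {c : Color} {k m n : ℕ} (hn : n ≤ m) {p : Position}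
    (h : ¬ Forced c (G c k) (plies c n p) p) :
    Avoids (positional fun p => Part.some (delay G c k m p)) c (G c k) n p := by
  refine avoids_of_not_forced (N := 2 * m + 1) (fun h q hc ho i hi hF => ?_) ?_ h
  · obtain ⟨r, hr, -, hrF⟩ := hG.delayOption_spec (c := c) (k := k) ho (2 * m + 1)
    refine ⟨delay G c k m q, mem_positional_concat.2 (Part.mem_some _), ?_⟩
    rw [delay, hr]
    exact hrF (Color.ne_iff.2 hc) i hi hF
  -- The horizon `2 * m + 1` also covers an initial ply of the opponent before the first move of
  -- `c`.
  · have := plies_zero_le c p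
    rw [plies_eq]
    omega

/-- Determinacy: if the goal is not forced in the recursive sense, the delaying strategy avoids it,
and no strategy of `c` can overcome that. -/
theorem IsGoal.canForce_iff (hG : IsGoal G) {c : Color} {k n : ℕ} {p : Position} (hp : p.Valid) :
    CanForce c (G c k) n p ↔ Forced c (G c k) (plies c n p) p := by
  refine ⟨fun ⟨σ, hσ, hF⟩ => ?_, fun h => ⟨_, legal_rankMove c k, hG.forces_rankMove h⟩⟩
  by_contra hno
  exact lt_irrefl n (lt_of_avoids_of_forces hp hσ (hG.legal_delay c k n) hF
    (hG.avoids_delay le_rfl hno))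

theorem IsGoal.avoids_of_canAvoid (hG : IsGoal G) {c : Color} {k m n : ℕ} (hn : n ≤ m)
    {p : Position} (hp : p.Valid) (h : CanAvoid c (G c k) n p) :
    Avoids (positional fun p => Part.some (delay G c k m p)) c (G c k) n p := by
  refine hG.avoids_delay hn fun hF => ?_
  obtain ⟨τ, hτ, hA⟩ := h
  exact lt_irrefl n (lt_of_avoids_of_forces hp (legal_rankMove c k) hτ (hG.forces_rankMove hF) hA)

/-- A goal forced within `m` moves can be avoided only for fewer than `m`, so the horizon `m`
already yields optimal delay. -/
theorem IsGoal.avoids_of_canForce (hG : IsGoal G) {c : Color} {k m n : ℕ} {p : Position}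
    (hp : p.Valid) (hF : CanForce c (G c k) m p) (h : CanAvoid c (G c k) n p) :
    Avoids (positional fun p => Part.some (delay G c k m p)) c (G c k) n p := by
  obtain ⟨σ, hσ, hF⟩ := hF
  obtain ⟨τ, hτ, hA⟩ := id h
  exact hG.avoids_of_canAvoid (lt_of_avoids_of_forces hp hσ hτ hF hA).le hp h

theorem IsGoal.primrec_goodMoves (hG : IsGoal G) {c : α → Color} {k n : α → ℕ} {p : α → Position}
    (hc : Primrec c) (hk : Primrec k) (hn : Primrec n) (hp : Primrec p) :
    Primrec fun x => goodMoves G (c x) (k x) (n x) (p x) := by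
  classical
  exact Primrec.filter (R := fun y : α × Position =>
      Forced (c y.1) (G (c y.1) (k y.1)) (n y.1) y.2)
    (primrec_moves (Primrec.nat_add.comp (Primrec.succ.comp hk) hn) hp)
    (hG.primrec_forced (hc.comp Primrec.fst) (hk.comp Primrec.fst) (hn.comp Primrec.fst)
      Primrec.snd)

/-- The search for the rank is unbounded, hence only partial recursiveness, although each test in it
is primitive recursive. -/
theorem IsGoal.partrec_rankMove (hG : IsGoal G) {c : α → Color} {k : α → ℕ} {p : α → Position}
    (hc : Primrec c) (hk : Primrec k) (hp : Primrec p) :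
    Partrec fun x => rankMove G (c x) (k x) (p x) := by
  classical
  refine Partrec.bind (Partrec.rfind (p := fun x n =>
    Part.some (decide (Forced (c x) (G (c x) (k x)) n (p x)))) ?_) ?_
  · exact (hG.primrec_forced (hc.comp Primrec.fst) (hk.comp Primrec.fst) Primrec.snd
      (hp.comp Primrec.fst)).decide.to_comp.partrec
  · exact (Primrec.list_head?.comp (hG.primrec_goodMoves (hc.comp Primrec.fst)
      (hk.comp Primrec.fst) (Primrec.pred.comp Primrec.snd)
      (hp.comp Primrec.fst))).to_comp.ofOption

theorem IsGoal.primrec_delay (hG : IsGoal G) {c : α → Color} {k m : α → ℕ} {p : α → Position}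
    (hc : Primrec c) (hk : Primrec k) (hm : Primrec m) (hp : Primrec p) :
    Primrec fun x => delay G (c x) (k x) (m x) (p x) := by
  classical
  refine Primrec.option_getD.comp ?_ hp
  refine (Primrec.nat_rec' (f := fun x => 2 * m x + 1) (g := fun x => (moves 0 (p x)).head?)
    (h := fun x y => ((moves (k x + 1 + y.1) (p x)).filter fun q =>
      ¬ Forced (c x) (G (c x) (k x)) y.1 q).head? <|> y.2)
    (Primrec.succ.comp (Primrec.nat_mul.comp (Primrec.const 2) hm))
    (Primrec.list_head?.comp (primrec_moves (Primrec.const 0) hp)) ?_).of_eq fun x => ?_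
  · have hn : Primrec fun y : α × ℕ × Option Position => y.2.1 := Primrec.fst.comp Primrec.snd
    refine (Primrec.option_orElse.comp (Primrec.list_head?.comp (Primrec.filter
      (R := fun z : (α × ℕ × Option Position) × Position =>
        ¬ Forced (c z.1.1) (G (c z.1.1) (k z.1.1)) z.1.2.1 z.2)
      (primrec_moves (Primrec.nat_add.comp (Primrec.succ.comp (hk.comp Primrec.fst)) hn)
        (hp.comp Primrec.fst)) ?_)) (Primrec.snd.comp Primrec.snd)).to₂
    have h₁ := Primrec.fst.comp (Primrec.fst (α := α × ℕ × Option Position) (β := Position))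
    exact (hG.primrec_forced (hc.comp h₁) (hk.comp h₁) (hn.comp Primrec.fst) Primrec.snd).not
  · induction 2 * m x + 1 with
    | zero => rfl
    | succ n ih =>
      rw [delayOption, ← ih]

theorem primrec_plies {c : α → Color} {n : α → ℕ} {p : α → Position} (hc : Primrec c)
    (hn : Primrec n) (hp : Primrec p) : Primrec fun x => plies (c x) (n x) (p x) :=
  Primrec.nat_add.comp (Primrec.nat_mul.comp (Primrec.const 2) hn)
    (Primrec.ite (Primrec.eq.comp (primrec_turn.comp hp) hc) (Primrec.const 0) (Primrec.const 1))

theorem IsGoal.computablePred_canForce (hG : IsGoal G) {c : α → Color} {k n : α → ℕ}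
    {p : α → Position} (hc : Primrec c) (hk : Primrec k) (hn : Primrec n) (hp : Primrec p) :
    ComputablePred fun x => (p x).Valid ∧ CanForce (c x) (G (c x) (k x)) (n x) (p x) :=
  (((primrec_valid.comp hp).and
    (hG.primrec_forced hc hk (primrec_plies hc hn hp) hp)).of_eq fun _ =>
      and_congr_right fun hv => (hG.canForce_iff hv).symm).computablePred

end Goal

/-! ### The three goals -/

theorem isGoal_mate : IsGoal fun c _ p => mateGoal c p where
  transfer c _ _ _ _ hR hp h := (hR.won_iff hp c).1 h
  primrec := primrec_won (Primrec.snd.comp Primrec.snd) Primrec.fst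

theorem isGoal_stalemate : IsGoal fun c _ p => stalemateGoal c p where
  transfer c _ _ _ _ hR hp h := h.imp (hR.won_iff hp c).1 (hR.stalemate_iff hp).1
  primrec := (primrec_won (Primrec.snd.comp Primrec.snd) Primrec.fst).or
    (primrec_stalemate (Primrec.snd.comp Primrec.snd))

/-- The position is won, or the search finds a family in which the opponent can be confined. -/
def WonOrConfinable (c : Color) (k : ℕ) (p : Position) : Prop := p.Won c ∨ Confinable c k p

theorem isGoal_wonOrConfinable : IsGoal WonOrConfinable where
  transfer c _ _ _ _ hR hp h := h.imp (hR.won_iff hp c).1 (hR.confinable hp)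
  primrec := (primrec_won (Primrec.snd.comp Primrec.snd) Primrec.fst).or
    (primrec_confinable Primrec.fst (Primrec.fst.comp Primrec.snd) (Primrec.snd.comp Primrec.snd))

theorem repetitionGoal_iff {c : Color} {k : ℕ} {p : Position} (hp : p.Valid) :
    repetitionGoal c k p ↔ WonOrConfinable c k p :=
  or_congr_right (canConfine_iff hp)

theorem canForce_congr {c : Color} {G H : Position → Prop} (hGH : ∀ q, q.Valid → (G q ↔ H q))
    {n : ℕ} {p : Position} (hp : p.Valid) : CanForce c G n p ↔ CanForce c H n p :=
  ⟨fun ⟨σ, hσ, h⟩ => ⟨σ, hσ, h.congr hGH hp⟩,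
    fun ⟨σ, hσ, h⟩ => ⟨σ, hσ, h.congr (fun q hq => (hGH q hq).symm) hp⟩⟩

theorem canAvoid_congr {c : Color} {G H : Position → Prop} (hGH : ∀ q, q.Valid → (G q ↔ H q))
    {n : ℕ} {p : Position} (hp : p.Valid) : CanAvoid c G n p ↔ CanAvoid c H n p :=
  ⟨fun ⟨σ, hσ, h⟩ => ⟨σ, hσ, h.congr hGH hp⟩,
    fun ⟨σ, hσ, h⟩ => ⟨σ, hσ, h.congr (fun q hq => (hGH q hq).symm) hp⟩⟩

theorem drawIn_iff {c : Color} {n k : ℕ} {p : Position} (hp : p.Valid) :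
    DrawIn c n k p ↔ CanForce c (WonOrConfinable c k) n p :=
  canForce_congr (fun _ => repetitionGoal_iff) hp

theorem Position.Won.over {p : Position} {c : Color} (h : p.Won c) : p.Over := by
  cases c
  · exact Or.inl h
  · exact Or.inr (Or.inl h)

/-! ### The strategy for draws by repetition -/

open Classical in
/-- The first position of the history from which the opponent can be confined. -/
noncomputable def firstConfinable (c : Color) (k : ℕ) (h : List Position) : Option Position :=
  (h.filter fun q => Confinable c k q).head?

/-- A move from the last position of the history to a member of the first closed family that is
found for `q`. -/
noncomputable def confiningMove (c : Color) (k : ℕ) (h : List Position) (q : Position) :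
    Option Position :=
  h.getLast?.bind fun r => (closedFamilies c k q).head?.bind fun V =>
    (V.filter fun s => s ∈ movesIn (famSize V) r).head?

/-- Decreases the rank until the opponent can be confined, and then confines the opponent. -/
noncomputable def repetitionMove (c : Color) (k : ℕ) (h : List Position) : Part Position :=
  -- The family is tied to the first confinable position of the history. Recomputing it from later
  -- positions might change the family, and the bound `k` would no longer apply to all visited
  -- positions together.
  bif (firstConfinable c k h).isSome then
    Part.ofOption ((firstConfinable c k h).bind (confiningMove c k h))
  else (Part.ofOption h.getLast?).bind fun p => rankMove WonOrConfinable c k p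

theorem legal_repetitionMove (c : Color) (k : ℕ) : Legal (repetitionMove c k) c := by
  intro h p q hv hc ho hq
  rw [repetitionMove] at hq
  cases hb : (firstConfinable c k (h ++ [p])).isSome <;> rw [hb] at hq
  · exact legal_rankMove c k h p q hv hc ho hq
  · rw [cond_true, Part.mem_ofOption] at hq
    obtain ⟨r, -, hq⟩ := Option.mem_bind_iff.1 hq
    rw [confiningMove, List.getLast?_concat, Option.bind_some] at hq
    obtain ⟨V, -, hq⟩ := Option.mem_bind_iff.1 hq
    have := (List.mem_filter.1 (List.mem_of_mem_head? hq)).2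
    exact oneMove_of_mem_movesIn (of_decide_eq_true this)

theorem firstConfinable_hist {c : Color} {k t : ℕ} {f : ℕ → Position} (ht : Confinable c k (f t))
    (hlt : ∀ s < t, ¬ Confinable c k (f s)) {s : ℕ} (hs : t ≤ s) :
    firstConfinable c k (hist f s) = some (f t) := by
  classical
  rw [firstConfinable, List.head?_filter, List.find?_eq_some_iff_getElem]
  refine ⟨by simpa using ht, t, by rw [length_hist]; omega, by simp [hist], fun j hj => ?_⟩
  simpa [hist] using hlt j hj

theorem firstConfinable_hist_eq_none {c : Color} {k t : ℕ} {f : ℕ → Position}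
    (h : ∀ s ≤ t, ¬ Confinable c k (f s)) : firstConfinable c k (hist f t) = none := by
  classical
  rw [firstConfinable, List.head?_filter, List.find?_eq_none]
  intro q hq
  obtain ⟨s, hs, rfl⟩ := List.mem_map.1 hq
  rw [List.mem_range] at hs
  simpa using h s (by omega)

/-- Once the opponent can be confined, the strategy does so. -/
theorem exists_confining_family {c : Color} {k t : ℕ} {q : Position} (hq : Confinable c k q) :
    ∃ V : List Position, V.length ≤ k ∧ Closed c {r | r ∈ V} ∧
      ∀ p f, IsPlay p f → Follows (repetitionMove c k) c f → f t = q →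
        (∀ s < t, ¬ Confinable c k (f s)) → ∀ s, t ≤ s →
          f s ∈ V ∧ ((f s).turn = c → (repetitionMove c k (hist f s)).Dom) := by
  obtain ⟨W, hW⟩ := confinable_iff.1 hq
  have hne := List.ne_nil_of_mem hW
  have hhead := List.head?_eq_some_head hne
  obtain ⟨hV, hlen, hqV⟩ := mem_closedFamilies (List.head_mem hne)
  refine ⟨_, hlen, hV, fun p f hf hfol hft hlt s hs => ?_⟩
  have hmove : ∀ s, t ≤ s → f s ∈ {r | r ∈ (closedFamilies c k q).head hne} → (f s).turn = c →
      ∃ r ∈ repetitionMove c k (hist f s), r ∈ {r | r ∈ (closedFamilies c k q).head hne} := by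
    intro s hs hsV hc
    rw [closed_iff] at hV
    obtain ⟨r, hr, hrm⟩ := (hV _ hsV).2.1 hc
    have hne' : (((closedFamilies c k q).head hne).filter fun r =>
        r ∈ movesIn (famSize ((closedFamilies c k q).head hne)) (f s)) ≠ [] :=
      List.ne_nil_of_mem (List.mem_filter.2 ⟨hr, decide_eq_true hrm⟩)
    refine ⟨_, ?_, (List.mem_filter.1 (List.head_mem hne')).1⟩
    rw [repetitionMove, firstConfinable_hist (hft ▸ hq) hlt hs, hft, Option.isSome_some, cond_true,
      Option.bind_some, confiningMove, hist_eq, List.getLast?_concat, Option.bind_some, hhead,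
      Option.bind_some, Part.mem_ofOption]
    exact List.head?_eq_some_head hne'
  have hmem : f s ∈ {r | r ∈ (closedFamilies c k q).head hne} :=
    hf.mem_of_closed hV hfol (t := t) (by rw [hft]; exact hqV) hmove hs
  exact ⟨hmem, fun hc => let ⟨r, hr, _⟩ := hmove s hs hmem hc; Part.dom_iff_mem.2 ⟨r, hr⟩⟩

theorem repetitionMove_hist_of_forall_not {c : Color} {k t : ℕ} {f : ℕ → Position}
    (h : ∀ s ≤ t, ¬ Confinable c k (f s)) :
    repetitionMove c k (hist f t) = rankMove WonOrConfinable c k (f t) := by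
  rw [repetitionMove, firstConfinable_hist_eq_none h, Option.isSome_none, cond_false, hist_eq,
    List.getLast?_concat]
  exact Part.bind_some _ _

theorem decreasesRank_repetitionMove {c : Color} {k t : ℕ} {f : ℕ → Position}
    (hc : (f t).turn = c) (hG : ∀ s ≤ t, ¬ WonOrConfinable c k (f s))
    (hm : ∃ m, Forced c (WonOrConfinable c k) m (f t)) :
    DecreasesRank (repetitionMove c k) c (WonOrConfinable c k) (hist f t) (f t) := by
  obtain ⟨r, hr, hF⟩ := isGoal_wonOrConfinable.exists_mem_rankMove hc (hG t le_rfl) hm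
  rw [← repetitionMove_hist_of_forall_not fun s hs h => hG s hs (Or.inr h)] at hr
  exact ⟨r, hr, hF⟩

theorem exists_first {P : ℕ → Prop} {t : ℕ} (h : P t) : ∃ s ≤ t, P s ∧ ∀ r < s, ¬ P r := by
  classical
  exact ⟨Nat.find ⟨t, h⟩, Nat.find_min' _ h, Nat.find_spec ⟨t, h⟩, fun r hr => Nat.find_min _ hr⟩

/-- After the first confinable position the closed family always offers a move. Before it the rank
is still finite, as the goal would otherwise have been reached already, so the search for the rank
ends. -/
theorem repetitionMove_dom {c : Color} {k n : ℕ} {p : Position} {f : ℕ → Position}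
    (h : Forced c (WonOrConfinable c k) n p) (hf : IsPlay p f)
    (hfol : Follows (repetitionMove c k) c f) {t : ℕ} (hc : (f t).turn = c) (ho : ¬ (f t).Over) :
    (repetitionMove c k (hist f t)).Dom := by
  by_cases hcon : ∃ s ≤ t, Confinable c k (f s)
  · obtain ⟨s, hs, hcs⟩ := hcon
    obtain ⟨r, hr, hcr, hmin⟩ := exists_first (P := fun s => Confinable c k (f s)) hcs
    obtain ⟨V, -, -, hV⟩ := exists_confining_family (t := r) hcr
    exact (hV p f hf hfol rfl hmin t (hr.trans hs)).2 hc
  · push Not at hcon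
    have hG : ∀ s ≤ t, ¬ WonOrConfinable c k (f s) := by
      rintro s hs (hw | hcs)
      · exact hf.not_over_of_le ho hs hw.over
      · exact hcon s hs hcs
    have hdec := fun t hc (_ : ¬ (f t).Over) => decreasesRank_repetitionMove (c := c) (k := k)
      (f := f) (t := t) hc
    have hm : ∃ m, Forced c (WonOrConfinable c k) m (f t) := by
      rcases le_total t n with htn | hnt
      · rcases exists_goal_or_forced hf hfol hdec h t htn with ⟨s, hs, hGs⟩ | hF
        · exact absurd hGs (hG s hs)
        · exact ⟨_, hF⟩
      · obtain ⟨s, hs, hGs⟩ := exists_goal_of_forced hf hfol hdec h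
        exact absurd hGs (hG s (hs.trans hnt))
    obtain ⟨r, hr, -⟩ := decreasesRank_repetitionMove hc hG hm
    exact Part.dom_iff_mem.2 ⟨r, hr⟩

theorem forcesRepetition_repetitionMove {c : Color} {k n : ℕ} {p : Position}
    (h : Forced c (WonOrConfinable c k) (plies c n p) p) :
    ForcesRepetition (repetitionMove c k) c n k p := by
  intro f hf hfol
  obtain ⟨t, ht, hG⟩ := exists_goal_of_forced hf hfol
    (fun t hc _ => decreasesRank_repetitionMove hc) h
  rcases hG with hw | hcon
  · exact ⟨t, hf.movesMade_le ht, Or.inl hw⟩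
  obtain ⟨r, hr, hcr, hmin⟩ := exists_first (P := fun s => Confinable c k (f s)) hcon
  refine ⟨r, hf.movesMade_le (hr.trans ht), Or.inr ?_⟩
  -- The family depends only on the position at time `r`, so the same one serves every play with
  -- this history.
  obtain ⟨V, hlen, hVc, hV⟩ := exists_confining_family (t := r) hcr
  classical
  refine ⟨V.toFinset, (List.toFinset_card_le V).trans hlen, fun q g hg hgfol t ht s hs => ?_⟩
  obtain ⟨rfl, hgf⟩ := eq_of_hist_eq ht
  have := (hV q g hg hgfol (hgf t le_rfl) (fun s hs => by rw [hgf s hs.le]; exact hmin s hs) s hs).1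
  exact ⟨List.mem_toFinset.2 this, (hVc _ this).1⟩

theorem primrec_getLast? {α : Type*} [Primcodable α] :
    Primrec (List.getLast? : List α → Option α) :=
  (Primrec.list_head?.comp Primrec.list_reverse).of_eq fun l => by simp

theorem partrec_repetitionMove :
    Partrec fun x : Color × ℕ × List Position => repetitionMove x.1 x.2.1 x.2.2 := by
  classical
  have hk : Primrec fun x : Color × ℕ × List Position => x.2.1 := Primrec.fst.comp Primrec.snd
  have hh : Primrec fun x : Color × ℕ × List Position => x.2.2 := Primrec.snd.comp Primrec.snd
  have hfirst : Primrec fun x : Color × ℕ × List Position =>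
      firstConfinable x.1 x.2.1 x.2.2 :=
    Primrec.list_head?.comp (Primrec.filter
      (R := fun y : (Color × ℕ × List Position) × Position => Confinable y.1.1 y.1.2.1 y.2) hh
      (primrec_confinable (Primrec.fst.comp Primrec.fst) (hk.comp Primrec.fst) Primrec.snd))
  refine Partrec.cond (Primrec.option_isSome.comp hfirst).to_comp
    (Primrec.option_bind hfirst ?_).to_comp.ofOption ?_
  · have hlast : Primrec fun y : (Color × ℕ × List Position) × Position => y.1.2.2.getLast? :=
      primrec_getLast?.comp (hh.comp Primrec.fst)
    refine (Primrec.option_bind hlast (g := fun y r => (closedFamilies y.1.1 y.1.2.1 y.2).head?.bind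
      fun V => (V.filter fun s => s ∈ movesIn (famSize V) r).head?) ?_).to₂
    have hfam : Primrec fun y : ((Color × ℕ × List Position) × Position) × Position =>
        (closedFamilies y.1.1.1 y.1.1.2.1 y.1.2).head? :=
      Primrec.list_head?.comp (primrec_closedFamilies
        (Primrec.fst.comp (Primrec.fst.comp Primrec.fst)) (hk.comp (Primrec.fst.comp Primrec.fst))
        (Primrec.snd.comp Primrec.fst))
    refine (Primrec.option_bind hfam
      (g := fun y V => (V.filter fun s => s ∈ movesIn (famSize V) y.2).head?) ?_).to₂
    refine (Primrec.list_head?.comp (Primrec.filter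
      (R := fun z : ((((Color × ℕ × List Position) × Position) × Position) × List Position) × Position =>
        z.2 ∈ movesIn (famSize z.1.2) z.1.1.2) Primrec.snd ?_)).to₂
    exact PrimrecPred.mem_list Primrec.snd (primrec_movesIn
      (primrec_famSize.comp (Primrec.snd.comp Primrec.fst))
      (Primrec.snd.comp (Primrec.fst.comp Primrec.fst)))
  · exact Partrec.bind (primrec_getLast?.comp hh).to_comp.ofOption
      (isGoal_wonOrConfinable.partrec_rankMove (Primrec.fst.comp Primrec.fst)
        (hk.comp Primrec.fst) Primrec.snd).to₂

end InfiniteChess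

/-! ### The theorem for the three goals -/

open InfiniteChess in
theorem mainTheorem1 :
    -- the mate-in-n problem is decidable
    (ComputablePred fun x : Color × ℕ × Position => x.2.2.Valid ∧ MateIn x.1 x.2.1 x.2.2) ∧
    -- a computable strategy that wins from every mate-in-n position in the fewest moves
    (∃ W : Color × Position →. Position, Partrec W ∧ ∀ c : Color,
      Legal (positional fun p => W (c, p)) c ∧
      ∀ (n : ℕ) (p : Position), p.Valid → MateIn c n p →
        (p.turn = c → ¬ p.Over → (W (c, p)).Dom) ∧
        Forces (positional fun p => W (c, p)) c (mateGoal c) n p) ∧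
    -- computable strategies for the opponent of c: from a mate-in-n position checkmate is delayed as
    -- long as possible, and from any position checkmate is avoided for k moves if this is possible
    (∃ D : Color × ℕ × Position → Position, Computable D ∧ ∀ (c : Color) (k : ℕ),
      Legal (positional fun p => Part.some (D (c, k, p))) c.other ∧
      ∀ p : Position, p.Valid →
        (MateIn c k p → ∀ j, CanAvoid c (mateGoal c) j p →
          Avoids (positional fun p => Part.some (D (c, k, p))) c (mateGoal c) j p) ∧
        (∀ j ≤ k, CanAvoid c (mateGoal c) j p →
          Avoids (positional fun p => Part.some (D (c, k, p))) c (mateGoal c) j p)) ∧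
    -- the stalemate-in-n problem is decidable, with computable optimal strategies for both sides
    (ComputablePred fun x : Color × ℕ × Position => x.2.2.Valid ∧ StalemateIn x.1 x.2.1 x.2.2) ∧
    (∃ W : Color × Position →. Position, Partrec W ∧ ∀ c : Color,
      Legal (positional fun p => W (c, p)) c ∧
      ∀ (n : ℕ) (p : Position), p.Valid → StalemateIn c n p →
        (p.turn = c → ¬ p.Over → (W (c, p)).Dom) ∧
        Forces (positional fun p => W (c, p)) c (stalemateGoal c) n p) ∧
    (∃ D : Color × ℕ × Position → Position, Computable D ∧ ∀ (c : Color) (k : ℕ),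
      Legal (positional fun p => Part.some (D (c, k, p))) c.other ∧
      ∀ p : Position, p.Valid →
        (StalemateIn c k p → ∀ j, CanAvoid c (stalemateGoal c) j p →
          Avoids (positional fun p => Part.some (D (c, k, p))) c (stalemateGoal c) j p) ∧
        (∀ j ≤ k, CanAvoid c (stalemateGoal c) j p →
          Avoids (positional fun p => Part.some (D (c, k, p))) c (stalemateGoal c) j p)) ∧
    -- the draw-in-n-by-k-repetition problem is decidable, with computable optimal strategies for
    -- both sides
    (ComputablePred fun x : Color × ℕ × ℕ × Position =>
      x.2.2.2.Valid ∧ DrawIn x.1 x.2.1 x.2.2.1 x.2.2.2) ∧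
    (∃ W : Color × ℕ × List Position →. Position, Partrec W ∧ ∀ (c : Color) (k : ℕ),
      Legal (fun h => W (c, k, h)) c ∧
      ∀ (n : ℕ) (p : Position), p.Valid → DrawIn c n k p →
        (∀ f, IsPlay p f → Follows (fun h => W (c, k, h)) c f →
          ∀ t, (f t).turn = c → ¬ (f t).Over → (W (c, k, hist f t)).Dom) ∧
        ForcesRepetition (fun h => W (c, k, h)) c n k p) ∧
    (∃ D : Color × ℕ × ℕ × Position → Position, Computable D ∧ ∀ (c : Color) (k m : ℕ),
      Legal (positional fun p => Part.some (D (c, k, m, p))) c.other ∧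
      ∀ p : Position, p.Valid →
        (DrawIn c m k p → ∀ j, CanAvoid c (repetitionGoal c k) j p →
          Avoids (positional fun p => Part.some (D (c, k, m, p))) c (repetitionGoal c k) j p) ∧
        (∀ j ≤ m, CanAvoid c (repetitionGoal c k) j p →
          Avoids (positional fun p => Part.some (D (c, k, m, p))) c (repetitionGoal c k) j p)) := by
  have hc {α : Type} [Primcodable α] : Primrec fun x : Color × α => x.1 := Primrec.fst
  have hn : Primrec fun x : Color × ℕ × Position => x.2.1 := Primrec.fst.comp Primrec.snd
  have hp : Primrec fun x : Color × ℕ × Position => x.2.2 := Primrec.snd.comp Primrec.snd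
  -- Mate and stalemate have no parameter; the parameter of `IsGoal` is set to 0 for them.
  have h0 {α : Type} [Primcodable α] : Primrec fun _ : α => 0 := Primrec.const 0
  refine ⟨isGoal_mate.computablePred_canForce hc h0 hn hp,
    ⟨_, isGoal_mate.partrec_rankMove Primrec.fst h0 Primrec.snd, fun c =>
      ⟨legal_rankMove c 0, fun n p hv h => ⟨fun ht ho => ?_, ?_⟩⟩⟩,
    ⟨_, (isGoal_mate.primrec_delay hc h0 hn hp).to_comp, fun c k =>
      ⟨isGoal_mate.legal_delay c 0 k, fun p hv =>
        ⟨fun h _ hA => isGoal_mate.avoids_of_canForce (k := 0) hv h hA,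
          fun _ hj hA => isGoal_mate.avoids_of_canAvoid (k := 0) hj hv hA⟩⟩⟩,
    isGoal_stalemate.computablePred_canForce hc h0 hn hp,
    ⟨_, isGoal_stalemate.partrec_rankMove Primrec.fst h0 Primrec.snd, fun c =>
      ⟨legal_rankMove c 0, fun n p hv h => ⟨fun ht ho => ?_, ?_⟩⟩⟩,
    ⟨_, (isGoal_stalemate.primrec_delay hc h0 hn hp).to_comp, fun c k =>
      ⟨isGoal_stalemate.legal_delay c 0 k, fun p hv =>
        ⟨fun h _ hA => isGoal_stalemate.avoids_of_canForce (k := 0) hv h hA,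
          fun _ hj hA => isGoal_stalemate.avoids_of_canAvoid (k := 0) hj hv hA⟩⟩⟩,
    ?_, ⟨_, partrec_repetitionMove, fun c k => ⟨legal_repetitionMove c k, fun n p hv h => ?_⟩⟩,
    ⟨_, (isGoal_wonOrConfinable.primrec_delay (α := Color × ℕ × ℕ × Position) hc
        (Primrec.fst.comp Primrec.snd) (Primrec.fst.comp (Primrec.snd.comp Primrec.snd))
        (Primrec.snd.comp (Primrec.snd.comp Primrec.snd))).to_comp,
      fun c k m => ⟨isGoal_wonOrConfinable.legal_delay c k m, fun p hv =>
        ⟨fun h j hA => ?_, fun j hj hA => ?_⟩⟩⟩⟩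
  · obtain ⟨r, hr, -⟩ := isGoal_mate.exists_mem_rankMove (k := 0) ht (fun hG => ho hG.over)
      ⟨_, (isGoal_mate.canForce_iff (k := 0) hv).1 h⟩
    exact Part.dom_iff_mem.2 ⟨r, hr⟩
  · exact isGoal_mate.forces_rankMove ((isGoal_mate.canForce_iff (k := 0) hv).1 h)
  · obtain ⟨r, hr, -⟩ := isGoal_stalemate.exists_mem_rankMove (k := 0) ht
      (fun hG => ho (hG.elim (fun h => h.over) fun h => Or.inr (Or.inr h)))
      ⟨_, (isGoal_stalemate.canForce_iff (k := 0) hv).1 h⟩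
    exact Part.dom_iff_mem.2 ⟨r, hr⟩
  · exact isGoal_stalemate.forces_rankMove ((isGoal_stalemate.canForce_iff (k := 0) hv).1 h)
  · exact (isGoal_wonOrConfinable.computablePred_canForce (α := Color × ℕ × ℕ × Position) hc
      (Primrec.fst.comp (Primrec.snd.comp Primrec.snd)) (Primrec.fst.comp Primrec.snd)
      (Primrec.snd.comp (Primrec.snd.comp Primrec.snd))).of_eq fun x =>
        and_congr_right fun hv => (drawIn_iff hv).symm
  · have hF := (isGoal_wonOrConfinable.canForce_iff hv).1 ((drawIn_iff hv).1 h)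
    exact ⟨fun f hf hfol t ht ho => repetitionMove_dom hF hf hfol ht ho,
      forcesRepetition_repetitionMove hF⟩
  · exact (isGoal_wonOrConfinable.avoids_of_canForce hv ((drawIn_iff hv).1 h)
      ((canAvoid_congr (fun _ => repetitionGoal_iff) hv).1 hA)).congr
        (fun _ hq => (repetitionGoal_iff hq).symm) hv
  · exact (isGoal_wonOrConfinable.avoids_of_canAvoid hj hv
      ((canAvoid_congr (fun _ => repetitionGoal_iff) hv).1 hA)).congr
        (fun _ hq => (repetitionGoal_iff hq).symm) hv
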